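/- **Conventions.** A *concrete 2-category* is a (strict) 2-category $\mathcal C$ equipped with a (strict) 2-functor $|-|\colon\mathcal C\to\mathbf{Cat}$ into small categories; for $F\colon A\to B$ in $\mathcal C$ we write $F(x)=|F|(x)$ and $F(f)=|F|(f)$ for objects $x$ and morphisms $f$ of $|A|$. A *double category* is a pseudo double category: composition of arrows and internal composition of cells are strict, and external composition is associative and unital up to natural, globular, invertible cells satisfying the triangle and pentagon identities. A *lax double functor* strictly preserves sources, targets and internal composition, and has natural globular laxators $F(m)\odot F(n)\to F(m\odot n)$ and unitors $\mathrm{id}_{F(a)}\to F(\mathrm{id}_a)$ satisfying the associativity and unit axioms. For a category $\mathcal S$ with chosen pushouts, $\mathbb{C}\mathrm{sp}(\mathcal S)$ is the double category whose objects and arrows are those of $\mathcal S$, whose proarrows are cospans, whose cells are maps of cospans, and whose external composition is by pushout; a functor $F\colon\mathcal S\to\mathcal T$ induces a lax double functor $\mathbb{C}\mathrm{sp}(F)$, whose laxators are the canonical maps between pushouts. $\mathbb{S}\mathrm{pan}(\mathbf{Cat})$ is the double category of categories, functors, spans of functors and maps of spans, with external composition by strict pullback. The *comma* lax double functor $\mathbb{C}\mathrm{omma}\colon\mathbb{C}\mathrm{sp}(\mathbf{Cat})\to\mathbb{S}\mathrm{pan}(\mathbf{Cat})$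 is the identity on objects and arrows and sends a cospan $A\xrightarrow{i}X\xleftarrow{o}B$ to the span $A\leftarrow i/o\to B$ given by the comma category. It sends a map of cospans $(H,F,K)$ to the map of spans whose apex functor is $(a,f,b)\mapsto(H(a),F(f),K(b))$, $(h,k)\mapsto(H(h),K(k))$. Its laxators send $((a,f,b),(b,g,c))$ to $(a,\iota_Y(g)\circ\iota_X(f),c)$ and $((h,k),(k,\ell))$ to $(h,\ell)$, where $\iota_X,\iota_Y$ are the inclusions into the pushout; its unitors send $a$ to $(a,1_a,a)$ and $h$ to $(h,h)$. The *double Grothendieck construction* $\int F$ of a lax double functor $F\colon\mathbb A\to\mathbb{S}\mathrm{pan}(\mathbf{Cat})$, where $F(m)=(F(a)\xleftarrow{\sigma_m}\mathrm{apex}F(m)\xrightarrow{\tau_m}F(b))$ and $\Phi_{m,n},\Phi_a$ are the apex functors of the laxators and unitors, is the double category with - objects $(a,x)$ with $x\in F(a)$; arrows $(a,x)\to(b,y)$ the pairs $(f\colon a\to b,\ \phi\colon F(f)(x)\to y)$; - proarrows $(a,x)\to(b,y)$ the pairs $(m,s)$ with $m\colon a\to b$ a proarrow and $s\in\mathrm{apex}F(m)$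 with $\sigma_m(s)=x$, $\tau_m(s)=y$; - cells $(m,s)\to(n,t)$ the pairs $(\alpha,\nu)$ with $\alpha\colon m\to n$ a cell and $\nu\colon\mathrm{apex}F(\alpha)(s)\to t$, with boundary arrows given by those of $\alpha$ together with $\sigma_n(\nu)$ and $\tau_n(\nu)$; - external composites $(m\odot n,\Phi_{m,n}(s,t))$ of proarrows and $(\alpha\odot\beta,\Phi_{m',n'}(\mu,\nu))$ of cells, and external identities $(\mathrm{id}_a,\Phi_a(x))$ and $(\mathrm{id}_f,\Phi_b(\phi))$. **Proposition.** Let $\mathcal C$ be a concrete 2-category whose underlying category has pushouts. Then there is a double category that has - as objects, pairs $(A,a)$ of an object $A$ of $\mathcal C$ and an object $a$ of $|A|$; - as arrows $(A,a)\to(A',a')$, pairs $(H,h')$ of a morphism $H\colon A\to A'$ of $\mathcal C$ and a morphism $h'\colon H(a)\to a'$ of $|A'|$; - as proarrows $(A,a)\to(B,b)$, pairs $(m,f)$ of a cospan $m=(A\xrightarrow{i}X\xleftarrow{o}B)$ in $\mathcal C$ and a morphism $f\colon i(a)\to o(b)$ of $|X|$; - as cells from $(m,f)\colon(A,a)\to(B,b)$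 to $(m',f')\colon(A',a')\to(B',b')$, where $m'=(A'\xrightarrow{i'}X'\xleftarrow{o'}B')$, with boundary arrows $(H,h')\colon(A,a)\to(A',a')$ and $(K,k')\colon(B,b)\to(B',b')$, the morphisms $F\colon X\to X'$ of $\mathcal C$ such that $F\circ i=i'\circ H$, $F\circ o=o'\circ K$, and $$f'\circ i'(h')=o'(k')\circ F(f)\colon\ i'(H(a))=F(i(a))\longrightarrow o'(b').$$ Arrows compose as in the Grothendieck construction of $|-|$, and cells compose internally by composing their boundary arrows and the morphisms $F$. The external composite of $(m,f)\colon(A,a)\to(B,b)$ with $(n,g)\colon(B,b)\to(C,c)$, where $m=(A\xrightarrow{i}X\xleftarrow{o}B)$ and $n=(B\xrightarrow{j}Y\xleftarrow{p}C)$, is $(m\odot n,h)$, where $m\odot n$ is the composite cospan with apex the pushout $X+_BY$ in $\mathcal C$, and $h$ is obtained by composing the images of $f$ and $g$ in $|X|+_{|B|}|Y|$ and applying the canonical functor $|X|+_{|B|}|Y|\to|X+_BY|$. The external identity at $(A,a)$ is $(\mathrm{id}_A,1_a)$. Cells are composed externally by the functoriality of pushouts, and the external identity cell on $(H,h')$ is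 given by $F=H$. Moreover, this double category is the double Grothendieck construction of the composite lax double functor $$\mathbb{C}\mathrm{sp}(\mathcal C)\xrightarrow{\ \mathbb{C}\mathrm{sp}(|-|)\ }\mathbb{C}\mathrm{sp}(\mathbf{Cat})\xrightarrow{\ \mathbb{C}\mathrm{omma}\ }\mathbb{S}\mathrm{pan}(\mathbf{Cat}):$$ the assignments $(A,a)\mapsto(A,a)$, $(H,h')\mapsto(H,h')$, $(m,f)\mapsto(m,(a,f,b))$, and a cell $F\mapsto((H,F,K),(h',k'))$ form a strict isomorphism of double categories onto it. -/

import Mathlib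

open CategoryTheory Limits

attribute [-instance] CategoryTheory.catToReflQuiver

universe w x v u w' x' v' u' w'' x'' v'' u''

/-! ## Double categories -/

/-- The data of a (pseudo) double category, except for the coherence cells: a category of objects
and arrows, proarrows between objects, cells, and the external composites and identities.
The category of proarrows and cells has as objects the triples `(a, b, m : Pro a b)` and as
morphisms the elements of `Cell m n`; each cell `α : Cell m n` has a left boundary arrow `src α`
and a right boundary arrow `tgt α`. Two cells can be composed externally if the right boundary of
the first one is the left boundary of the second one. All composites are written in diagrammatic
order. -/
structure DoubleCategoryData where
  Obj : Type u
  [category : Category.{v} Obj]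
  Pro : Obj → Obj → Type w
  Cell : ∀ {a b c d : Obj}, Pro a b → Pro c d → Type x
  src : ∀ {a b c d : Obj} {m : Pro a b} {n : Pro c d}, Cell m n → (a ⟶ c)
  tgt : ∀ {a b c d : Obj} {m : Pro a b} {n : Pro c d}, Cell m n → (b ⟶ d)
  idCell : ∀ {a b : Obj} (m : Pro a b), Cell m m
  vcomp : ∀ {a b c d e f : Obj} {m : Pro a b} {n : Pro c d} {p : Pro e f},
    Cell m n → Cell n p → Cell m p
  hcomp : ∀ {a b c : Obj}, Pro a b → Pro b c → Pro a c
  hcompCell : ∀ {a b c a' b' c' : Obj} {m : Pro a b} {n : Pro b c} {m' : Pro a' b'}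
    {n' : Pro b' c'} (α : Cell m m') (β : Cell n n'), tgt α = src β →
    Cell (hcomp m n) (hcomp m' n')
  hid : ∀ a : Obj, Pro a a
  hidCell : ∀ {a b : Obj}, (a ⟶ b) → Cell (hid a) (hid b)

attribute [instance] DoubleCategoryData.category

namespace DoubleCategoryData

/-- The axioms of a double category: proarrows and cells form a category, source and target are
functors from it to the category of objects and arrows, external composition and identities are
functors compatible with source and target, and external composition is unital and associative up
to natural globular invertible cells satisfying the triangle and pentagon identities. -/
structure Structure (D : DoubleCategoryData.{w, x, v, u}) where
  id_vcomp : ∀ {a b c d : D.Obj} {m : D.Pro a b} {n : D.Pro c d} (α : D.Cell m n),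
    D.vcomp (D.idCell m) α = α
  vcomp_id : ∀ {a b c d : D.Obj} {m : D.Pro a b} {n : D.Pro c d} (α : D.Cell m n),
    D.vcomp α (D.idCell n) = α
  vcomp_assoc : ∀ {a b c d e f g h : D.Obj} {m : D.Pro a b} {n : D.Pro c d} {p : D.Pro e f}
    {q : D.Pro g h} (α : D.Cell m n) (β : D.Cell n p) (γ : D.Cell p q),
    D.vcomp (D.vcomp α β) γ = D.vcomp α (D.vcomp β γ)
  src_idCell : ∀ {a b : D.Obj} (m : D.Pro a b), D.src (D.idCell m) = 𝟙 a
  tgt_idCell : ∀ {a b : D.Obj} (m : D.Pro a b), D.tgt (D.idCell m) = 𝟙 b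
  src_vcomp : ∀ {a b c d e f : D.Obj} {m : D.Pro a b} {n : D.Pro c d} {p : D.Pro e f}
    (α : D.Cell m n) (β : D.Cell n p), D.src (D.vcomp α β) = D.src α ≫ D.src β
  tgt_vcomp : ∀ {a b c d e f : D.Obj} {m : D.Pro a b} {n : D.Pro c d} {p : D.Pro e f}
    (α : D.Cell m n) (β : D.Cell n p), D.tgt (D.vcomp α β) = D.tgt α ≫ D.tgt β
  src_hcompCell : ∀ {a b c a' b' c' : D.Obj} {m : D.Pro a b} {n : D.Pro b c} {m' : D.Pro a' b'}
    {n' : D.Pro b' c'} (α : D.Cell m m') (β : D.Cell n n') (h : D.tgt α = D.src β),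
    D.src (D.hcompCell α β h) = D.src α
  tgt_hcompCell : ∀ {a b c a' b' c' : D.Obj} {m : D.Pro a b} {n : D.Pro b c} {m' : D.Pro a' b'}
    {n' : D.Pro b' c'} (α : D.Cell m m') (β : D.Cell n n') (h : D.tgt α = D.src β),
    D.tgt (D.hcompCell α β h) = D.tgt β
  src_hidCell : ∀ {a b : D.Obj} (f : a ⟶ b), D.src (D.hidCell f) = f
  tgt_hidCell : ∀ {a b : D.Obj} (f : a ⟶ b), D.tgt (D.hidCell f) = f
  hcompCell_id : ∀ {a b c : D.Obj} (m : D.Pro a b) (n : D.Pro b c),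
    D.hcompCell (D.idCell m) (D.idCell n) ((tgt_idCell m).trans (src_idCell n).symm) =
      D.idCell (D.hcomp m n)
  hcompCell_vcomp : ∀ {a b c a' b' c' a'' b'' c'' : D.Obj} {m : D.Pro a b} {n : D.Pro b c}
    {m' : D.Pro a' b'} {n' : D.Pro b' c'} {m'' : D.Pro a'' b''} {n'' : D.Pro b'' c''}
    (α : D.Cell m m') (α' : D.Cell m' m'') (β : D.Cell n n') (β' : D.Cell n' n'')
    (h : D.tgt α = D.src β) (h' : D.tgt α' = D.src β'),
    D.hcompCell (D.vcomp α α') (D.vcomp β β') (by rw [tgt_vcomp, src_vcomp, h, h']) =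
      D.vcomp (D.hcompCell α β h) (D.hcompCell α' β' h')
  hidCell_id : ∀ a : D.Obj, D.hidCell (𝟙 a) = D.idCell (D.hid a)
  hidCell_comp : ∀ {a b c : D.Obj} (f : a ⟶ b) (g : b ⟶ c),
    D.hidCell (f ≫ g) = D.vcomp (D.hidCell f) (D.hidCell g)
  /-- the associator -/
  assoc : ∀ {a b c d : D.Obj} (m : D.Pro a b) (n : D.Pro b c) (p : D.Pro c d),
    D.Cell (D.hcomp (D.hcomp m n) p) (D.hcomp m (D.hcomp n p))
  assocInv : ∀ {a b c d : D.Obj} (m : D.Pro a b) (n : D.Pro b c) (p : D.Pro c d),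
    D.Cell (D.hcomp m (D.hcomp n p)) (D.hcomp (D.hcomp m n) p)
  /-- the left unitor -/
  leftUnitor : ∀ {a b : D.Obj} (m : D.Pro a b), D.Cell (D.hcomp (D.hid a) m) m
  leftUnitorInv : ∀ {a b : D.Obj} (m : D.Pro a b), D.Cell m (D.hcomp (D.hid a) m)
  /-- the right unitor -/
  rightUnitor : ∀ {a b : D.Obj} (m : D.Pro a b), D.Cell (D.hcomp m (D.hid b)) m
  rightUnitorInv : ∀ {a b : D.Obj} (m : D.Pro a b), D.Cell m (D.hcomp m (D.hid b))
  assoc_assocInv : ∀ {a b c d : D.Obj} (m : D.Pro a b) (n : D.Pro b c) (p : D.Pro c d),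
    D.vcomp (assoc m n p) (assocInv m n p) = D.idCell _
  assocInv_assoc : ∀ {a b c d : D.Obj} (m : D.Pro a b) (n : D.Pro b c) (p : D.Pro c d),
    D.vcomp (assocInv m n p) (assoc m n p) = D.idCell _
  leftUnitor_leftUnitorInv : ∀ {a b : D.Obj} (m : D.Pro a b),
    D.vcomp (leftUnitor m) (leftUnitorInv m) = D.idCell _
  leftUnitorInv_leftUnitor : ∀ {a b : D.Obj} (m : D.Pro a b),
    D.vcomp (leftUnitorInv m) (leftUnitor m) = D.idCell _
  rightUnitor_rightUnitorInv : ∀ {a b : D.Obj} (m : D.Pro a b),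
    D.vcomp (rightUnitor m) (rightUnitorInv m) = D.idCell _
  rightUnitorInv_rightUnitor : ∀ {a b : D.Obj} (m : D.Pro a b),
    D.vcomp (rightUnitorInv m) (rightUnitor m) = D.idCell _
  src_assoc : ∀ {a b c d : D.Obj} (m : D.Pro a b) (n : D.Pro b c) (p : D.Pro c d),
    D.src (assoc m n p) = 𝟙 a
  tgt_assoc : ∀ {a b c d : D.Obj} (m : D.Pro a b) (n : D.Pro b c) (p : D.Pro c d),
    D.tgt (assoc m n p) = 𝟙 d
  src_leftUnitor : ∀ {a b : D.Obj} (m : D.Pro a b), D.src (leftUnitor m) = 𝟙 a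
  tgt_leftUnitor : ∀ {a b : D.Obj} (m : D.Pro a b), D.tgt (leftUnitor m) = 𝟙 b
  src_rightUnitor : ∀ {a b : D.Obj} (m : D.Pro a b), D.src (rightUnitor m) = 𝟙 a
  tgt_rightUnitor : ∀ {a b : D.Obj} (m : D.Pro a b), D.tgt (rightUnitor m) = 𝟙 b
  assoc_naturality : ∀ {a b c d a' b' c' d' : D.Obj} {m : D.Pro a b} {n : D.Pro b c}
    {p : D.Pro c d} {m' : D.Pro a' b'} {n' : D.Pro b' c'} {p' : D.Pro c' d'}
    (α : D.Cell m m') (β : D.Cell n n') (γ : D.Cell p p')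
    (h : D.tgt α = D.src β) (h' : D.tgt β = D.src γ),
    D.vcomp (D.hcompCell (D.hcompCell α β h) γ ((tgt_hcompCell α β h).trans h')) (assoc m' n' p') =
      D.vcomp (assoc m n p)
        (D.hcompCell α (D.hcompCell β γ h') (h.trans (src_hcompCell β γ h').symm))
  leftUnitor_naturality : ∀ {a b a' b' : D.Obj} {m : D.Pro a b} {m' : D.Pro a' b'}
    (α : D.Cell m m'),
    D.vcomp (D.hcompCell (D.hidCell (D.src α)) α (tgt_hidCell _)) (leftUnitor m') =
      D.vcomp (leftUnitor m) α
  rightUnitor_naturality : ∀ {a b a' b' : D.Obj} {m : D.Pro a b} {m' : D.Pro a' b'}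
    (α : D.Cell m m'),
    D.vcomp (D.hcompCell α (D.hidCell (D.tgt α)) (src_hidCell _).symm) (rightUnitor m') =
      D.vcomp (rightUnitor m) α
  triangle : ∀ {a b c : D.Obj} (m : D.Pro a b) (n : D.Pro b c),
    D.vcomp (assoc m (D.hid b) n)
        (D.hcompCell (D.idCell m) (leftUnitor n)
          ((tgt_idCell m).trans (src_leftUnitor n).symm)) =
      D.hcompCell (rightUnitor m) (D.idCell n) ((tgt_rightUnitor m).trans (src_idCell n).symm)
  pentagon : ∀ {a b c d e : D.Obj} (m : D.Pro a b) (n : D.Pro b c) (p : D.Pro c d) (q : D.Pro d e),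
    D.vcomp
        (D.vcomp
          (D.hcompCell (assoc m n p) (D.idCell q) ((tgt_assoc m n p).trans (src_idCell q).symm))
          (assoc m (D.hcomp n p) q))
        (D.hcompCell (D.idCell m) (assoc n p q) ((tgt_idCell m).trans (src_assoc n p q).symm)) =
      D.vcomp (assoc (D.hcomp m n) p q) (assoc m n (D.hcomp p q))

theorem Structure.hcompCell_vcomp_id {D : DoubleCategoryData.{w, x, v, u}} (S : D.Structure)
    {a b c a' a'' : D.Obj} {m : D.Pro a b} {n : D.Pro b c} {m' : D.Pro a' b} {m'' : D.Pro a'' b}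
    (α : D.Cell m m') (α' : D.Cell m' m'') (h : D.tgt α = D.src (D.idCell n))
    (h' : D.tgt α' = D.src (D.idCell n)) (h'' : D.tgt (D.vcomp α α') = D.src (D.idCell n)) :
    D.hcompCell (D.vcomp α α') (D.idCell n) h'' =
      D.vcomp (D.hcompCell α (D.idCell n) h) (D.hcompCell α' (D.idCell n) h') := by
  rw [← S.hcompCell_vcomp]
  congr 1
  rw [S.id_vcomp]

theorem Structure.hcompCell_id_vcomp {D : DoubleCategoryData.{w, x, v, u}} (S : D.Structure)
    {a b c c' c'' : D.Obj} {m : D.Pro a b} {n : D.Pro b c} {n' : D.Pro b c'} {n'' : D.Pro b c''}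
    (β : D.Cell n n') (β' : D.Cell n' n'') (h : D.tgt (D.idCell m) = D.src β)
    (h' : D.tgt (D.idCell m) = D.src β') (h'' : D.tgt (D.idCell m) = D.src (D.vcomp β β')) :
    D.hcompCell (D.idCell m) (D.vcomp β β') h'' =
      D.vcomp (D.hcompCell (D.idCell m) β h) (D.hcompCell (D.idCell m) β' h') := by
  rw [← S.hcompCell_vcomp]
  congr 1
  rw [S.id_vcomp]

end DoubleCategoryData

/-- A (pseudo) double category. -/
structure DoubleCategory extends DoubleCategoryData.{w, x, v, u} where
  str : toDoubleCategoryData.Structure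

/-- The underlying data of a lax double functor: its actions on objects and arrows, on proarrows,
and on cells. -/
structure DoubleFunctorData (D : DoubleCategoryData.{w, x, v, u})
    (E : DoubleCategoryData.{w', x', v', u'}) where
  obj : D.Obj ⥤ E.Obj
  pro : ∀ {a b : D.Obj}, D.Pro a b → E.Pro (obj.obj a) (obj.obj b)
  cell : ∀ {a b c d : D.Obj} {m : D.Pro a b} {n : D.Pro c d},
    D.Cell m n → E.Cell (pro m) (pro n)

/-- A lax double functor: it strictly preserves sources, targets, and the internal composites and
identities of cells, and has natural globular comparison cells `F m ⊙ F n ⟶ F (m ⊙ n)`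
(laxators) and `id (F a) ⟶ F (id a)` (unitors) satisfying the associativity and unit axioms. -/
structure LaxDoubleFunctor (D : DoubleCategory.{w, x, v, u})
    (E : DoubleCategory.{w', x', v', u'}) extends
    DoubleFunctorData D.toDoubleCategoryData E.toDoubleCategoryData where
  src_cell : ∀ {a b c d : D.Obj} {m : D.Pro a b} {n : D.Pro c d} (α : D.Cell m n),
    E.src (cell α) = obj.map (D.src α)
  tgt_cell : ∀ {a b c d : D.Obj} {m : D.Pro a b} {n : D.Pro c d} (α : D.Cell m n),
    E.tgt (cell α) = obj.map (D.tgt α)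
  cell_id : ∀ {a b : D.Obj} (m : D.Pro a b), cell (D.idCell m) = E.idCell (pro m)
  cell_vcomp : ∀ {a b c d e f : D.Obj} {m : D.Pro a b} {n : D.Pro c d} {p : D.Pro e f}
    (α : D.Cell m n) (β : D.Cell n p), cell (D.vcomp α β) = E.vcomp (cell α) (cell β)
  laxator : ∀ {a b c : D.Obj} (m : D.Pro a b) (n : D.Pro b c),
    E.Cell (E.hcomp (pro m) (pro n)) (pro (D.hcomp m n))
  unitor : ∀ a : D.Obj, E.Cell (E.hid (obj.obj a)) (pro (D.hid a))
  src_laxator : ∀ {a b c : D.Obj} (m : D.Pro a b) (n : D.Pro b c), E.src (laxator m n) = 𝟙 _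
  tgt_laxator : ∀ {a b c : D.Obj} (m : D.Pro a b) (n : D.Pro b c), E.tgt (laxator m n) = 𝟙 _
  src_unitor : ∀ a : D.Obj, E.src (unitor a) = 𝟙 _
  tgt_unitor : ∀ a : D.Obj, E.tgt (unitor a) = 𝟙 _
  laxator_naturality : ∀ {a b c a' b' c' : D.Obj} {m : D.Pro a b} {n : D.Pro b c}
    {m' : D.Pro a' b'} {n' : D.Pro b' c'} (α : D.Cell m m') (β : D.Cell n n')
    (h : D.tgt α = D.src β),
    E.vcomp (E.hcompCell (cell α) (cell β) (by rw [tgt_cell, src_cell, h])) (laxator m' n') =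
      E.vcomp (laxator m n) (cell (D.hcompCell α β h))
  unitor_naturality : ∀ {a b : D.Obj} (f : a ⟶ b),
    E.vcomp (E.hidCell (obj.map f)) (unitor b) = E.vcomp (unitor a) (cell (D.hidCell f))
  laxator_assoc : ∀ {a b c d : D.Obj} (m : D.Pro a b) (n : D.Pro b c) (p : D.Pro c d),
    E.vcomp
        (E.vcomp
          (E.hcompCell (laxator m n) (E.idCell (pro p))
            ((tgt_laxator m n).trans (E.str.src_idCell _).symm))
          (laxator (D.hcomp m n) p))
        (cell (D.str.assoc m n p)) =
      E.vcomp
        (E.vcomp (E.str.assoc (pro m) (pro n) (pro p))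
          (E.hcompCell (E.idCell (pro m)) (laxator n p)
            ((E.str.tgt_idCell _).trans (src_laxator n p).symm)))
        (laxator m (D.hcomp n p))
  laxator_leftUnitor : ∀ {a b : D.Obj} (m : D.Pro a b),
    E.vcomp
        (E.vcomp
          (E.hcompCell (unitor a) (E.idCell (pro m))
            ((tgt_unitor a).trans (E.str.src_idCell _).symm))
          (laxator (D.hid a) m))
        (cell (D.str.leftUnitor m)) =
      E.str.leftUnitor (pro m)
  laxator_rightUnitor : ∀ {a b : D.Obj} (m : D.Pro a b),
    E.vcomp
        (E.vcomp
          (E.hcompCell (E.idCell (pro m)) (unitor b)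
            ((E.str.tgt_idCell _).trans (src_unitor b).symm))
          (laxator m (D.hid b)))
        (cell (D.str.rightUnitor m)) =
      E.str.rightUnitor (pro m)

namespace LaxDoubleFunctor

variable {D : DoubleCategory.{w, x, v, u}} {E : DoubleCategory.{w', x', v', u'}}
  {K : DoubleCategory.{w'', x'', v'', u''}}

/-- A strict isomorphism of double categories: a double functor that strictly preserves external
composites and identities, is bijective on objects, on arrows between given objects, on proarrows
between given objects and on cells between given proarrows. -/
structure IsStrictIso (F : LaxDoubleFunctor D E) : Prop where
  obj_bijective : Function.Bijective F.obj.obj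
  map_bijective : ∀ a b : D.Obj, Function.Bijective (F.obj.map : (a ⟶ b) → _)
  pro_bijective : ∀ a b : D.Obj, Function.Bijective (F.pro : D.Pro a b → _)
  cell_bijective : ∀ {a b c d : D.Obj} (m : D.Pro a b) (n : D.Pro c d),
    Function.Bijective (F.cell : D.Cell m n → _)
  pro_hcomp : ∀ {a b c : D.Obj} (m : D.Pro a b) (n : D.Pro b c),
    E.hcomp (F.pro m) (F.pro n) = F.pro (D.hcomp m n)
  pro_hid : ∀ a : D.Obj, E.hid (F.obj.obj a) = F.pro (D.hid a)
  laxator_heq : ∀ {a b c : D.Obj} (m : D.Pro a b) (n : D.Pro b c),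
    F.laxator m n ≍ E.idCell (F.pro (D.hcomp m n))
  unitor_heq : ∀ a : D.Obj, F.unitor a ≍ E.idCell (F.pro (D.hid a))

/-- The composite of two lax double functors. -/
def comp (F : LaxDoubleFunctor D E) (G : LaxDoubleFunctor E K) : LaxDoubleFunctor D K where
  obj := F.obj ⋙ G.obj
  pro m := G.pro (F.pro m)
  cell α := G.cell (F.cell α)
  src_cell α := by rw [G.src_cell, F.src_cell]; rfl
  tgt_cell α := by rw [G.tgt_cell, F.tgt_cell]; rfl
  cell_id m := by rw [F.cell_id, G.cell_id]
  cell_vcomp α β := by rw [F.cell_vcomp, G.cell_vcomp]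
  laxator m n := K.vcomp (G.laxator (F.pro m) (F.pro n)) (G.cell (F.laxator m n))
  unitor a := K.vcomp (G.unitor (F.obj.obj a)) (G.cell (F.unitor a))
  src_laxator m n := by
    rw [K.str.src_vcomp, G.src_laxator, G.src_cell, F.src_laxator, CategoryTheory.Functor.map_id]
    exact Category.comp_id _
  tgt_laxator m n := by
    rw [K.str.tgt_vcomp, G.tgt_laxator, G.tgt_cell, F.tgt_laxator, CategoryTheory.Functor.map_id]
    exact Category.comp_id _
  src_unitor a := by
    rw [K.str.src_vcomp, G.src_unitor, G.src_cell, F.src_unitor, CategoryTheory.Functor.map_id]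
    exact Category.comp_id _
  tgt_unitor a := by
    rw [K.str.tgt_vcomp, G.tgt_unitor, G.tgt_cell, F.tgt_unitor, CategoryTheory.Functor.map_id]
    exact Category.comp_id _
  laxator_naturality α β h := by
    rw [← K.str.vcomp_assoc, G.laxator_naturality _ _ (by rw [F.tgt_cell, F.src_cell, h]),
      K.str.vcomp_assoc, ← G.cell_vcomp, F.laxator_naturality α β h, G.cell_vcomp,
      ← K.str.vcomp_assoc]
  unitor_naturality f := by
    rw [Functor.comp_map, ← K.str.vcomp_assoc, G.unitor_naturality, K.str.vcomp_assoc,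
      ← G.cell_vcomp, F.unitor_naturality, G.cell_vcomp, ← K.str.vcomp_assoc]
  laxator_assoc m n p := by
    have h := congrArg G.cell (F.laxator_assoc m n p)
    simp only [G.cell_vcomp] at h
    rw [K.str.hcompCell_vcomp_id (h := (G.tgt_laxator _ _).trans (K.str.src_idCell _).symm)
        (h' := by rw [G.tgt_cell, F.tgt_laxator, CategoryTheory.Functor.map_id, K.str.src_idCell]),
      K.str.hcompCell_id_vcomp (h := (K.str.tgt_idCell _).trans (G.src_laxator _ _).symm)
        (h' := by rw [G.src_cell, F.src_laxator, CategoryTheory.Functor.map_id, K.str.tgt_idCell])]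
    have e1 := G.laxator_naturality (F.laxator m n) (E.idCell (F.pro p))
      ((F.tgt_laxator m n).trans (E.str.src_idCell _).symm)
    have e2 := G.laxator_naturality (E.idCell (F.pro m)) (F.laxator n p)
      ((E.str.tgt_idCell _).trans (F.src_laxator n p).symm)
    simp only [G.cell_id] at e1 e2
    have e3 := G.laxator_assoc (F.pro m) (F.pro n) (F.pro p)
    simp only [K.str.vcomp_assoc] at h e1 e2 e3 ⊢
    rw [← K.str.vcomp_assoc (K.hcompCell (G.cell (F.laxator m n)) _ _), e1, K.str.vcomp_assoc, h,
      ← K.str.vcomp_assoc (K.hcompCell _ (G.cell (F.laxator n p)) _), e2, K.str.vcomp_assoc]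
    rw [← K.str.vcomp_assoc, ← K.str.vcomp_assoc, K.str.vcomp_assoc (K.hcompCell _ _ _), e3]
    simp only [K.str.vcomp_assoc]
  laxator_leftUnitor {a b} m := by
    have h := congrArg G.cell (F.laxator_leftUnitor m)
    simp only [G.cell_vcomp] at h
    rw [K.str.hcompCell_vcomp_id (h := (G.tgt_unitor _).trans (K.str.src_idCell _).symm)
        (h' := by rw [G.tgt_cell, F.tgt_unitor, CategoryTheory.Functor.map_id, K.str.src_idCell])]
    have e1 := G.laxator_naturality (F.unitor a) (E.idCell (F.pro m))
      ((F.tgt_unitor a).trans (E.str.src_idCell _).symm)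
    simp only [G.cell_id] at e1
    have e3 := G.laxator_leftUnitor (F.pro m)
    simp only [K.str.vcomp_assoc] at h e1 e3 ⊢
    rw [← K.str.vcomp_assoc (K.hcompCell (G.cell (F.unitor a)) _ _), e1, K.str.vcomp_assoc, h, e3]
  laxator_rightUnitor {a b} m := by
    have h := congrArg G.cell (F.laxator_rightUnitor m)
    simp only [G.cell_vcomp] at h
    rw [K.str.hcompCell_id_vcomp (h := (K.str.tgt_idCell _).trans (G.src_unitor _).symm)
        (h' := by rw [G.src_cell, F.src_unitor, CategoryTheory.Functor.map_id, K.str.tgt_idCell])]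
    have e1 := G.laxator_naturality (E.idCell (F.pro m)) (F.unitor b)
      ((E.str.tgt_idCell _).trans (F.src_unitor b).symm)
    simp only [G.cell_id] at e1
    have e3 := G.laxator_rightUnitor (F.pro m)
    simp only [K.str.vcomp_assoc] at h e1 e3 ⊢
    rw [← K.str.vcomp_assoc (K.hcompCell _ (G.cell (F.unitor b)) _), e1, K.str.vcomp_assoc, h, e3]

end LaxDoubleFunctor

/-! ## Cospans -/

section Cospans

attribute [local simp] pushout.inl_desc pushout.inr_desc pushout.inl_desc_assoc
  pushout.inr_desc_assoc

variable {S : Type u} [Category.{v} S]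

/-- A cospan `a ⟶ apex ⟵ b`. -/
structure Csp (a b : S) where
  apex : S
  inl : a ⟶ apex
  inr : b ⟶ apex

/-- A map of cospans, with arbitrary maps between the feet. -/
@[ext]
structure CspMap {a b c d : S} (m : Csp a b) (n : Csp c d) where
  left : a ⟶ c
  mid : m.apex ⟶ n.apex
  right : b ⟶ d
  w_left : m.inl ≫ mid = left ≫ n.inl := by cat_disch
  w_right : m.inr ≫ mid = right ≫ n.inr := by cat_disch

theorem CspMap.w_left_assoc {a b c d z : S} {m : Csp a b} {n : Csp c d} (α : CspMap m n)
    (h : n.apex ⟶ z) : m.inl ≫ α.mid ≫ h = α.left ≫ n.inl ≫ h := by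
  rw [← Category.assoc, α.w_left, Category.assoc]

theorem CspMap.w_right_assoc {a b c d z : S} {m : Csp a b} {n : Csp c d} (α : CspMap m n)
    (h : n.apex ⟶ z) : m.inr ≫ α.mid ≫ h = α.right ≫ n.inr ≫ h := by
  rw [← Category.assoc, α.w_right, Category.assoc]

attribute [local simp] CspMap.w_left CspMap.w_right CspMap.w_left_assoc CspMap.w_right_assoc

namespace Csp

/-- The identity cospan. -/
@[simps, reducible]
def hid (a : S) : Csp a a := ⟨a, 𝟙 a, 𝟙 a⟩

/-- The identity map of a cospan. -/
@[simps, reducible]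
def idMap {a b : S} (m : Csp a b) : CspMap m m where
  left := 𝟙 a
  mid := 𝟙 m.apex
  right := 𝟙 b

/-- The composite of maps of cospans. -/
@[simps, reducible]
def vcomp {a b c d e f : S} {m : Csp a b} {n : Csp c d} {p : Csp e f}
    (α : CspMap m n) (β : CspMap n p) : CspMap m p where
  left := α.left ≫ β.left
  mid := α.mid ≫ β.mid
  right := α.right ≫ β.right

/-- The identity map between identity cospans on an arrow. -/
@[simps, reducible]
def hidMap {a b : S} (f : a ⟶ b) : CspMap (hid a) (hid b) where
  left := f
  mid := f
  right := f

variable {T : Type u'} [Category.{v'} T] (F : S ⥤ T)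

/-- The image of a cospan under a functor. -/
@[simps, reducible]
def mapPro {a b : S} (m : Csp a b) : Csp (F.obj a) (F.obj b) :=
  ⟨F.obj m.apex, F.map m.inl, F.map m.inr⟩

/-- The image of a map of cospans under a functor. -/
@[simps, reducible]
def mapCell {a b c d : S} {m : Csp a b} {n : Csp c d} (α : CspMap m n) :
    CspMap (mapPro F m) (mapPro F n) where
  left := F.map α.left
  mid := F.map α.mid
  right := F.map α.right
  w_left := by rw [← F.map_comp, α.w_left, F.map_comp]
  w_right := by rw [← F.map_comp, α.w_right, F.map_comp]

/-- The comparison map from the identity cospan to the image of the identity cospan. -/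
@[simps, reducible]
def unitor (a : S) : CspMap (hid (F.obj a)) (mapPro F (hid a)) where
  left := 𝟙 _
  mid := 𝟙 _
  right := 𝟙 _

theorem unitor_naturality {a b : S} (f : a ⟶ b) :
    vcomp (hidMap (F.map f)) (unitor F b) = vcomp (unitor F a) (mapCell F (hidMap f)) := by
  ext <;> simp

variable [HasPushouts S]

theorem map_inl_desc {a b c z : S} {f : a ⟶ b} {g : a ⟶ c} (h : b ⟶ z) (k : c ⟶ z)
    (w : f ≫ h = g ≫ k) : F.map (pushout.inl f g) ≫ F.map (pushout.desc h k w) = F.map h := by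
  rw [← F.map_comp, pushout.inl_desc]

theorem map_inr_desc {a b c z : S} {f : a ⟶ b} {g : a ⟶ c} (h : b ⟶ z) (k : c ⟶ z)
    (w : f ≫ h = g ≫ k) : F.map (pushout.inr f g) ≫ F.map (pushout.desc h k w) = F.map k := by
  rw [← F.map_comp, pushout.inr_desc]

attribute [local simp] map_inl_desc map_inr_desc


/-- The external composite of cospans, by pushout. -/
@[simps, reducible]
noncomputable def hcomp {a b c : S} (m : Csp a b) (n : Csp b c) : Csp a c where
  apex := pushout m.inr n.inl
  inl := m.inl ≫ pushout.inl m.inr n.inl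
  inr := n.inr ≫ pushout.inr m.inr n.inl

/-- The external composite of maps of cospans, by the functoriality of pushouts. -/
@[simps, reducible]
noncomputable def hcompMap {a b c a' b' c' : S} {m : Csp a b} {n : Csp b c} {m' : Csp a' b'}
    {n' : Csp b' c'} (α : CspMap m m') (β : CspMap n n') (h : α.right = β.left) :
    CspMap (m.hcomp n) (m'.hcomp n') where
  left := α.left
  mid := pushout.desc (α.mid ≫ pushout.inl m'.inr n'.inl) (β.mid ≫ pushout.inr m'.inr n'.inl)
    (by rw [CspMap.w_right_assoc, CspMap.w_left_assoc, pushout.condition, h])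
  right := β.right

theorem condition {a b c : S} (m : Csp a b) (n : Csp b c) :
    m.inr ≫ pushout.inl m.inr n.inl = n.inl ≫ pushout.inr m.inr n.inl :=
  pushout.condition

theorem condition_assoc {a b c z : S} (m : Csp a b) (n : Csp b c)
    (h : pushout m.inr n.inl ⟶ z) :
    m.inr ≫ pushout.inl m.inr n.inl ≫ h = n.inl ≫ pushout.inr m.inr n.inl ≫ h := by
  rw [← Category.assoc, condition, Category.assoc]

theorem hom_ext {a b c z : S} {m : Csp a b} {n : Csp b c} {f g : (m.hcomp n).apex ⟶ z}
    (h : pushout.inl m.inr n.inl ≫ f = pushout.inl m.inr n.inl ≫ g)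
    (h' : pushout.inr m.inr n.inl ≫ f = pushout.inr m.inr n.inl ≫ g) : f = g :=
  pushout.hom_ext h h'

/-- The associator for the external composition of cospans. -/
@[simps, reducible]
noncomputable def assoc {a b c d : S} (m : Csp a b) (n : Csp b c) (p : Csp c d) :
    CspMap ((m.hcomp n).hcomp p) (m.hcomp (n.hcomp p)) where
  left := 𝟙 a
  mid := pushout.desc
    (pushout.desc (pushout.inl m.inr (n.hcomp p).inl)
      (pushout.inl n.inr p.inl ≫ pushout.inr m.inr (n.hcomp p).inl)
      (by simpa using condition m (n.hcomp p)))
    (pushout.inr n.inr p.inl ≫ pushout.inr m.inr (n.hcomp p).inl)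
    (by simp [condition_assoc])
  right := 𝟙 d

/-- The inverse of the associator. -/
@[simps, reducible]
noncomputable def assocInv {a b c d : S} (m : Csp a b) (n : Csp b c) (p : Csp c d) :
    CspMap (m.hcomp (n.hcomp p)) ((m.hcomp n).hcomp p) where
  left := 𝟙 a
  mid := pushout.desc
    (pushout.inl m.inr n.inl ≫ pushout.inl (m.hcomp n).inr p.inl)
    (pushout.desc (pushout.inr m.inr n.inl ≫ pushout.inl (m.hcomp n).inr p.inl)
      (pushout.inr (m.hcomp n).inr p.inl) (by simpa using condition (m.hcomp n) p))
    (by simp [condition_assoc])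
  right := 𝟙 d

/-- The left unitor for the external composition of cospans. -/
@[simps, reducible]
noncomputable def leftUnitor {a b : S} (m : Csp a b) : CspMap ((hid a).hcomp m) m where
  left := 𝟙 a
  mid := pushout.desc m.inl (𝟙 m.apex) (by simp)
  right := 𝟙 b

/-- The inverse of the left unitor. -/
@[simps, reducible]
noncomputable def leftUnitorInv {a b : S} (m : Csp a b) : CspMap m ((hid a).hcomp m) where
  left := 𝟙 a
  mid := pushout.inr (hid a).inr m.inl
  right := 𝟙 b
  w_left := by simpa using (condition (hid a) m).symm

/-- The right unitor for the external composition of cospans. -/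
@[simps, reducible]
noncomputable def rightUnitor {a b : S} (m : Csp a b) : CspMap (m.hcomp (hid b)) m where
  left := 𝟙 a
  mid := pushout.desc (𝟙 m.apex) m.inr (by simp)
  right := 𝟙 b

/-- The inverse of the right unitor. -/
@[simps, reducible]
noncomputable def rightUnitorInv {a b : S} (m : Csp a b) : CspMap m (m.hcomp (hid b)) where
  left := 𝟙 a
  mid := pushout.inl m.inr (hid b).inl
  right := 𝟙 b
  w_right := by simpa using condition m (hid b)

theorem hcompMap_id {a b c : S} (m : Csp a b) (n : Csp b c) :
    hcompMap (idMap m) (idMap n) rfl = idMap (m.hcomp n) := by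
  apply CspMap.ext
  · rfl
  · apply hom_ext <;> simp
  · rfl

theorem hcompMap_vcomp {a b c a' b' c' a'' b'' c'' : S} {m : Csp a b} {n : Csp b c}
    {m' : Csp a' b'} {n' : Csp b' c'} {m'' : Csp a'' b''} {n'' : Csp b'' c''}
    (α : CspMap m m') (α' : CspMap m' m'') (β : CspMap n n') (β' : CspMap n' n'')
    (h : α.right = β.left) (h' : α'.right = β'.left) :
    hcompMap (vcomp α α') (vcomp β β') (by simp [h, h']) =
      vcomp (hcompMap α β h) (hcompMap α' β' h') := by
  apply CspMap.ext
  · rfl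
  · apply hom_ext <;> simp
  · rfl

theorem assoc_assocInv {a b c d : S} (m : Csp a b) (n : Csp b c) (p : Csp c d) :
    vcomp (assoc m n p) (assocInv m n p) = idMap _ := by
  apply CspMap.ext
  · simp
  · apply hom_ext
    · apply hom_ext <;> simp
    · simp
  · simp

theorem assocInv_assoc {a b c d : S} (m : Csp a b) (n : Csp b c) (p : Csp c d) :
    vcomp (assocInv m n p) (assoc m n p) = idMap _ := by
  apply CspMap.ext
  · simp
  · apply hom_ext
    · simp
    · apply hom_ext <;> simp
  · simp

theorem leftUnitor_leftUnitorInv {a b : S} (m : Csp a b) :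
    vcomp (leftUnitor m) (leftUnitorInv m) = idMap _ := by
  apply CspMap.ext
  · simp
  · apply hom_ext
    · simpa using (condition (hid _) m).symm
    · simp
  · simp

theorem leftUnitorInv_leftUnitor {a b : S} (m : Csp a b) :
    vcomp (leftUnitorInv m) (leftUnitor m) = idMap _ := by
  ext <;> simp

theorem rightUnitor_rightUnitorInv {a b : S} (m : Csp a b) :
    vcomp (rightUnitor m) (rightUnitorInv m) = idMap _ := by
  apply CspMap.ext
  · simp
  · apply hom_ext
    · simp
    · simpa using condition m (hid _)
  · simp

theorem rightUnitorInv_rightUnitor {a b : S} (m : Csp a b) :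
    vcomp (rightUnitorInv m) (rightUnitor m) = idMap _ := by
  ext <;> simp

theorem assoc_naturality {a b c d a' b' c' d' : S} {m : Csp a b} {n : Csp b c}
    {p : Csp c d} {m' : Csp a' b'} {n' : Csp b' c'} {p' : Csp c' d'}
    (α : CspMap m m') (β : CspMap n n') (γ : CspMap p p')
    (h : α.right = β.left) (h' : β.right = γ.left) :
    vcomp (hcompMap (hcompMap α β h) γ h') (assoc m' n' p') =
      vcomp (assoc m n p) (hcompMap α (hcompMap β γ h') h) := by
  apply CspMap.ext
  · simp
  · apply hom_ext
    · apply hom_ext <;> simp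
    · simp
  · simp

theorem leftUnitor_naturality {a b a' b' : S} {m : Csp a b} {m' : Csp a' b'} (α : CspMap m m') :
    vcomp (hcompMap (hidMap α.left) α rfl) (leftUnitor m') = vcomp (leftUnitor m) α := by
  apply CspMap.ext
  · simp
  · apply hom_ext <;> simp
  · simp

theorem rightUnitor_naturality {a b a' b' : S} {m : Csp a b} {m' : Csp a' b'} (α : CspMap m m') :
    vcomp (hcompMap α (hidMap α.right) rfl) (rightUnitor m') = vcomp (rightUnitor m) α := by
  apply CspMap.ext
  · simp
  · apply hom_ext <;> simp
  · simp

theorem triangle {a b c : S} (m : Csp a b) (n : Csp b c) :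
    vcomp (assoc m (hid b) n) (hcompMap (idMap m) (leftUnitor n) rfl) =
      hcompMap (rightUnitor m) (idMap n) rfl := by
  apply CspMap.ext
  · simp
  · apply hom_ext
    · apply hom_ext
      · simp
      · simpa using (condition m n).symm
    · simp
  · simp

theorem pentagon {a b c d e : S} (m : Csp a b) (n : Csp b c) (p : Csp c d) (q : Csp d e) :
    vcomp (vcomp (hcompMap (assoc m n p) (idMap q) rfl) (assoc m (n.hcomp p) q))
        (hcompMap (idMap m) (assoc n p q) rfl) =
      vcomp (assoc (m.hcomp n) p q) (assoc m n (p.hcomp q)) := by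
  apply CspMap.ext
  · simp
  · apply hom_ext
    · apply hom_ext
      · apply hom_ext <;> simp
      · simp
    · simp
  · simp

variable (S) in
/-- The data of the double category of cospans. -/
noncomputable def doubleCategoryData : DoubleCategoryData where
  Obj := S
  Pro := Csp
  Cell := CspMap
  src := CspMap.left
  tgt := CspMap.right
  idCell := idMap
  vcomp := vcomp
  hcomp := hcomp
  hcompCell := hcompMap
  hid := hid
  hidCell := hidMap

variable (S) in
/-- The double category of cospans in a category with pushouts: its objects and arrows are those
of `S`, its proarrows are cospans, its cells are maps of cospans, and external composition is by
pushout. -/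
noncomputable def doubleCategory : DoubleCategory where
  toDoubleCategoryData := doubleCategoryData S
  str.id_vcomp _ := CspMap.ext (Category.id_comp _) (Category.id_comp _) (Category.id_comp _)
  str.vcomp_id _ := CspMap.ext (Category.comp_id _) (Category.comp_id _) (Category.comp_id _)
  str.vcomp_assoc _ _ _ :=
    CspMap.ext (Category.assoc _ _ _) (Category.assoc _ _ _) (Category.assoc _ _ _)
  str.src_idCell _ := rfl
  str.tgt_idCell _ := rfl
  str.src_vcomp _ _ := rfl
  str.tgt_vcomp _ _ := rfl
  str.src_hcompCell _ _ _ := rfl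
  str.tgt_hcompCell _ _ _ := rfl
  str.src_hidCell _ := rfl
  str.tgt_hidCell _ := rfl
  str.hcompCell_id := hcompMap_id
  str.hcompCell_vcomp := hcompMap_vcomp
  str.hidCell_id _ := rfl
  str.hidCell_comp _ _ := rfl
  str.assoc := assoc
  str.assocInv := assocInv
  str.leftUnitor := leftUnitor
  str.leftUnitorInv := leftUnitorInv
  str.rightUnitor := rightUnitor
  str.rightUnitorInv := rightUnitorInv
  str.assoc_assocInv := assoc_assocInv
  str.assocInv_assoc := assocInv_assoc
  str.leftUnitor_leftUnitorInv := leftUnitor_leftUnitorInv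
  str.leftUnitorInv_leftUnitor := leftUnitorInv_leftUnitor
  str.rightUnitor_rightUnitorInv := rightUnitor_rightUnitorInv
  str.rightUnitorInv_rightUnitor := rightUnitorInv_rightUnitor
  str.src_assoc _ _ _ := rfl
  str.tgt_assoc _ _ _ := rfl
  str.src_leftUnitor _ := rfl
  str.tgt_leftUnitor _ := rfl
  str.src_rightUnitor _ := rfl
  str.tgt_rightUnitor _ := rfl
  str.assoc_naturality := assoc_naturality
  str.leftUnitor_naturality := leftUnitor_naturality
  str.rightUnitor_naturality := rightUnitor_naturality
  str.triangle := triangle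
  str.pentagon := pentagon

section Functoriality

variable [HasPushouts T]

/-- The comparison map from the composite of images to the image of the composite; on apexes it
is the canonical map `F x +_{F b} F y ⟶ F (x +_b y)`. -/
@[simps, reducible]
noncomputable def laxator {a b c : S} (m : Csp a b) (n : Csp b c) :
    CspMap ((mapPro F m).hcomp (mapPro F n)) (mapPro F (m.hcomp n)) where
  left := 𝟙 _
  mid := pushoutComparison F m.inr n.inl
  right := 𝟙 _

theorem laxator_naturality {a b c a' b' c' : S} {m : Csp a b} {n : Csp b c} {m' : Csp a' b'}
    {n' : Csp b' c'} (α : CspMap m m') (β : CspMap n n') (h : α.right = β.left) :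
    vcomp (hcompMap (mapCell F α) (mapCell F β) (congrArg F.map h)) (laxator F m' n') =
      vcomp (laxator F m n) (mapCell F (hcompMap α β h)) := by
  apply CspMap.ext
  · simp
  · apply hom_ext <;> simp
  · simp

theorem laxator_assoc {a b c d : S} (m : Csp a b) (n : Csp b c) (p : Csp c d) :
    vcomp (vcomp (hcompMap (laxator F m n) (idMap (mapPro F p)) rfl) (laxator F (m.hcomp n) p))
        (mapCell F (assoc m n p)) =
      vcomp (vcomp (assoc (mapPro F m) (mapPro F n) (mapPro F p))
        (hcompMap (idMap (mapPro F m)) (laxator F n p) rfl)) (laxator F m (n.hcomp p)) := by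
  apply CspMap.ext
  · simp
  · apply hom_ext
    · apply hom_ext <;> simp
    · simp
  · simp

theorem laxator_leftUnitor {a b : S} (m : Csp a b) :
    vcomp (vcomp (hcompMap (unitor F a) (idMap (mapPro F m)) rfl) (laxator F (hid a) m))
        (mapCell F (leftUnitor m)) =
      leftUnitor (mapPro F m) := by
  apply CspMap.ext
  · simp
  · apply hom_ext <;> simp
  · simp

theorem laxator_rightUnitor {a b : S} (m : Csp a b) :
    vcomp (vcomp (hcompMap (idMap (mapPro F m)) (unitor F b) rfl) (laxator F m (hid b)))
        (mapCell F (rightUnitor m)) =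
      rightUnitor (mapPro F m) := by
  apply CspMap.ext
  · simp
  · apply hom_ext <;> simp
  · simp

/-- The lax double functor between double categories of cospans induced by a functor. It applies
the functor to cospans and their maps, and its laxators are the canonical comparison maps
between pushouts. -/
noncomputable def map : LaxDoubleFunctor (doubleCategory S) (doubleCategory T) where
  obj := F
  pro := mapPro F
  cell := mapCell F
  src_cell _ := rfl
  tgt_cell _ := rfl
  cell_id _ := CspMap.ext (F.map_id _) (F.map_id _) (F.map_id _)
  cell_vcomp _ _ := CspMap.ext (F.map_comp _ _) (F.map_comp _ _) (F.map_comp _ _)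
  laxator := laxator F
  unitor := unitor F
  src_laxator _ _ := rfl
  tgt_laxator _ _ := rfl
  src_unitor _ := rfl
  tgt_unitor _ := rfl
  laxator_naturality := laxator_naturality F
  unitor_naturality := unitor_naturality F
  laxator_assoc := laxator_assoc F
  laxator_leftUnitor := laxator_leftUnitor F
  laxator_rightUnitor := laxator_rightUnitor F

end Functoriality

end Csp

end Cospans

/-! ## Spans of categories -/

section Spans

theorem map_heq {A : Type u} [Category.{v} A] {B : Type u'} [Category.{v'} B] {F G : A ⥤ B}
    (h : F = G) {x y x' y' : A} {f : x ⟶ y} {g : x' ⟶ y'} (hx : x = x') (hy : y = y')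
    (hf : f ≍ g) : F.map f ≍ G.map g := by
  subst h hx hy hf; rfl

theorem Cat.map_heq {A B : Cat.{v, u}} {F G : A ⟶ B} (h : F = G) {x y : A} (f : x ⟶ y) :
    F.toFunctor.map f ≍ G.toFunctor.map f := by
  subst h; rfl

theorem Cat.obj_eq {A B : Cat.{v, u}} {F G : A ⟶ B} (h : F = G) (x : A) :
    F.toFunctor.obj x = G.toFunctor.obj x := by
  subst h; rfl

/-- The strict pullback of categories: objects are pairs of objects with the same image. -/
structure CatPullback {A B X : Cat.{v, u}} (F : A ⟶ X) (G : B ⟶ X) : Type u where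
  fst : A
  snd : B
  eq : F.toFunctor.obj fst = G.toFunctor.obj snd

namespace CatPullback

variable {A B X : Cat.{v, u}} {F : A ⟶ X} {G : B ⟶ X}

/-- Morphisms in the strict pullback of categories: pairs of morphisms with the same image. -/
@[ext]
structure Hom (p q : CatPullback F G) : Type v where
  fst : p.fst ⟶ q.fst
  snd : p.snd ⟶ q.snd
  heq : F.toFunctor.map fst ≍ G.toFunctor.map snd

instance : Category.{v} (CatPullback F G) where
  Hom := Hom
  id p := ⟨𝟙 _, 𝟙 _, by
    rw [F.toFunctor.map_id, G.toFunctor.map_id, p.eq]⟩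
  comp {p q r} f g := ⟨f.fst ≫ g.fst, f.snd ≫ g.snd, by
    rw [F.toFunctor.map_comp, G.toFunctor.map_comp]
    exact heq_comp p.eq q.eq r.eq f.heq g.heq⟩
  id_comp f := Hom.ext (Category.id_comp _) (Category.id_comp _)
  comp_id f := Hom.ext (Category.comp_id _) (Category.comp_id _)
  assoc f g h := Hom.ext (Category.assoc _ _ _) (Category.assoc _ _ _)

end CatPullback

/-- A span of categories `a ⟵ apex ⟶ b`. -/
structure Spn (a b : Cat.{v, u}) where
  apex : Cat.{v, u}
  fst : apex ⟶ a
  snd : apex ⟶ b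

/-- A map of spans, with arbitrary functors between the feet. -/
@[ext]
structure SpnMap {a b c d : Cat.{v, u}} (m : Spn a b) (n : Spn c d) where
  left : a ⟶ c
  mid : m.apex ⟶ n.apex
  right : b ⟶ d
  w_left : mid ≫ n.fst = m.fst ≫ left
  w_right : mid ≫ n.snd = m.snd ≫ right

namespace SpnMap

variable {a b c d : Cat.{v, u}} {m : Spn a b} {n : Spn c d} (α : SpnMap m n)

theorem left_obj (s : m.apex) :
    n.fst.toFunctor.obj (α.mid.toFunctor.obj s) = α.left.toFunctor.obj (m.fst.toFunctor.obj s) :=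
  Cat.obj_eq α.w_left s

theorem right_obj (s : m.apex) :
    n.snd.toFunctor.obj (α.mid.toFunctor.obj s) = α.right.toFunctor.obj (m.snd.toFunctor.obj s) :=
  Cat.obj_eq α.w_right s

theorem left_map {s t : m.apex} (f : s ⟶ t) :
    n.fst.toFunctor.map (α.mid.toFunctor.map f) ≍ α.left.toFunctor.map (m.fst.toFunctor.map f) :=
  Cat.map_heq α.w_left f

theorem right_map {s t : m.apex} (f : s ⟶ t) :
    n.snd.toFunctor.map (α.mid.toFunctor.map f) ≍ α.right.toFunctor.map (m.snd.toFunctor.map f) :=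
  Cat.map_heq α.w_right f

end SpnMap

namespace Spn

/-- The external composite of spans, by pullback. -/
@[reducible]
def hcomp {a b c : Cat.{v, u}} (m : Spn a b) (n : Spn b c) : Spn a c where
  apex := Cat.of (CatPullback m.snd n.fst)
  fst := Functor.toCatHom
    { obj := fun p => m.fst.toFunctor.obj p.fst, map := fun f => m.fst.toFunctor.map f.fst,
      map_id := fun _ => m.fst.toFunctor.map_id _,
      map_comp := fun _ _ => m.fst.toFunctor.map_comp _ _ }
  snd := Functor.toCatHom
    { obj := fun p => n.snd.toFunctor.obj p.snd, map := fun f => n.snd.toFunctor.map f.snd,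
      map_id := fun _ => n.snd.toFunctor.map_id _,
      map_comp := fun _ _ => n.snd.toFunctor.map_comp _ _ }

/-- The identity span. -/
@[reducible]
def hid (a : Cat.{v, u}) : Spn a a := ⟨a, 𝟙 a, 𝟙 a⟩

/-- The identity map of a span. -/
@[reducible]
def idMap {a b : Cat.{v, u}} (m : Spn a b) : SpnMap m m := ⟨𝟙 a, 𝟙 _, 𝟙 b, rfl, rfl⟩

/-- The composite of maps of spans. -/
@[reducible]
def vcomp {a b c d e f : Cat.{v, u}} {m : Spn a b} {n : Spn c d} {p : Spn e f}
    (α : SpnMap m n) (β : SpnMap n p) : SpnMap m p where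
  left := α.left ≫ β.left
  mid := α.mid ≫ β.mid
  right := α.right ≫ β.right
  w_left := by rw [Category.assoc, β.w_left, ← Category.assoc, α.w_left, Category.assoc]
  w_right := by rw [Category.assoc, β.w_right, ← Category.assoc, α.w_right, Category.assoc]

/-- The identity map between identity spans on a functor. -/
@[reducible]
def hidMap {a b : Cat.{v, u}} (f : a ⟶ b) : SpnMap (hid a) (hid b) := ⟨f, f, f, rfl, rfl⟩

/-- The external composite of maps of spans, by the functoriality of pullbacks. -/
@[reducible]
def hcompMap {a b c a' b' c' : Cat.{v, u}} {m : Spn a b} {n : Spn b c} {m' : Spn a' b'}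
    {n' : Spn b' c'} (α : SpnMap m m') (β : SpnMap n n') (h : α.right = β.left) :
    SpnMap (m.hcomp n) (m'.hcomp n') where
  left := α.left
  mid := Functor.toCatHom
    { obj := fun p => ⟨α.mid.toFunctor.obj p.fst, β.mid.toFunctor.obj p.snd, by
        rw [α.right_obj, β.left_obj, h, p.eq]⟩
      map := fun {p q} f => ⟨α.mid.toFunctor.map f.fst, β.mid.toFunctor.map f.snd,
        (α.right_map f.fst).trans
          ((_root_.map_heq (congrArg Cat.Hom.toFunctor h) p.eq q.eq f.heq).trans
            (β.left_map f.snd).symm)⟩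
      map_id := fun p => CatPullback.Hom.ext (α.mid.toFunctor.map_id _) (β.mid.toFunctor.map_id _)
      map_comp := fun f g =>
        CatPullback.Hom.ext (α.mid.toFunctor.map_comp _ _) (β.mid.toFunctor.map_comp _ _) }
  right := β.right
  w_left := Cat.Hom.ext (Functor.hext (fun p => α.left_obj p.fst) (fun _ _ f => α.left_map f.fst))
  w_right :=
    Cat.Hom.ext (Functor.hext (fun p => β.right_obj p.snd) (fun _ _ f => β.right_map f.snd))

/-- The associator for the external composition of spans. -/
@[reducible]
def assoc {a b c d : Cat.{v, u}} (m : Spn a b) (n : Spn b c) (p : Spn c d) :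
    SpnMap ((m.hcomp n).hcomp p) (m.hcomp (n.hcomp p)) where
  left := 𝟙 a
  mid := Functor.toCatHom
    { obj := fun s => ⟨s.fst.fst, ⟨s.fst.snd, s.snd, s.eq⟩, s.fst.eq⟩
      map := fun f => ⟨f.fst.fst, ⟨f.fst.snd, f.snd, f.heq⟩, f.fst.heq⟩ }
  right := 𝟙 d
  w_left := rfl
  w_right := rfl

/-- The inverse of the associator. -/
@[reducible]
def assocInv {a b c d : Cat.{v, u}} (m : Spn a b) (n : Spn b c) (p : Spn c d) :
    SpnMap (m.hcomp (n.hcomp p)) ((m.hcomp n).hcomp p) where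
  left := 𝟙 a
  mid := Functor.toCatHom
    { obj := fun s => ⟨⟨s.fst, s.snd.fst, s.eq⟩, s.snd.snd, s.snd.eq⟩
      map := fun f => ⟨⟨f.fst, f.snd.fst, f.heq⟩, f.snd.snd, f.snd.heq⟩ }
  right := 𝟙 d
  w_left := rfl
  w_right := rfl

/-- The left unitor for the external composition of spans. -/
@[reducible]
def leftUnitor {a b : Cat.{v, u}} (m : Spn a b) : SpnMap ((hid a).hcomp m) m where
  left := 𝟙 a
  mid := Functor.toCatHom { obj := fun s => s.snd, map := fun f => f.snd }
  right := 𝟙 b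
  w_left := Cat.Hom.ext (Functor.hext (fun p => p.eq.symm) (fun _ _ f => f.heq.symm))
  w_right := rfl

/-- The inverse of the left unitor. -/
@[reducible]
def leftUnitorInv {a b : Cat.{v, u}} (m : Spn a b) : SpnMap m ((hid a).hcomp m) where
  left := 𝟙 a
  mid := Functor.toCatHom
    { obj := fun s => ⟨m.fst.toFunctor.obj s, s, rfl⟩
      map := fun f => ⟨m.fst.toFunctor.map f, f, HEq.rfl⟩
      map_id := fun _ => CatPullback.Hom.ext (m.fst.toFunctor.map_id _) rfl
      map_comp := fun _ _ => CatPullback.Hom.ext (m.fst.toFunctor.map_comp _ _) rfl }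
  right := 𝟙 b
  w_left := rfl
  w_right := rfl

/-- The right unitor for the external composition of spans. -/
@[reducible]
def rightUnitor {a b : Cat.{v, u}} (m : Spn a b) : SpnMap (m.hcomp (hid b)) m where
  left := 𝟙 a
  mid := Functor.toCatHom { obj := fun s => s.fst, map := fun f => f.fst }
  right := 𝟙 b
  w_left := rfl
  w_right := Cat.Hom.ext (Functor.hext (fun p => p.eq) (fun _ _ f => f.heq))

/-- The inverse of the right unitor. -/
@[reducible]
def rightUnitorInv {a b : Cat.{v, u}} (m : Spn a b) : SpnMap m (m.hcomp (hid b)) where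
  left := 𝟙 a
  mid := Functor.toCatHom
    { obj := fun s => ⟨s, m.snd.toFunctor.obj s, rfl⟩
      map := fun f => ⟨f, m.snd.toFunctor.map f, HEq.rfl⟩
      map_id := fun _ => CatPullback.Hom.ext rfl (m.snd.toFunctor.map_id _)
      map_comp := fun _ _ => CatPullback.Hom.ext rfl (m.snd.toFunctor.map_comp _ _) }
  right := 𝟙 b
  w_left := rfl
  w_right := rfl

theorem toPullback_ext {C A B X : Cat.{v, u}} {F : A ⟶ X} {G : B ⟶ X}
    {H K : C ⟶ Cat.of (CatPullback F G)}
    (h₁ : ∀ x, (H.toFunctor.obj x).fst = (K.toFunctor.obj x).fst)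
    (h₂ : ∀ x, (H.toFunctor.obj x).snd = (K.toFunctor.obj x).snd)
    (h₃ : ∀ {x y : C} (f : x ⟶ y), (H.toFunctor.map f).fst ≍ (K.toFunctor.map f).fst)
    (h₄ : ∀ {x y : C} (f : x ⟶ y), (H.toFunctor.map f).snd ≍ (K.toFunctor.map f).snd) : H = K := by
  have key : ∀ {p q p' q' : CatPullback F G} (f : p ⟶ q) (f' : p' ⟶ q'), p = p' → q = q' →
      f.fst ≍ f'.fst → f.snd ≍ f'.snd → f ≍ f' := by
    rintro p q p' q' f f' rfl rfl h h'
    exact heq_of_eq (CatPullback.Hom.ext (eq_of_heq h) (eq_of_heq h'))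
  have hobj : ∀ x, H.toFunctor.obj x = K.toFunctor.obj x := by
    intro x
    have e₁ := h₁ x
    have e₂ := h₂ x
    generalize H.toFunctor.obj x = p at *
    generalize K.toFunctor.obj x = q at *
    cases p; cases q; cases e₁; cases e₂; rfl
  exact Cat.Hom.ext (Functor.hext hobj fun x y f => key _ _ (hobj x) (hobj y) (h₃ f) (h₄ f))

theorem leftUnitor_leftUnitorInv {a b : Cat.{v, u}} (m : Spn a b) :
    vcomp (leftUnitor m) (leftUnitorInv m) = idMap _ :=
  SpnMap.ext rfl
    (toPullback_ext (fun x => x.eq.symm) (fun _ => rfl) (fun f => f.heq.symm) fun _ => HEq.rfl) rfl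

theorem rightUnitor_rightUnitorInv {a b : Cat.{v, u}} (m : Spn a b) :
    vcomp (rightUnitor m) (rightUnitorInv m) = idMap _ :=
  SpnMap.ext rfl
    (toPullback_ext (fun _ => rfl) (fun x => x.eq) (fun _ => HEq.rfl) fun f => f.heq) rfl

/-- The data of the double category of spans of categories. -/
def doubleCategoryData : DoubleCategoryData where
  Obj := Cat.{v, u}
  Pro := Spn
  Cell := SpnMap
  src := SpnMap.left
  tgt := SpnMap.right
  idCell := idMap
  vcomp := vcomp
  hcomp := hcomp
  hcompCell := hcompMap
  hid := hid
  hidCell := hidMap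

/-- The double category of spans of categories: its objects and arrows are categories and
functors, its proarrows are spans of categories, its cells are maps of spans, and external
composition is by strict pullback. -/
def doubleCategory : DoubleCategory where
  toDoubleCategoryData := doubleCategoryData.{v, u}
  str.id_vcomp _ := SpnMap.ext (Category.id_comp _) (Category.id_comp _) (Category.id_comp _)
  str.vcomp_id _ := SpnMap.ext (Category.comp_id _) (Category.comp_id _) (Category.comp_id _)
  str.vcomp_assoc _ _ _ :=
    SpnMap.ext (Category.assoc _ _ _) (Category.assoc _ _ _) (Category.assoc _ _ _)
  str.src_idCell _ := rfl
  str.tgt_idCell _ := rfl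
  str.src_vcomp _ _ := rfl
  str.tgt_vcomp _ _ := rfl
  str.src_hcompCell _ _ _ := rfl
  str.tgt_hcompCell _ _ _ := rfl
  str.src_hidCell _ := rfl
  str.tgt_hidCell _ := rfl
  str.hcompCell_id _ _ := rfl
  str.hcompCell_vcomp _ _ _ _ _ _ := rfl
  str.hidCell_id _ := rfl
  str.hidCell_comp _ _ := rfl
  str.assoc := assoc
  str.assocInv := assocInv
  str.leftUnitor := leftUnitor
  str.leftUnitorInv := leftUnitorInv
  str.rightUnitor := rightUnitor
  str.rightUnitorInv := rightUnitorInv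
  str.assoc_assocInv _ _ _ := rfl
  str.assocInv_assoc _ _ _ := rfl
  str.leftUnitor_leftUnitorInv := leftUnitor_leftUnitorInv
  str.leftUnitorInv_leftUnitor _ := rfl
  str.rightUnitor_rightUnitorInv := rightUnitor_rightUnitorInv
  str.rightUnitorInv_rightUnitor _ := rfl
  str.src_assoc _ _ _ := rfl
  str.tgt_assoc _ _ _ := rfl
  str.src_leftUnitor _ := rfl
  str.tgt_leftUnitor _ := rfl
  str.src_rightUnitor _ := rfl
  str.tgt_rightUnitor _ := rfl
  str.assoc_naturality _ _ _ _ _ := rfl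
  str.leftUnitor_naturality _ := rfl
  str.rightUnitor_naturality _ := rfl
  str.triangle _ _ := rfl
  str.pentagon _ _ _ _ := rfl

end Spn

end Spans

/-! ## Comma categories -/

section CommaLax

section Casts

variable {X : Type u} [Category.{v} X] {Y : Type u'} [Category.{v'} Y]

/-- Transport of a morphism along equalities between objects. -/
def homCast {a b a' b' : X} (ha : a = a') (hb : b = b') (f : a ⟶ b) : a' ⟶ b' :=
  eqToHom ha.symm ≫ f ≫ eqToHom hb

theorem homCast_heq {a b a' b' : X} (ha : a = a') (hb : b = b') (f : a ⟶ b) :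
    homCast ha hb f ≍ f := by
  subst ha hb; simp [homCast]

/-- The composite of two morphisms that match up to an equality between objects. -/
def homGlue {a b b' c : X} (f : a ⟶ b) (h : b = b') (g : b' ⟶ c) : a ⟶ c :=
  f ≫ eqToHom h ≫ g

theorem map_homGlue (F : X ⥤ Y) {a b b' c : X} (f : a ⟶ b) (h : b = b') (g : b' ⟶ c) :
    F.map (homGlue f h g) = homGlue (F.map f) (congrArg F.obj h) (F.map g) := by
  subst h; simp [homGlue]

theorem homGlue_assoc {a b b' c c' d : X} (f : a ⟶ b) (h : b = b') (g : b' ⟶ c) (h' : c = c')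
    (k : c' ⟶ d) : homGlue (homGlue f h g) h' k = homGlue f h (homGlue g h' k) := by
  simp [homGlue]

theorem homGlue_heq {a b b' c a₁ b₁ b₁' c₁ : X} {f : a ⟶ b} {h : b = b'} {g : b' ⟶ c}
    {f₁ : a₁ ⟶ b₁} {h₁ : b₁ = b₁'} {g₁ : b₁' ⟶ c₁} (ea : a = a₁) (eb : b = b₁) (ec : c = c₁)
    (ef : f ≍ f₁) (eg : g ≍ g₁) : homGlue f h g ≍ homGlue f₁ h₁ g₁ := by
  subst ea eb ec h h₁ ef eg; rfl

theorem homGlue_id_left {a b c : X} {f : a ⟶ b} {h : b = c} {d : X} {g : c ⟶ d}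
    (e : a = b) (ef : f ≍ 𝟙 b) : homGlue f h g ≍ g := by
  subst e h ef; simp [homGlue]

theorem homGlue_id_right {a b c : X} {f : a ⟶ b} {h : b = c} {d : X} {g : c ⟶ d}
    (e : d = c) (eg : g ≍ 𝟙 c) : homGlue f h g ≍ f := by
  subst e h eg; simp [homGlue]

theorem map_heq_map (F : X ⥤ Y) {a b a' b' : X} (ha : a = a') (hb : b = b') {f : a ⟶ b}
    {f' : a' ⟶ b'} (h : f ≍ f') : F.map f ≍ F.map f' := by
  subst ha hb h; rfl

theorem sq_of_heq {a b c d a' b' c' d' : X} {f : a ⟶ b} {g : b ⟶ d} {h : a ⟶ c} {k : c ⟶ d}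
    {f' : a' ⟶ b'} {g' : b' ⟶ d'} {h' : a' ⟶ c'} {k' : c' ⟶ d'} (w : f ≫ g = h ≫ k)
    (ea : a = a') (eb : b = b') (ec : c = c') (ed : d = d')
    (ef : f ≍ f') (eg : g ≍ g') (eh : h ≍ h') (ek : k ≍ k') : f' ≫ g' = h' ≫ k' := by
  subst ea eb ec ed ef eg eh ek; exact w

theorem sq_homGlue {a b b' c a₁ b₁ b₁' c₁ : X} {f : a ⟶ b} {e : b = b'} {g : b' ⟶ c}
    {f₁ : a₁ ⟶ b₁} {e₁ : b₁ = b₁'} {g₁ : b₁' ⟶ c₁} {h : a ⟶ a₁} {k : b ⟶ b₁} {k' : b' ⟶ b₁'}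
    {l : c ⟶ c₁} (hk : k ≍ k') (w : h ≫ f₁ = f ≫ k) (w' : k' ≫ g₁ = g ≫ l) :
    h ≫ homGlue f₁ e₁ g₁ = homGlue f e g ≫ l := by
  subst e e₁ hk
  simp only [homGlue, eqToHom_refl, Category.id_comp, Category.assoc]
  rw [← w', ← Category.assoc, w, Category.assoc]

end Casts

variable {a b c d : Cat.{w, w}}

theorem Csp.w_left_obj {m : Csp a b} {n : Csp c d} (α : CspMap m n) (s : a) :
    α.mid.toFunctor.obj (m.inl.toFunctor.obj s) = n.inl.toFunctor.obj (α.left.toFunctor.obj s) :=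
  Cat.obj_eq α.w_left s

theorem Csp.w_right_obj {m : Csp a b} {n : Csp c d} (α : CspMap m n) (s : b) :
    α.mid.toFunctor.obj (m.inr.toFunctor.obj s) = n.inr.toFunctor.obj (α.right.toFunctor.obj s) :=
  Cat.obj_eq α.w_right s

theorem Csp.w_left_map {m : Csp a b} {n : Csp c d} (α : CspMap m n) {s t : a} (f : s ⟶ t) :
    α.mid.toFunctor.map (m.inl.toFunctor.map f) ≍ n.inl.toFunctor.map (α.left.toFunctor.map f) :=
  Cat.map_heq α.w_left f

theorem Csp.w_right_map {m : Csp a b} {n : Csp c d} (α : CspMap m n) {s t : b} (f : s ⟶ t) :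
    α.mid.toFunctor.map (m.inr.toFunctor.map f) ≍ n.inr.toFunctor.map (α.right.toFunctor.map f) :=
  Cat.map_heq α.w_right f

namespace CommaLax

/-- The comma span `A ⟵ i/o ⟶ B` of a cospan of functors `i : A ⟶ X ⟵ B : o`. -/
@[reducible]
def pro (m : Csp a b) : Spn a b where
  apex := Cat.of (Comma m.inl.toFunctor m.inr.toFunctor)
  fst := (Comma.fst _ _).toCatHom
  snd := (Comma.snd _ _).toCatHom

theorem hom_heq {m : Csp a b} {n : Csp c d} (α : CspMap m n)
    (s : Comma m.inl.toFunctor m.inr.toFunctor) :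
    homCast (Csp.w_left_obj α s.left) (Csp.w_right_obj α s.right) (α.mid.toFunctor.map s.hom) ≍
      α.mid.toFunctor.map s.hom :=
  homCast_heq _ _ _

/-- The map of comma spans induced by a map `(H, F, K)` of cospans; its apex functor sends
`(a, f, b)` to `(H a, F f, K b)` and `(h, k)` to `(H h, K k)`. -/
@[reducible]
def cell {m : Csp a b} {n : Csp c d} (α : CspMap m n) : SpnMap (pro m) (pro n) where
  left := α.left
  mid := Functor.toCatHom
    { obj := fun s =>
        { left := α.left.toFunctor.obj s.left
          right := α.right.toFunctor.obj s.right
          hom := homCast (Csp.w_left_obj α _) (Csp.w_right_obj α _) (α.mid.toFunctor.map s.hom) }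
      map := fun {s t} f =>
        { left := α.left.toFunctor.map f.left
          right := α.right.toFunctor.map f.right
          w := by
            have h := congrArg α.mid.toFunctor.map f.w
            rw [Functor.map_comp, Functor.map_comp] at h
            exact sq_of_heq h (Csp.w_left_obj α _) (Csp.w_left_obj α _) (Csp.w_right_obj α _)
              (Csp.w_right_obj α _) (Csp.w_left_map α _) (hom_heq α t).symm
              (hom_heq α s).symm (Csp.w_right_map α _) } }
  right := α.right
  w_left := rfl
  w_right := rfl

theorem condition_obj (m : Csp a b) (n : Csp b c) (s : b) :
    (pushout.inl m.inr n.inl).toFunctor.obj (m.inr.toFunctor.obj s) =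
      (pushout.inr m.inr n.inl).toFunctor.obj (n.inl.toFunctor.obj s) :=
  Cat.obj_eq (pushout.condition (f := m.inr) (g := n.inl)) s

theorem condition_map (m : Csp a b) (n : Csp b c) {s t : b} (f : s ⟶ t) :
    (pushout.inl m.inr n.inl).toFunctor.map (m.inr.toFunctor.map f) ≍
      (pushout.inr m.inr n.inl).toFunctor.map (n.inl.toFunctor.map f) :=
  Cat.map_heq (pushout.condition (f := m.inr) (g := n.inl)) f

theorem glue_eq (m : Csp a b) (n : Csp b c) {s t : b} (h : s = t) :
    (pushout.inl m.inr n.inl).toFunctor.obj (m.inr.toFunctor.obj s) =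
      (pushout.inr m.inr n.inl).toFunctor.obj (n.inl.toFunctor.obj t) := by
  rw [condition_obj, h]

/-- The composite, in the pushout of the apexes of two composable cospans of functors, of the
images of two morphisms. -/
noncomputable def glue (m : Csp a b) (n : Csp b c) {x : m.apex} {y : n.apex} {s t : b}
    (f : x ⟶ m.inr.toFunctor.obj s) (h : s = t) (g : n.inl.toFunctor.obj t ⟶ y) :
    (pushout.inl m.inr n.inl).toFunctor.obj x ⟶ (pushout.inr m.inr n.inl).toFunctor.obj y :=
  homGlue ((pushout.inl m.inr n.inl).toFunctor.map f) (glue_eq m n h)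
    ((pushout.inr m.inr n.inl).toFunctor.map g)

/-- The laxator: its apex functor sends a pair of objects `(a, f, b)` and `(b, g, c)` to
`(a, ι g ∘ ι f, c)` and a pair of maps `(h, k)` and `(k, l)` to `(h, l)`. -/
@[reducible]
noncomputable def laxator (m : Csp a b) (n : Csp b c) :
    SpnMap ((pro m).hcomp (pro n)) (pro (m.hcomp n)) where
  left := 𝟙 a
  mid := Functor.toCatHom
    { obj := fun p =>
        { left := p.fst.left
          right := p.snd.right
          hom := glue m n p.fst.hom p.eq p.snd.hom }
      map := fun {p q} f =>
        { left := f.fst.left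
          right := f.snd.right
          w := by
            have e₁ := congrArg (pushout.inl m.inr n.inl).toFunctor.map f.fst.w
            have e₂ := congrArg (pushout.inr m.inr n.inl).toFunctor.map f.snd.w
            rw [Functor.map_comp, Functor.map_comp] at e₁ e₂
            exact sq_homGlue ((condition_map m n _).trans
              (map_heq_map (n.inl.toFunctor ⋙ (pushout.inr m.inr n.inl).toFunctor)
                p.eq q.eq f.heq)) e₁ e₂ } }
  right := 𝟙 c
  w_left := rfl
  w_right := rfl

/-- The unitor: its apex functor sends `a` to `(a, 𝟙 a, a)` and `h` to `(h, h)`. -/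
@[reducible]
def unitor (a : Cat.{w, w}) : SpnMap (Spn.hid a) (pro (Csp.hid a)) where
  left := 𝟙 a
  mid := Functor.toCatHom
    { obj := fun s => { left := s, right := s, hom := 𝟙 s }
      map := fun f =>
        { left := f
          right := f
          w := (Category.comp_id f).trans (Category.id_comp f).symm } }
  right := 𝟙 a
  w_left := rfl
  w_right := rfl

theorem comma_ext {A B X : Type w} [Category.{w} A] [Category.{w} B] [Category.{w} X]
    {F : A ⥤ X} {G : B ⥤ X} {s t : Comma F G} (h₁ : s.left = t.left) (h₂ : s.right = t.right)
    (h₃ : s.hom ≍ t.hom) : s = t := by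
  cases s; cases t; cases h₁; cases h₂; cases h₃; rfl

theorem commaHom_heq {A B X : Type w} [Category.{w} A] [Category.{w} B] [Category.{w} X]
    {F : A ⥤ X} {G : B ⥤ X} {s t s' t' : Comma F G} {f : s ⟶ t} {g : s' ⟶ t'} (h : s = s')
    (h' : t = t') (h₁ : f.left ≍ g.left) (h₂ : f.right ≍ g.right) : f ≍ g := by
  subst h h'
  exact heq_of_eq (CommaMorphism.ext (eq_of_heq h₁) (eq_of_heq h₂))

theorem toComma_ext {A B X C : Cat.{w, w}} {F : A ⟶ X} {G : B ⟶ X}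
    {H K : C ⟶ Cat.of (Comma F.toFunctor G.toFunctor)}
    (h₁ : ∀ x, (H.toFunctor.obj x).left = (K.toFunctor.obj x).left)
    (h₂ : ∀ x, (H.toFunctor.obj x).right = (K.toFunctor.obj x).right)
    (h₃ : ∀ x, (H.toFunctor.obj x).hom ≍ (K.toFunctor.obj x).hom)
    (h₄ : ∀ {x y : C} (f : x ⟶ y), (H.toFunctor.map f).left ≍ (K.toFunctor.map f).left)
    (h₅ : ∀ {x y : C} (f : x ⟶ y), (H.toFunctor.map f).right ≍ (K.toFunctor.map f).right) :
    H = K :=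
  have hobj := fun x => comma_ext (h₁ x) (h₂ x) (h₃ x)
  Cat.Hom.ext (Functor.hext hobj fun x y f => commaHom_heq (hobj x) (hobj y) (h₄ f) (h₅ f))

theorem cell_id (m : Csp a b) : cell (Csp.idMap m) = Spn.idMap (pro m) :=
  SpnMap.ext rfl
    (toComma_ext (fun _ => rfl) (fun _ => rfl) (fun s => hom_heq (Csp.idMap m) s)
      (fun _ => HEq.rfl) (fun _ => HEq.rfl)) rfl

theorem cell_vcomp {a b c d e f : Cat.{w, w}} {m : Csp a b} {n : Csp c d} {p : Csp e f}
    (α : CspMap m n) (β : CspMap n p) :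
    cell (Csp.vcomp α β) = Spn.vcomp (cell α) (cell β) :=
  SpnMap.ext rfl
    (toComma_ext (fun _ => rfl) (fun _ => rfl)
      (fun s => (hom_heq (Csp.vcomp α β) s).trans <|
        ((hom_heq β ((cell α).mid.toFunctor.obj s)).trans
          (map_heq_map β.mid.toFunctor (Csp.w_left_obj α _).symm (Csp.w_right_obj α _).symm
            (hom_heq α s))).symm)
      (fun _ => HEq.rfl) (fun _ => HEq.rfl)) rfl

theorem unitor_naturality {a b : Cat.{w, w}} (f : a ⟶ b) :
    Spn.vcomp (Spn.hidMap f) (unitor b) = Spn.vcomp (unitor a) (cell (Csp.hidMap f)) :=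
  SpnMap.ext rfl
    (toComma_ext (fun _ => rfl) (fun _ => rfl)
      (fun s => ((hom_heq (Csp.hidMap f) ((unitor a).mid.toFunctor.obj s)).trans (heq_of_eq (f.toFunctor.map_id _))).symm)
      (fun _ => HEq.rfl) (fun _ => HEq.rfl)) rfl

theorem inl_desc_obj {a b c z : Cat.{w, w}} {f : a ⟶ b} {g : a ⟶ c} (h : b ⟶ z) (k : c ⟶ z)
    (w : f ≫ h = g ≫ k) (x : b) : (pushout.desc h k w).toFunctor.obj
      ((pushout.inl f g).toFunctor.obj x) = h.toFunctor.obj x :=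
  Cat.obj_eq (pushout.inl_desc h k w) x

theorem inr_desc_obj {a b c z : Cat.{w, w}} {f : a ⟶ b} {g : a ⟶ c} (h : b ⟶ z) (k : c ⟶ z)
    (w : f ≫ h = g ≫ k) (x : c) : (pushout.desc h k w).toFunctor.obj
      ((pushout.inr f g).toFunctor.obj x) = k.toFunctor.obj x :=
  Cat.obj_eq (pushout.inr_desc h k w) x

theorem inl_desc_map {a b c z : Cat.{w, w}} {f : a ⟶ b} {g : a ⟶ c} (h : b ⟶ z) (k : c ⟶ z)
    (w : f ≫ h = g ≫ k) {x y : b} (r : x ⟶ y) : (pushout.desc h k w).toFunctor.map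
      ((pushout.inl f g).toFunctor.map r) ≍ h.toFunctor.map r :=
  Cat.map_heq (pushout.inl_desc h k w) r

theorem inr_desc_map {a b c z : Cat.{w, w}} {f : a ⟶ b} {g : a ⟶ c} (h : b ⟶ z) (k : c ⟶ z)
    (w : f ≫ h = g ≫ k) {x y : c} (r : x ⟶ y) : (pushout.desc h k w).toFunctor.map
      ((pushout.inr f g).toFunctor.map r) ≍ k.toFunctor.map r :=
  Cat.map_heq (pushout.inr_desc h k w) r

theorem glue_desc_eq {m : Csp a b} {n : Csp b c} {z : Cat.{w, w}} (H : m.apex ⟶ z)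
    (K : n.apex ⟶ z) (w : m.inr ≫ H = n.inl ≫ K) {s t : b} (h : s = t) :
    H.toFunctor.obj (m.inr.toFunctor.obj s) = K.toFunctor.obj (n.inl.toFunctor.obj t) := by
  rw [h]
  exact Cat.obj_eq w t

/-- The image of a composite under a functor out of the pushout. -/
theorem desc_laxator {m : Csp a b} {n : Csp b c} {z : Cat.{w, w}} (H : m.apex ⟶ z)
    (K : n.apex ⟶ z) (w : m.inr ≫ H = n.inl ≫ K) (p : CatPullback (pro m).snd (pro n).fst) :
    (pushout.desc H K w).toFunctor.map ((laxator m n).mid.toFunctor.obj p).hom ≍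
      homGlue (H.toFunctor.map p.fst.hom) (glue_desc_eq H K w p.eq)
        (K.toFunctor.map p.snd.hom) := by
  change (pushout.desc H K w).toFunctor.map (homGlue _ _ _) ≍ _
  rw [map_homGlue]
  exact homGlue_heq (inl_desc_obj _ _ _ _) (inl_desc_obj _ _ _ _) (inr_desc_obj _ _ _ _)
    (inl_desc_map _ _ _ _) (inr_desc_map _ _ _ _)

theorem laxator_naturality {a b c a' b' c' : Cat.{w, w}} {m : Csp a b} {n : Csp b c}
    {m' : Csp a' b'} {n' : Csp b' c'} (α : CspMap m m') (β : CspMap n n')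
    (h : α.right = β.left) :
    Spn.vcomp (Spn.hcompMap (cell α) (cell β) h) (laxator m' n') =
      Spn.vcomp (laxator m n) (cell (Csp.hcompMap α β h)) :=
  SpnMap.ext rfl
    (toComma_ext (fun _ => rfl) (fun _ => rfl)
      (fun p => by
        refine HEq.trans ?_ (hom_heq (Csp.hcompMap α β h)
          ((laxator m n).mid.toFunctor.obj p)).symm
        refine HEq.trans ?_ (desc_laxator _ _ _ p).symm
        exact homGlue_heq (congrArg _ (Csp.w_left_obj α _).symm)
          (congrArg _ (Csp.w_right_obj α _).symm) (congrArg _ (Csp.w_right_obj β _).symm)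
          (map_heq_map _ (Csp.w_left_obj α _).symm (Csp.w_right_obj α _).symm
            (hom_heq α p.fst))
          (map_heq_map _ (Csp.w_left_obj β _).symm (Csp.w_right_obj β _).symm
            (hom_heq β p.snd)))
      (fun _ => HEq.rfl) (fun _ => HEq.rfl)) rfl

theorem laxator_leftUnitor {a b : Cat.{w, w}} (m : Csp a b) :
    Spn.vcomp (Spn.vcomp (Spn.hcompMap (unitor a) (Spn.idMap (pro m)) rfl)
      (laxator (Csp.hid a) m)) (cell (Csp.leftUnitor m)) = Spn.leftUnitor (pro m) :=
  SpnMap.ext rfl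
    (toComma_ext (fun p => p.eq) (fun _ => rfl)
      (fun _ => (hom_heq (Csp.leftUnitor m) _).trans ((desc_laxator _ _ _ _).trans
        (homGlue_id_left rfl (heq_of_eq (m.inl.toFunctor.map_id _)))))
      (fun f => f.heq) (fun _ => HEq.rfl)) rfl

theorem laxator_rightUnitor {a b : Cat.{w, w}} (m : Csp a b) :
    Spn.vcomp (Spn.vcomp (Spn.hcompMap (Spn.idMap (pro m)) (unitor b) rfl)
      (laxator m (Csp.hid b))) (cell (Csp.rightUnitor m)) = Spn.rightUnitor (pro m) :=
  SpnMap.ext rfl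
    (toComma_ext (fun _ => rfl) (fun p => p.eq.symm)
      (fun _ => (hom_heq (Csp.rightUnitor m) _).trans ((desc_laxator _ _ _ _).trans
        (homGlue_id_right rfl (heq_of_eq (m.inr.toFunctor.map_id _)))))
      (fun _ => HEq.rfl) (fun f => f.heq.symm)) rfl

theorem laxator_assoc {a b c d : Cat.{w, w}} (m : Csp a b) (n : Csp b c) (p : Csp c d) :
    Spn.vcomp (Spn.vcomp (Spn.hcompMap (laxator m n) (Spn.idMap (pro p)) rfl)
        (laxator (m.hcomp n) p)) (cell (Csp.assoc m n p)) =
      Spn.vcomp (Spn.vcomp (Spn.assoc (pro m) (pro n) (pro p))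
        (Spn.hcompMap (Spn.idMap (pro m)) (laxator n p) rfl)) (laxator m (n.hcomp p)) :=
  SpnMap.ext rfl
    (toComma_ext (fun _ => rfl) (fun _ => rfl)
      (fun q => by
        refine (hom_heq (Csp.assoc m n p) _).trans ((desc_laxator _ _ _ _).trans ?_)
        have e₁ := desc_laxator (m := m) (n := n) (pushout.inl m.inr (n.hcomp p).inl)
          (pushout.inl n.inr p.inl ≫ pushout.inr m.inr (n.hcomp p).inl)
          (Csp.condition m (n.hcomp p)) q.fst
        have e₂ := glue_desc_eq (m := n) (n := p)
          (pushout.inl n.inr p.inl ≫ pushout.inr m.inr (n.hcomp p).inl)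
          (pushout.inr n.inr p.inl ≫ pushout.inr m.inr (n.hcomp p).inl)
          (Csp.condition_assoc n p _) q.eq
        refine HEq.trans (homGlue_heq (h₁ := e₂) (inl_desc_obj _ _ _ _) (inr_desc_obj _ _ _ _)
          rfl e₁ HEq.rfl) ?_
        refine (heq_of_eq (homGlue_assoc _ _ _ _ _)).trans ?_
        refine homGlue_heq rfl rfl rfl HEq.rfl (heq_of_eq (Eq.symm ?_))
        exact map_homGlue (pushout.inr m.inr (n.hcomp p).inl).toFunctor _ _ _)
      (fun _ => HEq.rfl) (fun _ => HEq.rfl)) rfl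

end CommaLax

/-- The comma lax double functor from cospans of categories to spans of categories. -/
noncomputable def commaLax :
    LaxDoubleFunctor (Csp.doubleCategory Cat.{w, w}) Spn.doubleCategory.{w, w} where
  obj := 𝟭 _
  pro := CommaLax.pro
  cell := CommaLax.cell
  src_cell _ := rfl
  tgt_cell _ := rfl
  cell_id := CommaLax.cell_id
  cell_vcomp := CommaLax.cell_vcomp
  laxator := CommaLax.laxator
  unitor := CommaLax.unitor
  src_laxator _ _ := rfl
  tgt_laxator _ _ := rfl
  src_unitor _ := rfl
  tgt_unitor _ := rfl
  laxator_naturality := CommaLax.laxator_naturality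
  unitor_naturality := CommaLax.unitor_naturality
  laxator_assoc := CommaLax.laxator_assoc
  laxator_leftUnitor := CommaLax.laxator_leftUnitor
  laxator_rightUnitor := CommaLax.laxator_rightUnitor

end CommaLax

/-! ## The double Grothendieck construction -/

section DoubleGrothendieckConstruction

namespace DoubleGrothendieck

variable {A : DoubleCategory.{w, x, v, u}} (F : LaxDoubleFunctor A Spn.doubleCategory.{v', u'})

/-- The functor of objects and arrows underlying `F`. -/
@[reducible]
def baseFunctor : A.Obj ⥤ Cat.{v', u'} := F.obj

/-- The span assigned by `F` to a proarrow. -/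
@[reducible]
def span {a b : A.Obj} (m : A.Pro a b) : Spn ((baseFunctor F).obj a) ((baseFunctor F).obj b) :=
  F.pro m

/-- The map of spans assigned by `F` to a cell. -/
@[reducible]
def spanMap {a b c d : A.Obj} {m : A.Pro a b} {n : A.Pro c d} (α : A.Cell m n) :
    SpnMap (span F m) (span F n) :=
  F.cell α

/-- The laxator of `F`. -/
@[reducible]
def lax {a b c : A.Obj} (m : A.Pro a b) (n : A.Pro b c) :
    SpnMap ((span F m).hcomp (span F n)) (span F (A.hcomp m n)) :=
  F.laxator m n

/-- The unitor of `F`. -/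
@[reducible]
def unit (a : A.Obj) : SpnMap (Spn.hid ((baseFunctor F).obj a)) (span F (A.hid a)) :=
  F.unitor a

/-- A proarrow in the double Grothendieck construction: a proarrow `m` of the base with an object
in the apex of the span assigned to `m`, lying over the given objects. -/
@[ext]
structure Pro (X Y : Grothendieck (baseFunctor F)) where
  base : A.Pro X.base Y.base
  fiber : (span F base).apex
  fst_eq : (span F base).fst.toFunctor.obj fiber = X.fiber
  snd_eq : (span F base).snd.toFunctor.obj fiber = Y.fiber

/-- A cell in the double Grothendieck construction: a cell `α` of the base with a morphism from the
image of the source object under the functor between apexes assigned to `α`. -/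
structure Cell {X Y X' Y' : Grothendieck (baseFunctor F)} (P : Pro F X Y) (Q : Pro F X' Y') where
  base : A.Cell P.base Q.base
  fiber : (spanMap F base).mid.toFunctor.obj P.fiber ⟶ Q.fiber

variable {F}

theorem Cell.ext {X Y X' Y' : Grothendieck (baseFunctor F)} {P : Pro F X Y} {Q : Pro F X' Y'}
    {α β : Cell F P Q} (h : α.base = β.base) (h' : α.fiber ≍ β.fiber) : α = β := by
  cases α; cases β; cases h; cases h'; rfl

variable {X Y Z W X' Y' Z' W' X'' Y'' Z'' : Grothendieck (baseFunctor F)}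

theorem src_obj {P : Pro F X Y} {Q : Pro F X' Y'} (α : A.Cell P.base Q.base) :
    (span F Q.base).fst.toFunctor.obj ((spanMap F α).mid.toFunctor.obj P.fiber) =
      ((baseFunctor F).map (A.src α)).toFunctor.obj X.fiber := by
  rw [(spanMap F α).left_obj, P.fst_eq]
  exact Cat.obj_eq (F.src_cell α) _

theorem tgt_obj {P : Pro F X Y} {Q : Pro F X' Y'} (α : A.Cell P.base Q.base) :
    (span F Q.base).snd.toFunctor.obj ((spanMap F α).mid.toFunctor.obj P.fiber) =
      ((baseFunctor F).map (A.tgt α)).toFunctor.obj Y.fiber := by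
  rw [(spanMap F α).right_obj, P.snd_eq]
  exact Cat.obj_eq (F.tgt_cell α) _

/-- The left boundary of a cell. -/
@[reducible]
def src {P : Pro F X Y} {Q : Pro F X' Y'} (α : Cell F P Q) : X ⟶ X' where
  base := A.src α.base
  fiber := homCast (src_obj α.base) Q.fst_eq ((span F Q.base).fst.toFunctor.map α.fiber)

/-- The right boundary of a cell. -/
@[reducible]
def tgt {P : Pro F X Y} {Q : Pro F X' Y'} (α : Cell F P Q) : Y ⟶ Y' where
  base := A.tgt α.base
  fiber := homCast (tgt_obj α.base) Q.snd_eq ((span F Q.base).snd.toFunctor.map α.fiber)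

theorem src_fiber_heq {P : Pro F X Y} {Q : Pro F X' Y'} (α : Cell F P Q) :
    (src α).fiber ≍ (span F Q.base).fst.toFunctor.map α.fiber :=
  homCast_heq (src_obj α.base) Q.fst_eq _

theorem tgt_fiber_heq {P : Pro F X Y} {Q : Pro F X' Y'} (α : Cell F P Q) :
    (tgt α).fiber ≍ (span F Q.base).snd.toFunctor.map α.fiber :=
  homCast_heq (tgt_obj α.base) Q.snd_eq _

/-- A cell whose component in the apex is an identity. -/
@[reducible]
def lift {P : Pro F X Y} {Q : Pro F X' Y'} (α : A.Cell P.base Q.base)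
    (h : (spanMap F α).mid.toFunctor.obj P.fiber = Q.fiber) : Cell F P Q :=
  ⟨α, eqToHom h⟩

theorem id_obj (P : Pro F X Y) :
    (spanMap F (A.idCell P.base)).mid.toFunctor.obj P.fiber = P.fiber :=
  Cat.obj_eq (congrArg SpnMap.mid (F.cell_id P.base)) _

/-- The identity cell on a proarrow. -/
@[reducible]
def idCell (P : Pro F X Y) : Cell F P P := lift (A.idCell P.base) (id_obj P)

theorem vcomp_eq {a b c d e f : A.Obj} {m : A.Pro a b} {n : A.Pro c d} {p : A.Pro e f}
    (α : A.Cell m n) (β : A.Cell n p) :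
    (spanMap F (A.vcomp α β)).mid = (spanMap F α).mid ≫ (spanMap F β).mid :=
  congrArg SpnMap.mid (F.cell_vcomp α β)

/-- The internal composite of cells. -/
@[reducible]
def vcomp {P : Pro F X Y} {Q : Pro F X' Y'} {R : Pro F X'' Y''} (α : Cell F P Q)
    (β : Cell F Q R) : Cell F P R where
  base := A.vcomp α.base β.base
  fiber := eqToHom (Cat.obj_eq (vcomp_eq α.base β.base) _) ≫
    (spanMap F β.base).mid.toFunctor.map α.fiber ≫ β.fiber

theorem lax_fst_obj {a b c : A.Obj} (m : A.Pro a b) (n : A.Pro b c)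
    (p : CatPullback (span F m).snd (span F n).fst) :
    (span F (A.hcomp m n)).fst.toFunctor.obj ((lax F m n).mid.toFunctor.obj p) =
      (span F m).fst.toFunctor.obj p.fst :=
  ((lax F m n).left_obj p).trans (Cat.obj_eq (F.src_laxator m n) _)

theorem lax_snd_obj {a b c : A.Obj} (m : A.Pro a b) (n : A.Pro b c)
    (p : CatPullback (span F m).snd (span F n).fst) :
    (span F (A.hcomp m n)).snd.toFunctor.obj ((lax F m n).mid.toFunctor.obj p) =
      (span F n).snd.toFunctor.obj p.snd :=
  ((lax F m n).right_obj p).trans (Cat.obj_eq (F.tgt_laxator m n) _)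

theorem lax_fst_map {a b c : A.Obj} (m : A.Pro a b) (n : A.Pro b c)
    {p q : CatPullback (span F m).snd (span F n).fst} (f : p ⟶ q) :
    (span F (A.hcomp m n)).fst.toFunctor.map ((lax F m n).mid.toFunctor.map f) ≍
      (span F m).fst.toFunctor.map f.fst :=
  ((lax F m n).left_map f).trans
    (Cat.map_heq (F.src_laxator m n) (((span F m).hcomp (span F n)).fst.toFunctor.map f))

theorem lax_snd_map {a b c : A.Obj} (m : A.Pro a b) (n : A.Pro b c)
    {p q : CatPullback (span F m).snd (span F n).fst} (f : p ⟶ q) :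
    (span F (A.hcomp m n)).snd.toFunctor.map ((lax F m n).mid.toFunctor.map f) ≍
      (span F n).snd.toFunctor.map f.snd :=
  ((lax F m n).right_map f).trans
    (Cat.map_heq (F.tgt_laxator m n) (((span F m).hcomp (span F n)).snd.toFunctor.map f))

/-- The external composite of proarrows, by the laxators of `F`. -/
@[reducible]
def hcomp (P : Pro F X Y) (Q : Pro F Y Z) : Pro F X Z where
  base := A.hcomp P.base Q.base
  fiber := (lax F P.base Q.base).mid.toFunctor.obj ⟨P.fiber, Q.fiber, P.snd_eq.trans Q.fst_eq.symm⟩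
  fst_eq := (lax_fst_obj _ _ _).trans P.fst_eq
  snd_eq := (lax_snd_obj _ _ _).trans Q.snd_eq

theorem base_eq {f g : X ⟶ Y} (h : f = g) : f.base = g.base := by rw [h]

theorem fiber_heq {f g : X ⟶ Y} (h : f = g) : f.fiber ≍ g.fiber := by rw [h]

theorem hcompCell_eq {a b c a' b' c' : A.Obj} {m : A.Pro a b} {n : A.Pro b c}
    {m' : A.Pro a' b'} {n' : A.Pro b' c'} (α : A.Cell m m') (β : A.Cell n n')
    (h : A.tgt α = A.src β) :
    (lax F m n).mid ≫ (spanMap F (A.hcompCell α β h)).mid =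
      (Spn.hcompMap (spanMap F α) (spanMap F β)
        ((F.tgt_cell α).trans ((congrArg _ h).trans (F.src_cell β).symm))).mid ≫
      (lax F m' n').mid :=
  (congrArg SpnMap.mid (F.laxator_naturality α β h)).symm

theorem hcompCell_heq {P : Pro F X Y} {Q : Pro F Y Z} {P' : Pro F X' Y'} {Q' : Pro F Y' Z'}
    (α : Cell F P P') (β : Cell F Q Q') (h : tgt α = src β) :
    (span F P'.base).snd.toFunctor.map α.fiber ≍ (span F Q'.base).fst.toFunctor.map β.fiber :=
  (tgt_fiber_heq α).symm.trans ((fiber_heq h).trans (src_fiber_heq β))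

/-- The morphism in the strict pullback of the apexes given by a pair of composable cells. -/
@[reducible]
def pairHom {P : Pro F X Y} {Q : Pro F Y Z} {P' : Pro F X' Y'} {Q' : Pro F Y' Z'}
    (α : Cell F P P') (β : Cell F Q Q') (h : tgt α = src β) :
    (Spn.hcompMap (spanMap F α.base) (spanMap F β.base)
        ((F.tgt_cell α.base).trans
          ((congrArg _ (base_eq h)).trans (F.src_cell β.base).symm))).mid.toFunctor.obj
        ⟨P.fiber, Q.fiber, P.snd_eq.trans Q.fst_eq.symm⟩ ⟶
      (⟨P'.fiber, Q'.fiber, P'.snd_eq.trans Q'.fst_eq.symm⟩ :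
        CatPullback (span F P'.base).snd (span F Q'.base).fst) :=
  CatPullback.Hom.mk α.fiber β.fiber (hcompCell_heq α β h)

/-- The external composite of cells, by the laxators of `F`. -/
@[reducible]
def hcompCell {P : Pro F X Y} {Q : Pro F Y Z} {P' : Pro F X' Y'} {Q' : Pro F Y' Z'}
    (α : Cell F P P') (β : Cell F Q Q') (h : tgt α = src β) :
    Cell F (hcomp P Q) (hcomp P' Q') where
  base := A.hcompCell α.base β.base (base_eq h)
  fiber := eqToHom (Cat.obj_eq (hcompCell_eq α.base β.base (base_eq h)) _) ≫
    (lax F P'.base Q'.base).mid.toFunctor.map (pairHom α β h)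

/-- The external identity, by the unitors of `F`. -/
@[reducible]
def hid (X : Grothendieck (baseFunctor F)) : Pro F X X where
  base := A.hid X.base
  fiber := (unit F X.base).mid.toFunctor.obj X.fiber
  fst_eq := ((unit F X.base).left_obj X.fiber).trans (Cat.obj_eq (F.src_unitor X.base) _)
  snd_eq := ((unit F X.base).right_obj X.fiber).trans (Cat.obj_eq (F.tgt_unitor X.base) _)

theorem hidCell_eq {a b : A.Obj} (f : a ⟶ b) :
    (unit F a).mid ≫ (spanMap F (A.hidCell f)).mid = (baseFunctor F).map f ≫ (unit F b).mid :=
  (congrArg SpnMap.mid (F.unitor_naturality f)).symm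

/-- The external identity on an arrow. -/
@[reducible]
def hidCell (f : X ⟶ Y) : Cell F (hid X) (hid Y) where
  base := A.hidCell f.base
  fiber := eqToHom (Cat.obj_eq (hidCell_eq f.base) _) ≫ (unit F Y.base).mid.toFunctor.map f.fiber

theorem vcomp_fiber_heq {P : Pro F X Y} {Q : Pro F X' Y'} {R : Pro F X'' Y''} (α : Cell F P Q)
    (β : Cell F Q R) :
    (vcomp α β).fiber ≍ (spanMap F β.base).mid.toFunctor.map α.fiber ≫ β.fiber :=
  eqToHom_comp_heq _ _

theorem hcompCell_fiber_heq {P : Pro F X Y} {Q : Pro F Y Z} {P' : Pro F X' Y'} {Q' : Pro F Y' Z'}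
    (α : Cell F P P') (β : Cell F Q Q') (h : tgt α = src β) :
    (hcompCell α β h).fiber ≍
      (lax F P'.base Q'.base).mid.toFunctor.map (pairHom α β h) :=
  eqToHom_comp_heq _ _

theorem hidCell_fiber_heq (f : X ⟶ Y) :
    (hidCell f).fiber ≍ (unit F Y.base).mid.toFunctor.map f.fiber :=
  eqToHom_comp_heq _ _

theorem grothendieck_ext {X Y : Grothendieck (baseFunctor F)} {f g : X ⟶ Y}
    (h : f.base = g.base) (h' : f.fiber ≍ g.fiber) : f = g := by
  refine Grothendieck.ext f g h (eq_of_heq ?_)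
  exact (eqToHom_comp_heq _ _).trans h'

theorem comp_fiber_heq (f : X ⟶ Y) (g : Y ⟶ Z) :
    (f ≫ g).fiber ≍ ((baseFunctor F).map g.base).toFunctor.map f.fiber ≫ g.fiber := by
  rw [Grothendieck.comp_fiber]
  exact eqToHom_comp_heq _ _

theorem pullback_map_heq {a b c : Cat.{v', u'}} {m : Spn a b} {n : Spn b c}
    {p q p' q' : CatPullback m.snd n.fst} {f : p ⟶ q} {g : p' ⟶ q'}
    (h₁ : p.fst = p'.fst) (h₂ : p.snd = p'.snd) (h₃ : q.fst = q'.fst) (h₄ : q.snd = q'.snd)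
    (h₅ : f.fst ≍ g.fst) (h₆ : f.snd ≍ g.snd) : f ≍ g := by
  cases p; cases q; cases p'; cases q'
  cases h₁; cases h₂; cases h₃; cases h₄
  exact heq_of_eq (CatPullback.Hom.ext (eq_of_heq h₅) (eq_of_heq h₆))

theorem pullback_ext {a b c : Cat.{v', u'}} {m : Spn a b} {n : Spn b c}
    {p q : CatPullback m.snd n.fst} (h₁ : p.fst = q.fst) (h₂ : p.snd = q.snd) : p = q := by
  cases p; cases q; cases h₁; cases h₂; rfl

theorem eqToHom_heq_eqToHom {C : Type u'} [Category.{v'} C] {a b a' b' : C} (h : b = b')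
    (h₁ : a = b) (h₂ : a' = b') : eqToHom h₁ ≍ eqToHom h₂ := by
  subst h₁ h h₂; rfl

/-- The property that the component of a cell in the apex is an identity. -/
def IsLift {P : Pro F X Y} {Q : Pro F X' Y'} (α : Cell F P Q) : Prop :=
  ∃ h : (spanMap F α.base).mid.toFunctor.obj P.fiber = Q.fiber, α.fiber = eqToHom h

theorem lift_isLift {P : Pro F X Y} {Q : Pro F X' Y'} (α : A.Cell P.base Q.base)
    (h : (spanMap F α).mid.toFunctor.obj P.fiber = Q.fiber) :
    IsLift (lift (P := P) (Q := Q) α h) := ⟨h, rfl⟩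

theorem IsLift.heq {P : Pro F X Y} {Q : Pro F X' Y'} {α : Cell F P Q} (h : IsLift α) :
    α.fiber ≍ 𝟙 Q.fiber := by
  obtain ⟨h, e⟩ := h
  rw [e]
  exact eqToHom_heq_id_cod _ _ h

theorem IsLift.ext {P : Pro F X Y} {Q : Pro F X' Y'} {α β : Cell F P Q} (hα : IsLift α)
    (hβ : IsLift β) (h : α.base = β.base) : α = β :=
  Cell.ext h (hα.heq.trans hβ.heq.symm)

theorem vcomp_fiber_left {P : Pro F X Y} {Q : Pro F X' Y'} {R : Pro F X'' Y''} (α : Cell F P Q)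
    (β : Cell F Q R) (h : IsLift α) : (vcomp α β).fiber ≍ β.fiber := by
  obtain ⟨h, e⟩ := h
  refine (vcomp_fiber_heq _ _).trans ?_
  rw [e, eqToHom_map]
  exact eqToHom_comp_heq _ _

theorem vcomp_fiber_right {P : Pro F X Y} {Q : Pro F X' Y'} {R : Pro F X'' Y''} (α : Cell F P Q)
    (β : Cell F Q R) (h : IsLift β) :
    (vcomp α β).fiber ≍ (spanMap F β.base).mid.toFunctor.map α.fiber := by
  obtain ⟨h, e⟩ := h
  refine (vcomp_fiber_heq _ _).trans ?_
  rw [e]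
  exact comp_eqToHom_heq _ h

theorem IsLift.vcomp {P : Pro F X Y} {Q : Pro F X' Y'} {R : Pro F X'' Y''} {α : Cell F P Q}
    {β : Cell F Q R} (hα : IsLift α) (hβ : IsLift β) : IsLift (vcomp α β) := by
  have h := hβ.choose
  have e := (vcomp_fiber_left α β hα).trans hβ.heq
  have h' : (spanMap F (A.vcomp α.base β.base)).mid.toFunctor.obj P.fiber = R.fiber := by
    rw [← h, ← hα.choose]
    exact Cat.obj_eq (vcomp_eq α.base β.base) _
  exact ⟨h', eq_of_heq (e.trans (eqToHom_heq_id_cod _ _ h').symm)⟩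

theorem IsLift.hcompCell {P : Pro F X Y} {Q : Pro F Y Z} {P' : Pro F X' Y'} {Q' : Pro F Y' Z'}
    {α : Cell F P P'} {β : Cell F Q Q'} (hα : IsLift α) (hβ : IsLift β) (h : tgt α = src β) :
    IsLift (hcompCell α β h) := by
  have e := pullback_ext (m := span F P'.base) (n := span F Q'.base)
    (p := (Spn.hcompMap (spanMap F α.base) (spanMap F β.base)
        ((F.tgt_cell α.base).trans
          ((congrArg _ (base_eq h)).trans (F.src_cell β.base).symm))).mid.toFunctor.obj
        ⟨P.fiber, Q.fiber, P.snd_eq.trans Q.fst_eq.symm⟩)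
    (q := ⟨P'.fiber, Q'.fiber, P'.snd_eq.trans Q'.fst_eq.symm⟩) hα.choose hβ.choose
  have h' : (spanMap F (A.hcompCell α.base β.base (base_eq h))).mid.toFunctor.obj
      (hcomp P Q).fiber = (hcomp P' Q').fiber :=
    (Cat.obj_eq (hcompCell_eq α.base β.base (base_eq h)) _).trans (congrArg _ e)
  refine ⟨h', eq_of_heq (((hcompCell_fiber_heq α β h).trans ?_).trans
    (eqToHom_heq_id_cod _ _ h').symm)⟩
  refine (map_heq_map _ e rfl (f' := 𝟙 _) ?_).trans
    (heq_of_eq ((lax F P'.base Q'.base).mid.toFunctor.map_id _))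
  exact pullback_map_heq hα.choose hβ.choose rfl rfl hα.heq hβ.heq

theorem id_vcomp {P : Pro F X Y} {Q : Pro F X' Y'} (α : Cell F P Q) :
    vcomp (idCell P) α = α :=
  Cell.ext (A.str.id_vcomp _) (vcomp_fiber_left _ _ (lift_isLift _ _))

theorem vcomp_id {P : Pro F X Y} {Q : Pro F X' Y'} (α : Cell F P Q) :
    vcomp α (idCell Q) = α :=
  Cell.ext (A.str.vcomp_id _) ((vcomp_fiber_right _ _ (lift_isLift _ _)).trans
    (Cat.map_heq (congrArg SpnMap.mid (F.cell_id Q.base)) _))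

theorem vcomp_assoc {X₃ Y₃ : Grothendieck (baseFunctor F)} {P : Pro F X Y} {Q : Pro F X' Y'}
    {R : Pro F X'' Y''} {S : Pro F X₃ Y₃} (α : Cell F P Q) (β : Cell F Q R) (γ : Cell F R S) :
    vcomp (vcomp α β) γ = vcomp α (vcomp β γ) := by
  refine Cell.ext (A.str.vcomp_assoc _ _ _) ?_
  refine (vcomp_fiber_heq _ γ).trans (HEq.trans ?_ (vcomp_fiber_heq α _).symm)
  have e := vcomp_eq (F := F) β.base γ.base
  refine (heq_comp (congrArg _ (Cat.obj_eq (vcomp_eq α.base β.base) _)) rfl rfl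
    (map_heq_map (spanMap F γ.base).mid.toFunctor (Cat.obj_eq (vcomp_eq α.base β.base) _) rfl
      (vcomp_fiber_heq α β)) HEq.rfl).trans ?_
  rw [Functor.map_comp, Category.assoc]
  exact heq_comp (Cat.obj_eq e _).symm (Cat.obj_eq e _).symm rfl (Cat.map_heq e _).symm
    (vcomp_fiber_heq β γ).symm

theorem src_idCell (P : Pro F X Y) : src (idCell P) = 𝟙 X := by
  refine grothendieck_ext (A.str.src_idCell _) ((src_fiber_heq _).trans ?_)
  rw [eqToHom_map, Grothendieck.id_fiber]
  exact eqToHom_heq_eqToHom P.fst_eq _ _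

theorem tgt_idCell (P : Pro F X Y) : tgt (idCell P) = 𝟙 Y := by
  refine grothendieck_ext (A.str.tgt_idCell _) ((tgt_fiber_heq _).trans ?_)
  rw [eqToHom_map, Grothendieck.id_fiber]
  exact eqToHom_heq_eqToHom P.snd_eq _ _

theorem src_vcomp {P : Pro F X Y} {Q : Pro F X' Y'} {R : Pro F X'' Y''} (α : Cell F P Q)
    (β : Cell F Q R) : src (vcomp α β) = src α ≫ src β := by
  refine grothendieck_ext (A.str.src_vcomp _ _) ((src_fiber_heq _).trans ?_)
  refine HEq.trans ?_ (comp_fiber_heq _ _).symm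
  refine (map_heq_map _ (Cat.obj_eq (vcomp_eq α.base β.base) _) rfl (vcomp_fiber_heq α β)).trans ?_
  rw [Functor.map_comp]
  have e : (spanMap F β.base).left = (baseFunctor F).map (A.src β.base) := F.src_cell β.base
  refine heq_comp ?_ ?_ R.fst_eq ?_ (src_fiber_heq β).symm
  · exact ((spanMap F β.base).left_obj _).trans ((Cat.obj_eq e _).trans (congrArg _ (src_obj α.base)))
  · exact src_obj β.base
  · refine ((spanMap F β.base).left_map α.fiber).trans ((Cat.map_heq e _).trans ?_)
    exact map_heq_map _ (src_obj α.base) Q.fst_eq (src_fiber_heq α).symm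

theorem tgt_vcomp {P : Pro F X Y} {Q : Pro F X' Y'} {R : Pro F X'' Y''} (α : Cell F P Q)
    (β : Cell F Q R) : tgt (vcomp α β) = tgt α ≫ tgt β := by
  refine grothendieck_ext (A.str.tgt_vcomp _ _) ((tgt_fiber_heq _).trans ?_)
  refine HEq.trans ?_ (comp_fiber_heq _ _).symm
  refine (map_heq_map _ (Cat.obj_eq (vcomp_eq α.base β.base) _) rfl (vcomp_fiber_heq α β)).trans ?_
  rw [Functor.map_comp]
  have e : (spanMap F β.base).right = (baseFunctor F).map (A.tgt β.base) := F.tgt_cell β.base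
  refine heq_comp ?_ ?_ R.snd_eq ?_ (tgt_fiber_heq β).symm
  · exact ((spanMap F β.base).right_obj _).trans ((Cat.obj_eq e _).trans (congrArg _ (tgt_obj α.base)))
  · exact tgt_obj β.base
  · refine ((spanMap F β.base).right_map α.fiber).trans ((Cat.map_heq e _).trans ?_)
    exact map_heq_map _ (tgt_obj α.base) Q.snd_eq (tgt_fiber_heq α).symm

theorem src_hcompCell {P : Pro F X Y} {Q : Pro F Y Z} {P' : Pro F X' Y'} {Q' : Pro F Y' Z'}
    (α : Cell F P P') (β : Cell F Q Q') (h : tgt α = src β) :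
    src (hcompCell α β h) = src α := by
  refine grothendieck_ext (A.str.src_hcompCell _ _ _) ((src_fiber_heq _).trans ?_)
  refine HEq.trans ?_ (src_fiber_heq α).symm
  exact (map_heq_map _ (Cat.obj_eq (hcompCell_eq α.base β.base (base_eq h)) _) rfl
    (hcompCell_fiber_heq α β h)).trans (lax_fst_map P'.base Q'.base (pairHom α β h))

theorem tgt_hcompCell {P : Pro F X Y} {Q : Pro F Y Z} {P' : Pro F X' Y'} {Q' : Pro F Y' Z'}
    (α : Cell F P P') (β : Cell F Q Q') (h : tgt α = src β) :
    tgt (hcompCell α β h) = tgt β := by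
  refine grothendieck_ext (A.str.tgt_hcompCell _ _ _) ((tgt_fiber_heq _).trans ?_)
  refine HEq.trans ?_ (tgt_fiber_heq β).symm
  exact (map_heq_map _ (Cat.obj_eq (hcompCell_eq α.base β.base (base_eq h)) _) rfl
    (hcompCell_fiber_heq α β h)).trans (lax_snd_map P'.base Q'.base (pairHom α β h))

theorem src_hidCell (f : X ⟶ Y) : src (hidCell f) = f := by
  refine grothendieck_ext (A.str.src_hidCell _) ((src_fiber_heq _).trans ?_)
  refine (map_heq_map _ (Cat.obj_eq (hidCell_eq f.base) _) rfl (hidCell_fiber_heq f)).trans ?_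
  exact ((unit F Y.base).left_map f.fiber).trans (Cat.map_heq (F.src_unitor Y.base) _)

theorem tgt_hidCell (f : X ⟶ Y) : tgt (hidCell f) = f := by
  refine grothendieck_ext (A.str.tgt_hidCell _) ((tgt_fiber_heq _).trans ?_)
  refine (map_heq_map _ (Cat.obj_eq (hidCell_eq f.base) _) rfl (hidCell_fiber_heq f)).trans ?_
  exact ((unit F Y.base).right_map f.fiber).trans (Cat.map_heq (F.tgt_unitor Y.base) _)

theorem hcompCell_id (P : Pro F X Y) (Q : Pro F Y Z) :
    hcompCell (idCell P) (idCell Q) ((tgt_idCell P).trans (src_idCell Q).symm) =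
      idCell (hcomp P Q) :=
  ((lift_isLift _ _).hcompCell (lift_isLift _ _) _).ext (lift_isLift _ _) (A.str.hcompCell_id _ _)

theorem hcompCell_vcomp {P : Pro F X Y} {Q : Pro F Y Z} {P' : Pro F X' Y'} {Q' : Pro F Y' Z'}
    {P'' : Pro F X'' Y''} {Q'' : Pro F Y'' Z''} (α : Cell F P P') (α' : Cell F P' P'')
    (β : Cell F Q Q') (β' : Cell F Q' Q'') (h : tgt α = src β) (h' : tgt α' = src β') :
    hcompCell (vcomp α α') (vcomp β β') (by rw [tgt_vcomp, src_vcomp, h, h']) =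
      vcomp (hcompCell α β h) (hcompCell α' β' h') := by
  refine Cell.ext (A.str.hcompCell_vcomp _ _ _ _ (base_eq h) (base_eq h')) ?_
  refine (hcompCell_fiber_heq _ _ _).trans (HEq.trans ?_ (vcomp_fiber_heq _ _).symm)
  have e := hcompCell_eq (F := F) α'.base β'.base (base_eq h')
  refine HEq.trans ?_ (heq_comp ?_ rfl rfl (map_heq_map
      (spanMap F (A.hcompCell α'.base β'.base (base_eq h'))).mid.toFunctor
    (Cat.obj_eq (hcompCell_eq α.base β.base (base_eq h)) _).symm rfl
    (hcompCell_fiber_heq α β h).symm) HEq.rfl)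
  refine HEq.trans ?_ (heq_comp (Cat.obj_eq e _).symm (Cat.obj_eq e _).symm rfl
    (Cat.map_heq e (pairHom α β h)).symm (hcompCell_fiber_heq α' β' h').symm)
  on_goal 2 => exact congrArg _ (Cat.obj_eq (hcompCell_eq α.base β.base (base_eq h)) _).symm
  refine HEq.trans ?_ (heq_of_eq ((lax F P''.base Q''.base).mid.toFunctor.map_comp _ _))
  exact map_heq_map _
    (pullback_ext (Cat.obj_eq (vcomp_eq α.base α'.base) _)
      (Cat.obj_eq (vcomp_eq β.base β'.base) _)) rfl
    (pullback_map_heq (Cat.obj_eq (vcomp_eq α.base α'.base) _)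
      (Cat.obj_eq (vcomp_eq β.base β'.base) _) rfl rfl (vcomp_fiber_heq α α')
      (vcomp_fiber_heq β β'))

theorem hidCell_id (X : Grothendieck (baseFunctor F)) : hidCell (𝟙 X) = idCell (hid X) := by
  refine Cell.ext (A.str.hidCell_id _) ((hidCell_fiber_heq _).trans
    (HEq.trans ?_ (lift_isLift _ _).heq.symm))
  rw [Grothendieck.id_fiber, eqToHom_map]
  exact eqToHom_heq_id_cod _ _ _

theorem hidCell_comp (f : X ⟶ Y) (g : Y ⟶ Z) :
    hidCell (f ≫ g) = vcomp (hidCell f) (hidCell g) := by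
  refine Cell.ext (A.str.hidCell_comp _ _) ((hidCell_fiber_heq _).trans
    (HEq.trans ?_ (vcomp_fiber_heq _ _).symm))
  have e := hidCell_eq (F := F) g.base
  have e' : ((baseFunctor F).map (f ≫ g).base).toFunctor.obj X.fiber =
      ((baseFunctor F).map g.base).toFunctor.obj
        (((baseFunctor F).map f.base).toFunctor.obj X.fiber) :=
    Cat.obj_eq ((baseFunctor F).map_comp f.base g.base) _
  refine (map_heq_map _ e' rfl (comp_fiber_heq f g)).trans ?_
  rw [Functor.map_comp]
  refine heq_comp ?_ (Cat.obj_eq e _).symm rfl ?_ (hidCell_fiber_heq g).symm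
  · exact (Cat.obj_eq e _).symm.trans (congrArg _ (Cat.obj_eq (hidCell_eq f.base) _).symm)
  · exact (Cat.map_heq e f.fiber).symm.trans
      (map_heq_map _ (Cat.obj_eq (hidCell_eq f.base) _).symm rfl (hidCell_fiber_heq f).symm)

theorem assoc_eq {a b c d : A.Obj} (m : A.Pro a b) (n : A.Pro b c) (p : A.Pro c d) :
    ((Spn.hcompMap (lax F m n) (Spn.idMap (span F p)) (F.tgt_laxator m n)).mid ≫
        (lax F (A.hcomp m n) p).mid) ≫ (spanMap F (A.str.assoc m n p)).mid =
      ((Spn.assoc (span F m) (span F n) (span F p)).mid ≫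
        (Spn.hcompMap (Spn.idMap (span F m)) (lax F n p) (F.src_laxator n p).symm).mid) ≫
        (lax F m (A.hcomp n p)).mid :=
  congrArg SpnMap.mid (F.laxator_assoc m n p)

theorem leftUnitor_eq {a b : A.Obj} (m : A.Pro a b) :
    ((Spn.hcompMap (unit F a) (Spn.idMap (span F m)) (F.tgt_unitor a)).mid ≫
        (lax F (A.hid a) m).mid) ≫ (spanMap F (A.str.leftUnitor m)).mid =
      (Spn.leftUnitor (span F m)).mid :=
  congrArg SpnMap.mid (F.laxator_leftUnitor m)

theorem rightUnitor_eq {a b : A.Obj} (m : A.Pro a b) :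
    ((Spn.hcompMap (Spn.idMap (span F m)) (unit F b) (F.src_unitor b).symm).mid ≫
        (lax F m (A.hid b)).mid) ≫ (spanMap F (A.str.rightUnitor m)).mid =
      (Spn.rightUnitor (span F m)).mid :=
  congrArg SpnMap.mid (F.laxator_rightUnitor m)

theorem inv_obj (P : Pro F X Y) (Q : Pro F X' Y') {α : A.Cell P.base Q.base}
    {β : A.Cell Q.base P.base} (h : (spanMap F α).mid.toFunctor.obj P.fiber = Q.fiber)
    (e : A.vcomp α β = A.idCell _) : (spanMap F β).mid.toFunctor.obj Q.fiber = P.fiber := by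
  have h₁ := Cat.obj_eq (vcomp_eq (F := F) α β) P.fiber
  rw [e] at h₁
  rw [← h]
  exact h₁.symm.trans (id_obj P)

theorem assoc_obj (P : Pro F X Y) (Q : Pro F Y Z) (R : Pro F Z W) :
    (spanMap F (A.str.assoc P.base Q.base R.base)).mid.toFunctor.obj
      (hcomp (hcomp P Q) R).fiber = (hcomp P (hcomp Q R)).fiber :=
  Cat.obj_eq (assoc_eq (F := F) P.base Q.base R.base)
    ⟨⟨P.fiber, Q.fiber, P.snd_eq.trans Q.fst_eq.symm⟩, R.fiber, Q.snd_eq.trans R.fst_eq.symm⟩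

theorem leftUnitor_obj (P : Pro F X Y) :
    (spanMap F (A.str.leftUnitor P.base)).mid.toFunctor.obj
      (hcomp (hid X) P).fiber = P.fiber :=
  Cat.obj_eq (leftUnitor_eq (F := F) P.base) ⟨X.fiber, P.fiber, P.fst_eq.symm⟩

theorem rightUnitor_obj (P : Pro F X Y) :
    (spanMap F (A.str.rightUnitor P.base)).mid.toFunctor.obj
      (hcomp P (hid Y)).fiber = P.fiber :=
  Cat.obj_eq (rightUnitor_eq (F := F) P.base) ⟨P.fiber, Y.fiber, P.snd_eq⟩

/-- The associator. -/
@[reducible]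
def assoc (P : Pro F X Y) (Q : Pro F Y Z) (R : Pro F Z W) :
    Cell F (hcomp (hcomp P Q) R) (hcomp P (hcomp Q R)) :=
  lift (A.str.assoc P.base Q.base R.base) (assoc_obj P Q R)

/-- The inverse of the associator. -/
@[reducible]
def assocInv (P : Pro F X Y) (Q : Pro F Y Z) (R : Pro F Z W) :
    Cell F (hcomp P (hcomp Q R)) (hcomp (hcomp P Q) R) :=
  lift (A.str.assocInv P.base Q.base R.base)
    (inv_obj (hcomp (hcomp P Q) R) (hcomp P (hcomp Q R)) (assoc_obj P Q R) (A.str.assoc_assocInv P.base Q.base R.base))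

/-- The left unitor. -/
@[reducible]
def leftUnitor (P : Pro F X Y) : Cell F (hcomp (hid X) P) P :=
  lift (A.str.leftUnitor P.base) (leftUnitor_obj P)

/-- The inverse of the left unitor. -/
@[reducible]
def leftUnitorInv (P : Pro F X Y) : Cell F P (hcomp (hid X) P) :=
  lift (A.str.leftUnitorInv P.base)
    (inv_obj (hcomp (hid X) P) P (leftUnitor_obj P) (A.str.leftUnitor_leftUnitorInv P.base))

/-- The right unitor. -/
@[reducible]
def rightUnitor (P : Pro F X Y) : Cell F (hcomp P (hid Y)) P :=
  lift (A.str.rightUnitor P.base) (rightUnitor_obj P)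

/-- The inverse of the right unitor. -/
@[reducible]
def rightUnitorInv (P : Pro F X Y) : Cell F P (hcomp P (hid Y)) :=
  lift (A.str.rightUnitorInv P.base)
    (inv_obj (hcomp P (hid Y)) P (rightUnitor_obj P) (A.str.rightUnitor_rightUnitorInv P.base))

theorem assoc_isLift (P : Pro F X Y) (Q : Pro F Y Z) (R : Pro F Z W) : IsLift (assoc P Q R) :=
  ⟨assoc_obj P Q R, rfl⟩

theorem assocInv_isLift (P : Pro F X Y) (Q : Pro F Y Z) (R : Pro F Z W) : IsLift (assocInv P Q R) :=
  ⟨inv_obj (hcomp (hcomp P Q) R) (hcomp P (hcomp Q R)) (assoc_obj P Q R)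
    (A.str.assoc_assocInv P.base Q.base R.base), rfl⟩

theorem leftUnitor_isLift (P : Pro F X Y) : IsLift (leftUnitor P) :=
  ⟨leftUnitor_obj P, rfl⟩

theorem leftUnitorInv_isLift (P : Pro F X Y) : IsLift (leftUnitorInv P) :=
  ⟨inv_obj (hcomp (hid X) P) P (leftUnitor_obj P)
    (A.str.leftUnitor_leftUnitorInv P.base), rfl⟩

theorem rightUnitor_isLift (P : Pro F X Y) : IsLift (rightUnitor P) :=
  ⟨rightUnitor_obj P, rfl⟩

theorem rightUnitorInv_isLift (P : Pro F X Y) : IsLift (rightUnitorInv P) :=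
  ⟨inv_obj (hcomp P (hid Y)) P (rightUnitor_obj P)
    (A.str.rightUnitor_rightUnitorInv P.base), rfl⟩

theorem idCell_isLift (P : Pro F X Y) : IsLift (idCell P) :=
  ⟨id_obj P, rfl⟩

theorem assoc_assocInv (P : Pro F X Y) (Q : Pro F Y Z) (R : Pro F Z W) :
    vcomp (assoc P Q R) (assocInv P Q R) = idCell _ :=
  ((assoc_isLift P Q R).vcomp (assocInv_isLift P Q R)).ext (idCell_isLift _) (A.str.assoc_assocInv _ _ _)

theorem assocInv_assoc (P : Pro F X Y) (Q : Pro F Y Z) (R : Pro F Z W) :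
    vcomp (assocInv P Q R) (assoc P Q R) = idCell _ :=
  ((assocInv_isLift P Q R).vcomp (assoc_isLift P Q R)).ext (idCell_isLift _) (A.str.assocInv_assoc _ _ _)

theorem leftUnitor_leftUnitorInv (P : Pro F X Y) :
    vcomp (leftUnitor P) (leftUnitorInv P) = idCell _ :=
  ((leftUnitor_isLift P).vcomp (leftUnitorInv_isLift P)).ext (idCell_isLift _) (A.str.leftUnitor_leftUnitorInv _)

theorem leftUnitorInv_leftUnitor (P : Pro F X Y) :
    vcomp (leftUnitorInv P) (leftUnitor P) = idCell _ :=
  ((leftUnitorInv_isLift P).vcomp (leftUnitor_isLift P)).ext (idCell_isLift _) (A.str.leftUnitorInv_leftUnitor _)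

theorem rightUnitor_rightUnitorInv (P : Pro F X Y) :
    vcomp (rightUnitor P) (rightUnitorInv P) = idCell _ :=
  ((rightUnitor_isLift P).vcomp (rightUnitorInv_isLift P)).ext (idCell_isLift _) (A.str.rightUnitor_rightUnitorInv _)

theorem rightUnitorInv_rightUnitor (P : Pro F X Y) :
    vcomp (rightUnitorInv P) (rightUnitor P) = idCell _ :=
  ((rightUnitorInv_isLift P).vcomp (rightUnitor_isLift P)).ext (idCell_isLift _) (A.str.rightUnitorInv_rightUnitor _)

theorem IsLift.src {P : Pro F X Y} {Q : Pro F X Y'} {α : Cell F P Q} (h : IsLift α)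
    (h' : A.src α.base = 𝟙 X.base) : src α = 𝟙 X := by
  obtain ⟨h, e⟩ := h
  refine grothendieck_ext h' ((src_fiber_heq _).trans ?_)
  rw [e, eqToHom_map, Grothendieck.id_fiber]
  exact eqToHom_heq_eqToHom Q.fst_eq _ _

theorem IsLift.tgt {P : Pro F X Y} {Q : Pro F X' Y} {α : Cell F P Q} (h : IsLift α)
    (h' : A.tgt α.base = 𝟙 Y.base) : tgt α = 𝟙 Y := by
  obtain ⟨h, e⟩ := h
  refine grothendieck_ext h' ((tgt_fiber_heq _).trans ?_)
  rw [e, eqToHom_map, Grothendieck.id_fiber]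
  exact eqToHom_heq_eqToHom Q.snd_eq _ _

theorem src_assoc (P : Pro F X Y) (Q : Pro F Y Z) (R : Pro F Z W) : src (assoc P Q R) = 𝟙 X :=
  (assoc_isLift P Q R).src (A.str.src_assoc _ _ _)

theorem tgt_assoc (P : Pro F X Y) (Q : Pro F Y Z) (R : Pro F Z W) : tgt (assoc P Q R) = 𝟙 W :=
  (assoc_isLift P Q R).tgt (A.str.tgt_assoc _ _ _)

theorem src_leftUnitor (P : Pro F X Y) : src (leftUnitor P) = 𝟙 X :=
  (leftUnitor_isLift P).src (A.str.src_leftUnitor _)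

theorem tgt_leftUnitor (P : Pro F X Y) : tgt (leftUnitor P) = 𝟙 Y :=
  (leftUnitor_isLift P).tgt (A.str.tgt_leftUnitor _)

theorem src_rightUnitor (P : Pro F X Y) : src (rightUnitor P) = 𝟙 X :=
  (rightUnitor_isLift P).src (A.str.src_rightUnitor _)

theorem tgt_rightUnitor (P : Pro F X Y) : tgt (rightUnitor P) = 𝟙 Y :=
  (rightUnitor_isLift P).tgt (A.str.tgt_rightUnitor _)

/-- The morphism in the iterated strict pullback of the apexes given by three composable cells. -/
@[reducible]
def tripleHom {P : Pro F X Y} {Q : Pro F Y Z} {R : Pro F Z W} {P' : Pro F X' Y'}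
    {Q' : Pro F Y' Z'} {R' : Pro F Z' W'} (α : Cell F P P') (β : Cell F Q Q') (γ : Cell F R R')
    (h : tgt α = src β) (h' : tgt β = src γ) :
    (Spn.hcompMap (Spn.hcompMap (spanMap F α.base) (spanMap F β.base)
        ((F.tgt_cell α.base).trans
          ((congrArg _ (base_eq h)).trans (F.src_cell β.base).symm))) (spanMap F γ.base)
        ((F.tgt_cell β.base).trans
          ((congrArg _ (base_eq h')).trans (F.src_cell γ.base).symm))).mid.toFunctor.obj
        ⟨⟨P.fiber, Q.fiber, P.snd_eq.trans Q.fst_eq.symm⟩, R.fiber,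
          Q.snd_eq.trans R.fst_eq.symm⟩ ⟶
      (⟨⟨P'.fiber, Q'.fiber, P'.snd_eq.trans Q'.fst_eq.symm⟩, R'.fiber,
          Q'.snd_eq.trans R'.fst_eq.symm⟩ :
        CatPullback ((span F P'.base).hcomp (span F Q'.base)).snd (span F R'.base).fst) :=
  CatPullback.Hom.mk (pairHom α β h) γ.fiber (hcompCell_heq β γ h')

theorem assoc_naturality {P : Pro F X Y} {Q : Pro F Y Z} {R : Pro F Z W} {P' : Pro F X' Y'}
    {Q' : Pro F Y' Z'} {R' : Pro F Z' W'} (α : Cell F P P') (β : Cell F Q Q') (γ : Cell F R R')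
    (h : tgt α = src β) (h' : tgt β = src γ) :
    vcomp (hcompCell (hcompCell α β h) γ ((tgt_hcompCell α β h).trans h')) (assoc P' Q' R') =
      vcomp (assoc P Q R)
        (hcompCell α (hcompCell β γ h') (h.trans (src_hcompCell β γ h').symm)) := by
  refine Cell.ext (A.str.assoc_naturality _ _ _ (base_eq h) (base_eq h')) ?_
  refine (vcomp_fiber_right _ _ (assoc_isLift P' Q' R')).trans
    (HEq.trans ?_ (vcomp_fiber_left _ _ (assoc_isLift P Q R)).symm)
  refine HEq.trans ?_ (hcompCell_fiber_heq _ _ _).symm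
  refine (map_heq_map _ (Cat.obj_eq (hcompCell_eq _ _ _) _) rfl
    (hcompCell_fiber_heq (hcompCell α β h) γ ((tgt_hcompCell α β h).trans h'))).trans ?_
  have e₁ := Cat.obj_eq (hcompCell_eq (F := F) α.base β.base (base_eq h))
    ⟨P.fiber, Q.fiber, P.snd_eq.trans Q.fst_eq.symm⟩
  have e₂ := Cat.obj_eq (hcompCell_eq (F := F) β.base γ.base (base_eq h'))
    ⟨Q.fiber, R.fiber, Q.snd_eq.trans R.fst_eq.symm⟩
  refine HEq.trans ?_ ((Cat.map_heq (assoc_eq (F := F) P'.base Q'.base R'.base)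
    (tripleHom α β γ h h')).trans ?_)
  · have k := pullback_map_heq
        (f := pairHom (hcompCell α β h) γ ((tgt_hcompCell α β h).trans h'))
        (g := (Spn.hcompMap (lax F P'.base Q'.base) (Spn.idMap (span F R'.base))
          (F.tgt_laxator P'.base Q'.base)).mid.toFunctor.map (tripleHom α β γ h h'))
        e₁ rfl rfl rfl (hcompCell_fiber_heq α β h) HEq.rfl
    refine map_heq_map ((lax F (A.hcomp P'.base Q'.base) R'.base).mid ≫
        (spanMap F (A.str.assoc P'.base Q'.base R'.base)).mid).toFunctor ?_ rfl k
    exact pullback_ext e₁ rfl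
  · have k := pullback_map_heq
        (f := ((Spn.assoc (span F P'.base) (span F Q'.base) (span F R'.base)).mid ≫
          (Spn.hcompMap (Spn.idMap (span F P'.base)) (lax F Q'.base R'.base)
            (F.src_laxator Q'.base R'.base).symm).mid).toFunctor.map (tripleHom α β γ h h'))
        (g := pairHom α (hcompCell β γ h') (h.trans (src_hcompCell β γ h').symm))
        rfl e₂.symm rfl rfl HEq.rfl (hcompCell_fiber_heq β γ h').symm
    refine map_heq_map (lax F P'.base (A.hcomp Q'.base R'.base)).mid.toFunctor ?_ rfl k
    exact pullback_ext rfl e₂.symm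

theorem leftUnitor_naturality {P : Pro F X Y} {P' : Pro F X' Y'} (α : Cell F P P') :
    vcomp (hcompCell (hidCell (src α)) α (tgt_hidCell _)) (leftUnitor P') =
      vcomp (leftUnitor P) α := by
  refine Cell.ext (A.str.leftUnitor_naturality _) ?_
  refine (vcomp_fiber_right _ _ (leftUnitor_isLift P')).trans
    (HEq.trans ?_ (vcomp_fiber_left _ _ (leftUnitor_isLift P)).symm)
  refine (map_heq_map _ (Cat.obj_eq (hcompCell_eq _ _ _) _) rfl
    (hcompCell_fiber_heq _ _ (tgt_hidCell (src α)))).trans ?_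
  have e := Cat.obj_eq (hidCell_eq (F := F) (src α).base) X.fiber
  let r : (⟨((baseFunctor F).map (src α).base).toFunctor.obj X.fiber,
      (spanMap F α.base).mid.toFunctor.obj P.fiber, (src_obj α.base).symm⟩ :
        CatPullback (Spn.hid ((baseFunctor F).obj X'.base)).snd (span F P'.base).fst) ⟶
      ⟨X'.fiber, P'.fiber, P'.fst_eq.symm⟩ :=
    CatPullback.Hom.mk (src α).fiber α.fiber (src_fiber_heq α)
  refine HEq.trans ?_ (Cat.map_heq (leftUnitor_eq (F := F) P'.base) r)
  have k := pullback_map_heq (f := pairHom (hidCell (src α)) α (tgt_hidCell (src α)))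
        (g := (Spn.hcompMap (unit F X'.base) (Spn.idMap (span F P'.base))
          (F.tgt_unitor X'.base)).mid.toFunctor.map r)
        e rfl rfl rfl (hidCell_fiber_heq (src α)) HEq.rfl
  refine map_heq_map ((lax F (A.hid X'.base) P'.base).mid ≫
        (spanMap F (A.str.leftUnitor P'.base)).mid).toFunctor ?_ rfl k
  exact pullback_ext e rfl

theorem rightUnitor_naturality {P : Pro F X Y} {P' : Pro F X' Y'} (α : Cell F P P') :
    vcomp (hcompCell α (hidCell (tgt α)) (src_hidCell _).symm) (rightUnitor P') =
      vcomp (rightUnitor P) α := by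
  refine Cell.ext (A.str.rightUnitor_naturality _) ?_
  refine (vcomp_fiber_right _ _ (rightUnitor_isLift P')).trans
    (HEq.trans ?_ (vcomp_fiber_left _ _ (rightUnitor_isLift P)).symm)
  refine (map_heq_map _ (Cat.obj_eq (hcompCell_eq _ _ _) _) rfl
    (hcompCell_fiber_heq _ _ (src_hidCell (tgt α)).symm)).trans ?_
  have e := Cat.obj_eq (hidCell_eq (F := F) (tgt α).base) Y.fiber
  let r : (⟨(spanMap F α.base).mid.toFunctor.obj P.fiber,
      ((baseFunctor F).map (tgt α).base).toFunctor.obj Y.fiber, tgt_obj α.base⟩ :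
        CatPullback (span F P'.base).snd (Spn.hid ((baseFunctor F).obj Y'.base)).fst) ⟶
      ⟨P'.fiber, Y'.fiber, P'.snd_eq⟩ :=
    CatPullback.Hom.mk α.fiber (tgt α).fiber (tgt_fiber_heq α).symm
  refine HEq.trans ?_ (Cat.map_heq (rightUnitor_eq (F := F) P'.base) r)
  have k := pullback_map_heq (f := pairHom α (hidCell (tgt α)) (src_hidCell (tgt α)).symm)
        (g := (Spn.hcompMap (Spn.idMap (span F P'.base)) (unit F Y'.base)
          (F.src_unitor Y'.base).symm).mid.toFunctor.map r)
        rfl e rfl rfl HEq.rfl (hidCell_fiber_heq (tgt α))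
  refine map_heq_map ((lax F P'.base (A.hid Y'.base)).mid ≫
        (spanMap F (A.str.rightUnitor P'.base)).mid).toFunctor ?_ rfl k
  exact pullback_ext rfl e

theorem triangle (P : Pro F X Y) (Q : Pro F Y Z) :
    vcomp (assoc P (hid Y) Q) (hcompCell (idCell P) (leftUnitor Q)
        ((tgt_idCell P).trans (src_leftUnitor Q).symm)) =
      hcompCell (rightUnitor P) (idCell Q) ((tgt_rightUnitor P).trans (src_idCell Q).symm) :=
  ((assoc_isLift _ _ _).vcomp ((idCell_isLift _).hcompCell (leftUnitor_isLift _) _)).ext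
    ((rightUnitor_isLift _).hcompCell (idCell_isLift _) _) (A.str.triangle _ _)

theorem pentagon {V : Grothendieck (baseFunctor F)} (P : Pro F X Y) (Q : Pro F Y Z)
    (R : Pro F Z W) (S : Pro F W V) :
    vcomp
        (vcomp (hcompCell (assoc P Q R) (idCell S) ((tgt_assoc P Q R).trans (src_idCell S).symm))
          (assoc P (hcomp Q R) S))
        (hcompCell (idCell P) (assoc Q R S) ((tgt_idCell P).trans (src_assoc Q R S).symm)) =
      vcomp (assoc (hcomp P Q) R S) (assoc P Q (hcomp R S)) :=
  ((((assoc_isLift _ _ _).hcompCell (idCell_isLift _) _).vcomp (assoc_isLift _ _ _)).vcomp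
    ((idCell_isLift _).hcompCell (assoc_isLift _ _ _) _)).ext
    ((assoc_isLift _ _ _).vcomp (assoc_isLift _ _ _)) (A.str.pentagon _ _ _ _)

variable (F) in
/-- The data of the double Grothendieck construction. -/
def doubleCategoryData : DoubleCategoryData where
  Obj := Grothendieck (baseFunctor F)
  Pro := Pro F
  Cell := Cell F
  src := src
  tgt := tgt
  idCell := idCell
  vcomp := vcomp
  hcomp := hcomp
  hcompCell := hcompCell
  hid := hid
  hidCell := hidCell

variable (F) in
/-- The double Grothendieck construction of a lax double functor into the double category of spans
of categories. Its category of objects and arrows is the Grothendieck construction of `F` on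
objects and arrows, its category of proarrows and cells is the Grothendieck construction of the
functor sending a proarrow `m` to the apex of the span `F m`, and external composites and
identities are given by the laxators and unitors of `F`. -/
def doubleCategory : DoubleCategory where
  toDoubleCategoryData := doubleCategoryData F
  str.id_vcomp := id_vcomp
  str.vcomp_id := vcomp_id
  str.vcomp_assoc := vcomp_assoc
  str.src_idCell := src_idCell
  str.tgt_idCell := tgt_idCell
  str.src_vcomp := src_vcomp
  str.tgt_vcomp := tgt_vcomp
  str.src_hcompCell := src_hcompCell
  str.tgt_hcompCell := tgt_hcompCell
  str.src_hidCell := src_hidCell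
  str.tgt_hidCell := tgt_hidCell
  str.hcompCell_id := hcompCell_id
  str.hcompCell_vcomp := hcompCell_vcomp
  str.hidCell_id := hidCell_id
  str.hidCell_comp := hidCell_comp
  str.assoc := assoc
  str.assocInv := assocInv
  str.leftUnitor := leftUnitor
  str.leftUnitorInv := leftUnitorInv
  str.rightUnitor := rightUnitor
  str.rightUnitorInv := rightUnitorInv
  str.assoc_assocInv := assoc_assocInv
  str.assocInv_assoc := assocInv_assoc
  str.leftUnitor_leftUnitorInv := leftUnitor_leftUnitorInv
  str.leftUnitorInv_leftUnitor := leftUnitorInv_leftUnitor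
  str.rightUnitor_rightUnitorInv := rightUnitor_rightUnitorInv
  str.rightUnitorInv_rightUnitor := rightUnitorInv_rightUnitor
  str.src_assoc := src_assoc
  str.tgt_assoc := tgt_assoc
  str.src_leftUnitor := src_leftUnitor
  str.tgt_leftUnitor := tgt_leftUnitor
  str.src_rightUnitor := src_rightUnitor
  str.tgt_rightUnitor := tgt_rightUnitor
  str.assoc_naturality := assoc_naturality
  str.leftUnitor_naturality := leftUnitor_naturality
  str.rightUnitor_naturality := rightUnitor_naturality
  str.triangle := triangle
  str.pentagon := pentagon

end DoubleGrothendieck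

end DoubleGrothendieckConstruction

/-! ## Process theories -/

section ProcessTheories

namespace ProcessTheory

variable {S : Type u} [Category.{v} S] (U : S ⥤ Cat.{w, w})

/-- A proarrow between objects `(A, a)` and `(B, b)` with `a ∈ U A` and `b ∈ U B`: a cospan
`i : A ⟶ X ⟵ B : o` together with a morphism `i(a) ⟶ o(b)` in `U X`. -/
structure Pro (X Y : Grothendieck U) where
  csp : Csp X.base Y.base
  hom : (U.map csp.inl).toFunctor.obj X.fiber ⟶ (U.map csp.inr).toFunctor.obj Y.fiber

variable {U}

theorem left_obj {a b c d : S} {m : Csp a b} {n : Csp c d} {H : a ⟶ c} {F : m.apex ⟶ n.apex}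
    (e : m.inl ≫ F = H ≫ n.inl) (s : U.obj a) :
    (U.map F).toFunctor.obj ((U.map m.inl).toFunctor.obj s) =
      (U.map n.inl).toFunctor.obj ((U.map H).toFunctor.obj s) :=
  Cat.obj_eq ((U.map_comp _ _).symm.trans ((congrArg _ e).trans (U.map_comp _ _))) s

theorem right_obj {a b c d : S} {m : Csp a b} {n : Csp c d} {K : b ⟶ d} {F : m.apex ⟶ n.apex}
    (e : m.inr ≫ F = K ≫ n.inr) (s : U.obj b) :
    (U.map F).toFunctor.obj ((U.map m.inr).toFunctor.obj s) =
      (U.map n.inr).toFunctor.obj ((U.map K).toFunctor.obj s) :=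
  Cat.obj_eq ((U.map_comp _ _).symm.trans ((congrArg _ e).trans (U.map_comp _ _))) s

variable (U)

/-- A cell between proarrows `(m, f)` and `(m', f')` with boundary arrows `(H, h')` and `(K, k')`:
a morphism `F` between the apexes of `m` and `m'` forming a map of cospans with `H` and `K`, such
that `f' ∘ i'(h') = o'(k') ∘ F(f)`. -/
structure Cell {X Y X' Y' : Grothendieck U} (P : Pro U X Y) (Q : Pro U X' Y') where
  src : X ⟶ X'
  tgt : Y ⟶ Y'
  mid : P.csp.apex ⟶ Q.csp.apex
  w_left : P.csp.inl ≫ mid = src.base ≫ Q.csp.inl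
  w_right : P.csp.inr ≫ mid = tgt.base ≫ Q.csp.inr
  comm : (U.map Q.csp.inl).toFunctor.map src.fiber ≫ Q.hom =
    homCast (left_obj w_left X.fiber) (right_obj w_right Y.fiber)
        ((U.map mid).toFunctor.map P.hom) ≫
      (U.map Q.csp.inr).toFunctor.map tgt.fiber

variable {U} {X Y Z X' Y' Z' X'' Y'' : Grothendieck U}

/-- The map of cospans underlying a cell. -/
@[reducible]
def Cell.cspMap {P : Pro U X Y} {Q : Pro U X' Y'} (α : Cell U P Q) : CspMap P.csp Q.csp :=
  ⟨α.src.base, α.mid, α.tgt.base, α.w_left, α.w_right⟩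

theorem comp_fiber_heq (f : X ⟶ Y) (g : Y ⟶ Z) :
    (f ≫ g).fiber ≍ (U.map g.base).toFunctor.map f.fiber ≫ g.fiber := by
  rw [Grothendieck.comp_fiber]
  exact eqToHom_comp_heq _ _

theorem id_fiber_heq (X : Grothendieck U) : Grothendieck.Hom.fiber (𝟙 X) ≍ 𝟙 X.fiber := by
  rw [Grothendieck.id_fiber]
  exact eqToHom_heq_id_cod _ _ _

theorem mid_heq {P : Pro U X Y} {Q : Pro U X' Y'} {H : X.base ⟶ X'.base} {K : Y.base ⟶ Y'.base}
    {F : P.csp.apex ⟶ Q.csp.apex} (e : P.csp.inl ≫ F = H ≫ Q.csp.inl)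
    (e' : P.csp.inr ≫ F = K ≫ Q.csp.inr) :
    homCast (left_obj e X.fiber) (right_obj e' Y.fiber) ((U.map F).toFunctor.map P.hom) ≍
      (U.map F).toFunctor.map P.hom :=
  homCast_heq _ _ _

theorem left_map_heq {a b c d : S} {m : Csp a b} {n : Csp c d} {H : a ⟶ c} {F : m.apex ⟶ n.apex}
    (e : m.inl ≫ F = H ≫ n.inl) {s t : U.obj a} (f : s ⟶ t) :
    (U.map F).toFunctor.map ((U.map m.inl).toFunctor.map f) ≍
      (U.map n.inl).toFunctor.map ((U.map H).toFunctor.map f) :=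
  Cat.map_heq ((U.map_comp _ _).symm.trans ((congrArg _ e).trans (U.map_comp _ _))) f

theorem right_map_heq {a b c d : S} {m : Csp a b} {n : Csp c d} {K : b ⟶ d}
    {F : m.apex ⟶ n.apex} (e : m.inr ≫ F = K ≫ n.inr) {s t : U.obj b} (f : s ⟶ t) :
    (U.map F).toFunctor.map ((U.map m.inr).toFunctor.map f) ≍
      (U.map n.inr).toFunctor.map ((U.map K).toFunctor.map f) :=
  Cat.map_heq ((U.map_comp _ _).symm.trans ((congrArg _ e).trans (U.map_comp _ _))) f

/-- The identity cell. -/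
@[reducible]
def idCell (P : Pro U X Y) : Cell U P P where
  src := 𝟙 X
  tgt := 𝟙 Y
  mid := 𝟙 _
  w_left := (Category.comp_id _).trans (Category.id_comp _).symm
  w_right := (Category.comp_id _).trans (Category.id_comp _).symm
  comm := by
    have e : ∀ Z : Grothendieck U, Z.fiber = (U.map (𝟙 Z.base)).toFunctor.obj Z.fiber := fun Z =>
      (Cat.obj_eq (U.map_id Z.base) Z.fiber).symm
    have k : ∀ {Z : Grothendieck U} {T : Cat.{w, w}} (G : U.obj Z.base ⟶ T),
        𝟙 (G.toFunctor.obj Z.fiber) ≍ G.toFunctor.map (Grothendieck.Hom.fiber (𝟙 Z)) := by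
      intro Z T G
      rw [← G.toFunctor.map_id]
      exact map_heq_map _ (e Z) rfl (id_fiber_heq Z).symm
    refine sq_of_heq (f := 𝟙 _) (g := P.hom) (h := P.hom) (k := 𝟙 _)
      ((Category.id_comp _).trans (Category.comp_id _).symm) (congrArg _ (e X)) rfl
      (congrArg _ (e Y)) rfl (k (U.map P.csp.inl)) HEq.rfl ?_ (k (U.map P.csp.inr))
    exact ((mid_heq (P := P) (Q := P) (Csp.idMap P.csp).w_left (Csp.idMap P.csp).w_right).trans
      (Cat.map_heq (U.map_id _) P.hom)).symm

/-- The internal composite of cells. -/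
@[reducible]
def vcomp {P : Pro U X Y} {Q : Pro U X' Y'} {R : Pro U X'' Y''} (α : Cell U P Q)
    (β : Cell U Q R) : Cell U P R where
  src := α.src ≫ β.src
  tgt := α.tgt ≫ β.tgt
  mid := α.mid ≫ β.mid
  w_left := (Csp.vcomp α.cspMap β.cspMap).w_left
  w_right := (Csp.vcomp α.cspMap β.cspMap).w_right
  comm := by
    have e₁ := congrArg (U.map β.mid).toFunctor.map α.comm
    rw [Functor.map_comp, Functor.map_comp] at e₁
    have hQ := mid_heq (P := Q) (Q := R) β.w_left β.w_right
    have hP := mid_heq (P := P) (Q := Q) α.w_left α.w_right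
    have e₂ := sq_of_heq e₁ (left_obj β.w_left _) (left_obj β.w_left _) (right_obj β.w_right _)
      (right_obj β.w_right _) (left_map_heq β.w_left α.src.fiber) hQ.symm
      (homCast_heq (left_obj β.w_left _) (right_obj β.w_right _) _).symm
      (right_map_heq β.w_right α.tgt.fiber)
    have e₃ : ∀ {Z Z' Z'' : Grothendieck U} (f : Z ⟶ Z') (g : Z' ⟶ Z''),
        (U.map g.base).toFunctor.obj ((U.map f.base).toFunctor.obj Z.fiber) =
          (U.map (f ≫ g).base).toFunctor.obj Z.fiber := fun f g =>
      (Cat.obj_eq (U.map_comp f.base g.base) _).symm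
    have e₄ : ∀ {Z Z' Z'' : Grothendieck U} (f : Z ⟶ Z') (g : Z' ⟶ Z'') {T : Cat.{w, w}}
        (G : U.obj Z''.base ⟶ T), G.toFunctor.map ((U.map g.base).toFunctor.map f.fiber) ≫
          G.toFunctor.map g.fiber ≍ G.toFunctor.map (f ≫ g).fiber := by
      intro Z Z' Z'' f g T G
      rw [← Functor.map_comp]
      exact map_heq_map _ (e₃ f g) rfl (comp_fiber_heq f g).symm
    refine sq_of_heq (f := (U.map R.csp.inl).toFunctor.map
          ((U.map β.src.base).toFunctor.map α.src.fiber) ≫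
        (U.map R.csp.inl).toFunctor.map β.src.fiber) (g := R.hom)
      (h := homCast (left_obj β.w_left _) (right_obj β.w_right _)
        ((U.map β.mid).toFunctor.map (homCast (left_obj α.w_left X.fiber)
          (right_obj α.w_right Y.fiber) ((U.map α.mid).toFunctor.map P.hom))))
      (k := (U.map R.csp.inr).toFunctor.map ((U.map β.tgt.base).toFunctor.map α.tgt.fiber) ≫
        (U.map R.csp.inr).toFunctor.map β.tgt.fiber) ?_ (congrArg _ (e₃ _ _)) rfl
      (congrArg _ (e₃ _ _)) rfl (e₄ _ _ _) HEq.rfl ?_ (e₄ _ _ _)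
    · rw [Category.assoc, β.comm, ← Category.assoc, e₂, Category.assoc]
    · refine (homCast_heq (left_obj β.w_left _) (right_obj β.w_right _) _).trans ?_
      refine (map_heq_map _ (left_obj α.w_left _).symm (right_obj α.w_right _).symm hP).trans ?_
      refine HEq.trans ?_ (mid_heq (P := P) (Q := R) (Csp.vcomp α.cspMap β.cspMap).w_left
        (Csp.vcomp α.cspMap β.cspMap).w_right).symm
      exact (Cat.map_heq (U.map_comp α.mid β.mid) P.hom).symm

/-- The external identity `(id_A, 𝟙 a)` on `(A, a)`. -/
@[reducible]
def hid (X : Grothendieck U) : Pro U X X := ⟨Csp.hid X.base, 𝟙 _⟩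

/-- The external identity on an arrow. -/
@[reducible]
def hidCell (f : X ⟶ Y) : Cell U (hid X) (hid Y) where
  src := f
  tgt := f
  mid := f.base
  w_left := (Csp.hidMap f.base).w_left
  w_right := (Csp.hidMap f.base).w_right
  comm := by
    have e := left_obj (m := Csp.hid X.base) (n := Csp.hid Y.base) (Csp.hidMap f.base).w_left
      X.fiber
    have k : homCast e e ((U.map f.base).toFunctor.map (𝟙 _)) = 𝟙 _ := by
      rw [(U.map f.base).toFunctor.map_id]
      simp [homCast]
    exact (Category.comp_id _).trans ((congrArg (· ≫ _) k).trans (Category.id_comp _)).symm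

variable [HasPushouts S]

theorem hcomp_left_obj {a b c : S} (m : Csp a b) (n : Csp b c) (s : U.obj a) :
    (pushoutComparison U m.inr n.inl).toFunctor.obj
        ((pushout.inl (U.map m.inr) (U.map n.inl)).toFunctor.obj
          ((U.map m.inl).toFunctor.obj s)) =
      (U.map (m.hcomp n).inl).toFunctor.obj s := by
  refine Eq.trans ?_ (Cat.obj_eq (U.map_comp _ _) s).symm
  exact Cat.obj_eq (inl_comp_pushoutComparison U m.inr n.inl) _

theorem hcomp_right_obj {a b c : S} (m : Csp a b) (n : Csp b c) (s : U.obj c) :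
    (pushoutComparison U m.inr n.inl).toFunctor.obj
        ((pushout.inr (U.map m.inr) (U.map n.inl)).toFunctor.obj
          ((U.map n.inr).toFunctor.obj s)) =
      (U.map (m.hcomp n).inr).toFunctor.obj s := by
  refine Eq.trans ?_ (Cat.obj_eq (U.map_comp _ _) s).symm
  exact Cat.obj_eq (inr_comp_pushoutComparison U m.inr n.inl) _

/-- The external composite of proarrows `(m, f)` and `(n, g)` from `(A, a)` via `(B, b)` to
`(C, c)`: the composite cospan, with apex `X +_B Y`, together with the composite of the images of
`f` and `g` in the pushout `U X +_{U B} U Y` mapped along the canonical functor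
`U X +_{U B} U Y ⟶ U (X +_B Y)`. -/
@[reducible]
noncomputable def hcomp (P : Pro U X Y) (Q : Pro U Y Z) : Pro U X Z where
  csp := P.csp.hcomp Q.csp
  hom := homCast (hcomp_left_obj P.csp Q.csp X.fiber) (hcomp_right_obj P.csp Q.csp Z.fiber)
    ((pushoutComparison U P.csp.inr Q.csp.inl).toFunctor.map
      (CommaLax.glue (Csp.mapPro U P.csp) (Csp.mapPro U Q.csp) P.hom rfl Q.hom))

theorem condition_obj_eq {a b c : S} (m : Csp a b) (n : Csp b c) (s : U.obj b) :
    (U.map (pushout.inl m.inr n.inl)).toFunctor.obj ((U.map m.inr).toFunctor.obj s) =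
      (U.map (pushout.inr m.inr n.inl)).toFunctor.obj ((U.map n.inl).toFunctor.obj s) :=
  Cat.obj_eq ((U.map_comp _ _).symm.trans
    ((congrArg _ pushout.condition).trans (U.map_comp _ _))) s

theorem condition_map_heq {a b c : S} (m : Csp a b) (n : Csp b c) {s t : U.obj b} (f : s ⟶ t) :
    (U.map (pushout.inl m.inr n.inl)).toFunctor.map ((U.map m.inr).toFunctor.map f) ≍
      (U.map (pushout.inr m.inr n.inl)).toFunctor.map ((U.map n.inl).toFunctor.map f) :=
  Cat.map_heq ((U.map_comp _ _).symm.trans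
    ((congrArg _ pushout.condition).trans (U.map_comp _ _))) f

theorem hcomp_hom_heq (P : Pro U X Y) (Q : Pro U Y Z) :
    (hcomp P Q).hom ≍ homGlue ((U.map (pushout.inl P.csp.inr Q.csp.inl)).toFunctor.map P.hom)
      (condition_obj_eq P.csp Q.csp Y.fiber)
      ((U.map (pushout.inr P.csp.inr Q.csp.inl)).toFunctor.map Q.hom) := by
  refine (homCast_heq (hcomp_left_obj P.csp Q.csp X.fiber)
    (hcomp_right_obj P.csp Q.csp Z.fiber) _).trans ?_
  unfold CommaLax.glue
  rw [map_homGlue]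
  have e₁ := inl_comp_pushoutComparison U P.csp.inr Q.csp.inl
  have e₂ := inr_comp_pushoutComparison U P.csp.inr Q.csp.inl
  exact homGlue_heq (Cat.obj_eq e₁ _) (Cat.obj_eq e₁ _) (Cat.obj_eq e₂ _)
    (Cat.map_heq e₁ _) (Cat.map_heq e₂ _)

/-- The external composite of cells, by the functoriality of pushouts. -/
@[reducible]
noncomputable def hcompCell {P : Pro U X Y} {Q : Pro U Y Z} {P' : Pro U X' Y'} {Q' : Pro U Y' Z'}
    (α : Cell U P P') (β : Cell U Q Q') (h : α.tgt = β.src) :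
    Cell U (hcomp P Q) (hcomp P' Q') where
  src := α.src
  tgt := β.tgt
  mid := (Csp.hcompMap α.cspMap β.cspMap (congrArg Grothendieck.Hom.base h)).mid
  w_left := (Csp.hcompMap α.cspMap β.cspMap _).w_left
  w_right := (Csp.hcompMap α.cspMap β.cspMap _).w_right
  comm := by
    have hα := congrArg (U.map (pushout.inl P'.csp.inr Q'.csp.inl)).toFunctor.map α.comm
    have hβ := congrArg (U.map (pushout.inr P'.csp.inr Q'.csp.inl)).toFunctor.map β.comm
    rw [Functor.map_comp, Functor.map_comp] at hα hβ
    have hk : (U.map (pushout.inl P'.csp.inr Q'.csp.inl)).toFunctor.map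
        ((U.map P'.csp.inr).toFunctor.map α.tgt.fiber) ≍
        (U.map (pushout.inr P'.csp.inr Q'.csp.inl)).toFunctor.map
        ((U.map Q'.csp.inl).toFunctor.map β.src.fiber) := by
      rw [h]
      exact condition_map_heq P'.csp Q'.csp _
    have e : (U.map (pushout.inl P'.csp.inr Q'.csp.inl)).toFunctor.obj
        ((U.map P'.csp.inr).toFunctor.obj ((U.map α.tgt.base).toFunctor.obj Y.fiber)) =
        (U.map (pushout.inr P'.csp.inr Q'.csp.inl)).toFunctor.obj
        ((U.map Q'.csp.inl).toFunctor.obj ((U.map β.src.base).toFunctor.obj Y.fiber)) := by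
      rw [h]
      exact condition_obj_eq P'.csp Q'.csp _
    have sq := sq_homGlue (e := e) (e₁ := condition_obj_eq P'.csp Q'.csp Y'.fiber) hk hα hβ
    let γ := Csp.hcompMap α.cspMap β.cspMap (congrArg Grothendieck.Hom.base h)
    have hl : ∀ {a b c : S} (i : a ⟶ b) (j : b ⟶ c) (s : U.obj a),
        (U.map j).toFunctor.obj ((U.map i).toFunctor.obj s) = (U.map (i ≫ j)).toFunctor.obj s :=
      fun i j s => (Cat.obj_eq (U.map_comp i j) s).symm
    have hm : ∀ {a b c : S} (i : a ⟶ b) (j : b ⟶ c) {s t : U.obj a} (f : s ⟶ t),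
        (U.map j).toFunctor.map ((U.map i).toFunctor.map f) ≍ (U.map (i ≫ j)).toFunctor.map f :=
      fun i j _ _ f => (Cat.map_heq (U.map_comp i j) f).symm
    refine sq_of_heq sq (hl _ _ _) (hl _ _ _) (hl _ _ _) (hl _ _ _) (hm _ _ _)
      (hcomp_hom_heq P' Q').symm ?_ (hm _ _ _)
    refine HEq.trans ?_ (mid_heq (P := hcomp P Q) (Q := hcomp P' Q') γ.w_left γ.w_right).symm
    refine HEq.trans ?_ (map_heq_map (U.map γ.mid).toFunctor (hl _ _ _) (hl _ _ _)
      (hcomp_hom_heq P Q).symm)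
    rw [map_homGlue]
    have i₁ : pushout.inl P.csp.inr Q.csp.inl ≫ γ.mid = α.mid ≫ pushout.inl _ _ :=
      pushout.inl_desc _ _ _
    have i₂ : pushout.inr P.csp.inr Q.csp.inl ≫ γ.mid = β.mid ≫ pushout.inr _ _ :=
      pushout.inr_desc _ _ _
    have o₁ : ∀ s : U.obj P.csp.apex, (U.map γ.mid).toFunctor.obj
        ((U.map (pushout.inl P.csp.inr Q.csp.inl)).toFunctor.obj s) =
        (U.map (pushout.inl P'.csp.inr Q'.csp.inl)).toFunctor.obj
          ((U.map α.mid).toFunctor.obj s) := fun s =>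
      (hl _ _ s).trans ((Cat.obj_eq (congrArg U.map i₁) s).trans (hl _ _ s).symm)
    have o₂ : ∀ s : U.obj Q.csp.apex, (U.map γ.mid).toFunctor.obj
        ((U.map (pushout.inr P.csp.inr Q.csp.inl)).toFunctor.obj s) =
        (U.map (pushout.inr P'.csp.inr Q'.csp.inl)).toFunctor.obj
          ((U.map β.mid).toFunctor.obj s) := fun s =>
      (hl _ _ s).trans ((Cat.obj_eq (congrArg U.map i₂) s).trans (hl _ _ s).symm)
    refine homGlue_heq ((congrArg _ (left_obj α.w_left _).symm).trans (o₁ _).symm)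
      ((congrArg _ (right_obj α.w_right _).symm).trans (o₁ _).symm)
      ((congrArg _ (right_obj β.w_right _).symm).trans (o₂ _).symm) ?_ ?_
    · refine (map_heq_map _ (left_obj α.w_left _).symm (right_obj α.w_right _).symm
        (mid_heq (P := P) (Q := P') α.w_left α.w_right)).trans ?_
      exact (hm _ _ _).trans ((Cat.map_heq (congrArg U.map i₁) P.hom).symm.trans (hm _ _ _).symm)
    · refine (map_heq_map _ (left_obj β.w_left _).symm (right_obj β.w_right _).symm
        (mid_heq (P := Q) (Q := Q') β.w_left β.w_right)).trans ?_
      exact (hm _ _ _).trans ((Cat.map_heq (congrArg U.map i₂) Q.hom).symm.trans (hm _ _ _).symm)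

variable (U) in
/-- The data of the double category of process theories. -/
noncomputable def doubleCategoryData : DoubleCategoryData where
  Obj := Grothendieck U
  Pro := Pro U
  Cell := Cell U
  src := Cell.src
  tgt := Cell.tgt
  idCell := idCell
  vcomp := vcomp
  hcomp := hcomp
  hcompCell := hcompCell
  hid := hid
  hidCell := hidCell

/-- The object `(a, f, b)` of the comma category given by a proarrow. -/
@[reducible]
def Pro.comma (P : Pro U X Y) :
    Comma (U.map P.csp.inl).toFunctor (U.map P.csp.inr).toFunctor where
  left := X.fiber
  right := Y.fiber
  hom := P.hom

/-- The morphism `(h', k')` of the comma category given by a cell. -/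
@[reducible]
def Cell.commaHom {P : Pro U X Y} {Q : Pro U X' Y'} (α : Cell U P Q) :
    (CommaLax.cell (Csp.mapCell U α.cspMap)).mid.toFunctor.obj P.comma ⟶ Q.comma where
  left := α.src.fiber
  right := α.tgt.fiber
  w := α.comm

/-- The comparison map on objects. -/
@[reducible]
noncomputable def comparisonObj (X : Grothendieck U) :
    Grothendieck (DoubleGrothendieck.baseFunctor ((Csp.map U).comp commaLax)) :=
  ⟨X.base, X.fiber⟩

/-- The comparison map on arrows. -/
@[reducible]
noncomputable def comparisonMap (f : X ⟶ Y) : comparisonObj X ⟶ comparisonObj Y :=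
  ⟨f.base, f.fiber⟩

/-- The comparison map on proarrows. -/
@[reducible]
noncomputable def comparisonPro (P : Pro U X Y) :
    DoubleGrothendieck.Pro ((Csp.map U).comp commaLax) (comparisonObj X) (comparisonObj Y) :=
  ⟨P.csp, P.comma, rfl, rfl⟩

/-- The comparison map on cells. -/
@[reducible]
noncomputable def comparisonCell {P : Pro U X Y} {Q : Pro U X' Y'} (α : Cell U P Q) :
    DoubleGrothendieck.Cell ((Csp.map U).comp commaLax) (comparisonPro P) (comparisonPro Q) :=
  ⟨α.cspMap, α.commaHom⟩

variable (U) in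
/-- The canonical map from the data of the double category of process theories to the double
Grothendieck construction of the composite of the lax double functors `Csp.map U` and `commaLax`.
It sends `(A, a)` to `(A, a)`, a proarrow `(m, f)` from `(A, a)` to `(B, b)` to `(m, (a, f, b))`,
and a cell with boundary arrows `(H, h')` and `(K, k')` to the underlying map of cospans together
with the morphism `(h', k')` of the comma category. -/
noncomputable def comparison : DoubleFunctorData (doubleCategoryData U)
    (DoubleGrothendieck.doubleCategory ((Csp.map U).comp commaLax)).toDoubleCategoryData where
  obj :=
    { obj := comparisonObj (U := U)
      map := comparisonMap (U := U) }
  pro := comparisonPro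
  cell := comparisonCell

end ProcessTheory

end ProcessTheories

/-! ### Globular cells and functoriality of `U` on chosen morphisms. -/

namespace ProcessTheory

variable {S : Type u} [Category.{v} S] {U : S ⥤ Cat.{w, w}}

section Globular

variable {X Y Z W X' Y' Z' W' : Grothendieck U}

/-! The result rests on two observations, both made for a functor `U : S ⥤ Cat` on a category with
pushouts and then applied to `U.toFunctor`.

A cell carries only two boundary arrows and a map of apexes; the remaining fields are propositions.
By `Cell.ext`, every double category axiom therefore splits into equations between arrows of
`Grothendieck U`, which are trivial, and one equation between maps of apexes, which is the same
axiom in the double category of cospans. The only real work is to see that the associators and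
unitors of cospans are cells at all, that is, that they carry the chosen morphism of their source to
that of their target. Here `desc_hcomp_hom_heq` is decisive: a map out of the pushout sends the
morphism of a composite proarrow to the composite of the images of its two factors. Applied to the
associator, it turns both sides into a triple composite in one category, and associativity there
concludes (`assoc_hom_heq`); for the unitors one factor becomes an identity. Inverses come for free
from `map_inv_heq`.

For the comparison, a morphism `f : i(a) ⟶ o(b)` is the same thing as an object `(a, f, b)` of the
comma category lying over `a` and `b`, and the equation required of a cell is the commuting square
of a morphism `(h', k')` of the comma category. This gives the bijections on proarrows and cells.
The laxator of the composite functor glues two morphisms in the pushout of categories and then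
applies the canonical functor, which is the recipe for external composition of process theories, so
composites agree by definition. External identities agree only up to the equation `U.map (𝟙 a) = 𝟙`.

The laxators and unitors of the comparison are lifts: their component in the apex is transport along
an equality. Lifts are closed under both compositions and are determined by their base
(`IsLift.ext`), so the remaining lax functor axioms reduce to identity laws for cospans.

Heterogeneous equality is used throughout because `U.map (i ≫ j)` and `U.map i ≫ U.map j` agree only
propositionally, so that their values on morphisms have different types. -/

theorem Cell.ext {P : Pro U X Y} {Q : Pro U X' Y'} {α β : Cell U P Q} (h : α.src = β.src)
    (h' : α.tgt = β.tgt) (h'' : α.mid = β.mid) : α = β := by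
  cases α; cases β; cases h; cases h'; cases h''; rfl

theorem Pro.ext_heq {P Q : Pro U X Y} (h : P.csp = Q.csp) (h' : P.hom ≍ Q.hom) : P = Q := by
  cases P; cases Q; cases h; cases h'; rfl

/-- The fiber of an identity in `Grothendieck U` is not an identity but a transport along `U.map (𝟙
_) = 𝟙`; any functor on the fiber still sends it to something heterogeneously equal to an identity.
This handles both vertical sides of the square in `globular`. -/
theorem map_id_fiber_heq {T : Cat.{w, w}} (X : Grothendieck U) (G : U.obj X.base ⟶ T) :
    G.toFunctor.map (Grothendieck.Hom.fiber (𝟙 X)) ≍ 𝟙 (G.toFunctor.obj X.fiber) := by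
  rw [← G.toFunctor.map_id]
  exact map_heq_map _ (Cat.obj_eq (U.map_id X.base) X.fiber) rfl (id_fiber_heq X)

/-- The cell with identity boundary arrows given by a map between the apexes that preserves the
chosen morphisms. -/
@[reducible]
def globular {P Q : Pro U X Y} (F : P.csp.apex ⟶ Q.csp.apex) (w_left : P.csp.inl ≫ F = Q.csp.inl)
    (w_right : P.csp.inr ≫ F = Q.csp.inr) (h : (U.map F).toFunctor.map P.hom ≍ Q.hom) :
    Cell U P Q where
  src := 𝟙 X
  tgt := 𝟙 Y
  mid := F
  w_left := w_left.trans (Category.id_comp _).symm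
  w_right := w_right.trans (Category.id_comp _).symm
  comm := by
    have e : ∀ Z : Grothendieck U, Z.fiber = (U.map (𝟙 Z.base)).toFunctor.obj Z.fiber := fun Z =>
      (Cat.obj_eq (U.map_id Z.base) Z.fiber).symm
    -- The required square is the trivial square `𝟙 ≫ Q.hom = Q.hom ≫ 𝟙`, transported along `U.map
    -- (𝟙 _) = 𝟙` on its vertical sides and along `h` on the horizontal side coming from `P`.
    refine sq_of_heq (f := 𝟙 _) (g := Q.hom) (h := Q.hom) (k := 𝟙 _)
      ((Category.id_comp _).trans (Category.comp_id _).symm) (congrArg _ (e X)) rfl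
      (congrArg _ (e Y)) rfl (map_id_fiber_heq X _).symm HEq.rfl ?_ (map_id_fiber_heq Y _).symm
    exact h.symm.trans (mid_heq (P := P) (Q := Q)
      (w_left.trans (Category.id_comp Q.csp.inl).symm)
      (w_right.trans (Category.id_comp Q.csp.inr).symm)).symm

/-- Applying `U.map G` to the relation `h` leaves `U.map (F ≫ G)`, an identity functor, acting on
`P.hom`. Hence the inverse of a coherence map preserves chosen morphisms as soon as the map itself
does, without a second computation in a pushout. -/
theorem map_inv_heq {P Q : Pro U X Y} {F : P.csp.apex ⟶ Q.csp.apex} {G : Q.csp.apex ⟶ P.csp.apex}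
    (w_left : P.csp.inl ≫ F = Q.csp.inl) (w_right : P.csp.inr ≫ F = Q.csp.inr)
    (h : (U.map F).toFunctor.map P.hom ≍ Q.hom) (e : F ≫ G = 𝟙 _) :
    (U.map G).toFunctor.map Q.hom ≍ P.hom := by
  have hl := Cat.obj_eq ((U.map_comp P.csp.inl F).symm.trans (congrArg U.map w_left)) X.fiber
  have hr := Cat.obj_eq ((U.map_comp P.csp.inr F).symm.trans (congrArg U.map w_right)) Y.fiber
  refine (map_heq_map _ hl.symm hr.symm h.symm).trans ?_
  exact Cat.map_heq ((U.map_comp F G).symm.trans ((congrArg U.map e).trans (U.map_id _))) P.hom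

/-- The factorization is a hypothesis rather than `k := i ≫ j`, so that pushout relations such as
`pushout.inl_desc` can be supplied directly. The next lemma is the companion on objects. -/
theorem map_comp_heq {a b c : S} {i : a ⟶ b} {j : b ⟶ c} {k : a ⟶ c} (e : i ≫ j = k)
    {s t : U.obj a} (f : s ⟶ t) :
    (U.map j).toFunctor.map ((U.map i).toFunctor.map f) ≍ (U.map k).toFunctor.map f :=
  Cat.map_heq ((U.map_comp i j).symm.trans (congrArg U.map e)) f

theorem map_comp_obj {a b c : S} {i : a ⟶ b} {j : b ⟶ c} {k : a ⟶ c} (e : i ≫ j = k)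
    (s : U.obj a) :
    (U.map j).toFunctor.obj ((U.map i).toFunctor.obj s) = (U.map k).toFunctor.obj s :=
  Cat.obj_eq ((U.map_comp i j).symm.trans (congrArg U.map e)) s

/-- Supplies the equality at the shared foot that `homGlue` needs in order to compose the images of
two consecutive morphisms in `U.obj z`. -/
theorem desc_obj_eq {a b c z : S} (m : Csp a b) (n : Csp b c) {H : m.apex ⟶ z} {K : n.apex ⟶ z}
    (w : m.inr ≫ H = n.inl ≫ K) (s : U.obj b) :
    (U.map H).toFunctor.obj ((U.map m.inr).toFunctor.obj s) =
      (U.map K).toFunctor.obj ((U.map n.inl).toFunctor.obj s) :=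
  (map_comp_obj w s).trans (map_comp_obj rfl s).symm

/-- Coherence maps of cospans have identity legs by definition, so this and `inr_mid` apply to them
with `rfl` and give the leg conditions of `globular`. -/
theorem inl_mid {a b : S} {m n : Csp a b} {α : CspMap m n} (h : α.left = 𝟙 a) :
    m.inl ≫ α.mid = n.inl := by
  rw [α.w_left, h, Category.id_comp]

theorem inr_mid {a b : S} {m n : Csp a b} {α : CspMap m n} (h : α.right = 𝟙 b) :
    m.inr ≫ α.mid = n.inr := by
  rw [α.w_right, h, Category.id_comp]

/-! ### Composite proarrows under maps out of the pushout, and the coherence cells. -/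

variable [HasPushouts S]

/-- The image of the morphism of a composite proarrow under a map out of the pushout. -/
theorem desc_hcomp_hom_heq {z : S} (P : Pro U X Y) (Q : Pro U Y Z) {H : P.csp.apex ⟶ z}
    {K : Q.csp.apex ⟶ z} {L : pushout P.csp.inr Q.csp.inl ⟶ z}
    (hl : pushout.inl P.csp.inr Q.csp.inl ≫ L = H) (hr : pushout.inr P.csp.inr Q.csp.inl ≫ L = K)
    (w : P.csp.inr ≫ H = Q.csp.inl ≫ K) :
    (U.map L).toFunctor.map (hcomp P Q).hom ≍ homGlue ((U.map H).toFunctor.map P.hom)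
      (desc_obj_eq P.csp Q.csp w Y.fiber) ((U.map K).toFunctor.map Q.hom) := by
  -- `hcomp_hom_heq` rewrites the composite inside `U` of the pushout in `S`. From here on the
  -- pushout of categories is gone, and `U.map L` simply distributes over the gluing.
  refine (map_heq_map _ (map_comp_obj rfl _).symm (map_comp_obj rfl _).symm
    (hcomp_hom_heq P Q)).trans ?_
  rw [map_homGlue]
  exact homGlue_heq (map_comp_obj hl _) (map_comp_obj hl _) (map_comp_obj hr _)
    (map_comp_heq hl _) (map_comp_heq hr _)

/-- Both sides are the composite of the images of `P.hom`, `Q.hom` and `R.hom` in the value of `U`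
at the right-bracketed pushout, bracketed in the two possible ways. -/
theorem assoc_hom_heq (P : Pro U X Y) (Q : Pro U Y Z) (R : Pro U Z W) :
    (U.map (Csp.assoc P.csp Q.csp R.csp).mid).toFunctor.map (hcomp (hcomp P Q) R).hom ≍
      (hcomp P (hcomp Q R)).hom := by
  -- `c₁` and `c₂` say that the three inclusions into the right-bracketed pushout agree on the two
  -- intermediate feet, so that the images of the three morphisms can be glued there.
  have c₁ : P.csp.inr ≫ pushout.inl P.csp.inr (Q.csp.hcomp R.csp).inl =
      Q.csp.inl ≫ pushout.inl Q.csp.inr R.csp.inl ≫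
        pushout.inr P.csp.inr (Q.csp.hcomp R.csp).inl :=
    (Csp.condition P.csp (Q.csp.hcomp R.csp)).trans (Category.assoc _ _ _)
  have c₂ := Csp.condition_assoc Q.csp R.csp (pushout.inr P.csp.inr (Q.csp.hcomp R.csp).inl)
  refine (desc_hcomp_hom_heq (hcomp P Q) R (pushout.inl_desc _ _ _) (pushout.inr_desc _ _ _)
    ?_).trans ?_
  · rw [Category.assoc, pushout.inr_desc]
    exact c₂
  -- The left factor is itself the image of a composite, now under the inner `pushout.desc` of the
  -- associator, and is expanded by the same lemma.
  refine (homGlue_heq (h₁ := desc_obj_eq Q.csp R.csp c₂ Z.fiber) ?_ ?_ rfl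
    (desc_hcomp_hom_heq P Q (pushout.inl_desc _ _ _) (pushout.inr_desc _ _ _) c₁)
    HEq.rfl).trans ?_
  · exact (congrArg _ (map_comp_obj rfl X.fiber).symm).trans (map_comp_obj (pushout.inl_desc _ _ _) _)
  · exact (congrArg _ (map_comp_obj rfl Z.fiber).symm).trans (map_comp_obj (pushout.inr_desc _ _ _) _)
  -- After rebracketing, the last two factors are the image of `hcomp Q R` under the second
  -- inclusion, and the first is the image of `P.hom` under the first inclusion.
  rw [homGlue_assoc]
  refine HEq.trans ?_ (hcomp_hom_heq P (hcomp Q R)).symm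
  exact homGlue_heq rfl rfl
    ((map_comp_obj rfl _).symm.trans (congrArg _ (map_comp_obj rfl W.fiber))) HEq.rfl
    (desc_hcomp_hom_heq Q R rfl rfl c₂).symm

/-- The left unitor is `inl` on the first summand and the identity on the second. The morphism of
`hid X` is an identity, hence so is its image, and only `P.hom` survives in the gluing.
`rightUnitor_hom_heq` is the mirror image. -/
theorem leftUnitor_hom_heq (P : Pro U X Y) :
    (U.map (Csp.leftUnitor P.csp).mid).toFunctor.map (hcomp (hid X) P).hom ≍ P.hom := by
  refine (desc_hcomp_hom_heq (hid X) P (pushout.inl_desc _ _ _) (pushout.inr_desc _ _ _)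
    ((Category.id_comp _).trans (Category.comp_id _).symm)).trans ?_
  refine (homGlue_id_left ?_ ?_).trans (Cat.map_heq (U.map_id _) P.hom)
  · rfl
  · exact heq_of_eq ((U.map P.csp.inl).toFunctor.map_id _)

theorem rightUnitor_hom_heq (P : Pro U X Y) :
    (U.map (Csp.rightUnitor P.csp).mid).toFunctor.map (hcomp P (hid Y)).hom ≍ P.hom := by
  refine (desc_hcomp_hom_heq P (hid Y) (pushout.inl_desc _ _ _) (pushout.inr_desc _ _ _)
    ((Category.comp_id _).trans (Category.id_comp _).symm)).trans ?_
  refine (homGlue_id_right ?_ ?_).trans (Cat.map_heq (U.map_id _) P.hom)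
  · rfl
  · exact heq_of_eq ((U.map P.csp.inr).toFunctor.map_id _)

/-- The associator. -/
@[reducible]
noncomputable def assoc (P : Pro U X Y) (Q : Pro U Y Z) (R : Pro U Z W) :
    Cell U (hcomp (hcomp P Q) R) (hcomp P (hcomp Q R)) :=
  globular (Csp.assoc P.csp Q.csp R.csp).mid (inl_mid rfl) (inr_mid rfl) (assoc_hom_heq P Q R)

/-- The inverse of the associator. -/
@[reducible]
noncomputable def assocInv (P : Pro U X Y) (Q : Pro U Y Z) (R : Pro U Z W) :
    Cell U (hcomp P (hcomp Q R)) (hcomp (hcomp P Q) R) :=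
  globular (Csp.assocInv P.csp Q.csp R.csp).mid (inl_mid rfl) (inr_mid rfl)
    (map_inv_heq (P := hcomp (hcomp P Q) R) (Q := hcomp P (hcomp Q R)) (F := (Csp.assoc P.csp Q.csp R.csp).mid) (inl_mid rfl) (inr_mid rfl) (assoc_hom_heq P Q R)
      (congrArg CspMap.mid (Csp.assoc_assocInv P.csp Q.csp R.csp)))

/-- The left unitor. -/
@[reducible]
noncomputable def leftUnitor (P : Pro U X Y) : Cell U (hcomp (hid X) P) P :=
  globular (Csp.leftUnitor P.csp).mid (inl_mid rfl) (inr_mid rfl) (leftUnitor_hom_heq P)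

/-- The inverse of the left unitor. -/
@[reducible]
noncomputable def leftUnitorInv (P : Pro U X Y) : Cell U P (hcomp (hid X) P) :=
  globular (Csp.leftUnitorInv P.csp).mid (inl_mid rfl) (inr_mid rfl)
    (map_inv_heq (P := hcomp (hid X) P) (Q := P) (F := (Csp.leftUnitor P.csp).mid) (inl_mid rfl) (inr_mid rfl) (leftUnitor_hom_heq P)
      (congrArg CspMap.mid (Csp.leftUnitor_leftUnitorInv P.csp)))

/-- The right unitor. -/
@[reducible]
noncomputable def rightUnitor (P : Pro U X Y) : Cell U (hcomp P (hid Y)) P :=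
  globular (Csp.rightUnitor P.csp).mid (inl_mid rfl) (inr_mid rfl) (rightUnitor_hom_heq P)

/-- The inverse of the right unitor. -/
@[reducible]
noncomputable def rightUnitorInv (P : Pro U X Y) : Cell U P (hcomp P (hid Y)) :=
  globular (Csp.rightUnitorInv P.csp).mid (inl_mid rfl) (inr_mid rfl)
    (map_inv_heq (P := hcomp P (hid Y)) (Q := P) (F := (Csp.rightUnitor P.csp).mid) (inl_mid rfl) (inr_mid rfl) (rightUnitor_hom_heq P)
      (congrArg CspMap.mid (Csp.rightUnitor_rightUnitorInv P.csp)))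

/-! ### The double category axioms for process theories. -/

variable (U) in
/-- Process theories form a double category. -/
noncomputable def doubleCategoryStructure : (doubleCategoryData U).Structure where
  id_vcomp _ := Cell.ext (Category.id_comp _) (Category.id_comp _) (Category.id_comp _)
  vcomp_id _ := Cell.ext (Category.comp_id _) (Category.comp_id _) (Category.comp_id _)
  vcomp_assoc _ _ _ :=
    Cell.ext (Category.assoc _ _ _) (Category.assoc _ _ _) (Category.assoc _ _ _)
  src_idCell _ := rfl
  tgt_idCell _ := rfl
  src_vcomp _ _ := rfl
  tgt_vcomp _ _ := rfl
  src_hcompCell _ _ _ := rfl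
  tgt_hcompCell _ _ _ := rfl
  src_hidCell _ := rfl
  tgt_hidCell _ := rfl
  -- External composition keeps the outer boundary arrows unchanged, so only the equation between
  -- maps of apexes has content, and that is the corresponding law for cospans.
  hcompCell_id P Q := Cell.ext rfl rfl (congrArg CspMap.mid (Csp.hcompMap_id P.csp Q.csp))
  hcompCell_vcomp α α' β β' h h' := Cell.ext rfl rfl (congrArg CspMap.mid
    (Csp.hcompMap_vcomp α.cspMap α'.cspMap β.cspMap β'.cspMap
      (congrArg Grothendieck.Hom.base h) (congrArg Grothendieck.Hom.base h')))
  hidCell_id _ := rfl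
  hidCell_comp _ _ := rfl
  assoc := assoc
  assocInv := assocInv
  leftUnitor := leftUnitor
  leftUnitorInv := leftUnitorInv
  rightUnitor := rightUnitor
  rightUnitorInv := rightUnitorInv
  assoc_assocInv P Q R := Cell.ext (Category.id_comp _) (Category.id_comp _)
    (congrArg CspMap.mid (Csp.assoc_assocInv P.csp Q.csp R.csp))
  assocInv_assoc P Q R := Cell.ext (Category.id_comp _) (Category.id_comp _)
    (congrArg CspMap.mid (Csp.assocInv_assoc P.csp Q.csp R.csp))
  leftUnitor_leftUnitorInv P := Cell.ext (Category.id_comp _) (Category.id_comp _)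
    (congrArg CspMap.mid (Csp.leftUnitor_leftUnitorInv P.csp))
  leftUnitorInv_leftUnitor P := Cell.ext (Category.id_comp _) (Category.id_comp _)
    (congrArg CspMap.mid (Csp.leftUnitorInv_leftUnitor P.csp))
  rightUnitor_rightUnitorInv P := Cell.ext (Category.id_comp _) (Category.id_comp _)
    (congrArg CspMap.mid (Csp.rightUnitor_rightUnitorInv P.csp))
  rightUnitorInv_rightUnitor P := Cell.ext (Category.id_comp _) (Category.id_comp _)
    (congrArg CspMap.mid (Csp.rightUnitorInv_rightUnitor P.csp))
  src_assoc _ _ _ := rfl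
  tgt_assoc _ _ _ := rfl
  src_leftUnitor _ := rfl
  tgt_leftUnitor _ := rfl
  src_rightUnitor _ := rfl
  tgt_rightUnitor _ := rfl
  -- The associator and unitors have identity boundaries, so naturality on each boundary reads `f ≫
  -- 𝟙 = 𝟙 ≫ f`.
  assoc_naturality α β γ h h' := Cell.ext
    ((Category.comp_id _).trans (Category.id_comp _).symm)
    ((Category.comp_id _).trans (Category.id_comp _).symm)
    (congrArg CspMap.mid (Csp.assoc_naturality α.cspMap β.cspMap γ.cspMap
      (congrArg Grothendieck.Hom.base h) (congrArg Grothendieck.Hom.base h')))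
  leftUnitor_naturality α := Cell.ext
    ((Category.comp_id _).trans (Category.id_comp _).symm)
    ((Category.comp_id _).trans (Category.id_comp _).symm)
    (congrArg CspMap.mid (Csp.leftUnitor_naturality α.cspMap))
  rightUnitor_naturality α := Cell.ext
    ((Category.comp_id _).trans (Category.id_comp _).symm)
    ((Category.comp_id _).trans (Category.id_comp _).symm)
    (congrArg CspMap.mid (Csp.rightUnitor_naturality α.cspMap))
  triangle P Q := Cell.ext (Category.id_comp _) (Category.id_comp _)
    (congrArg CspMap.mid (Csp.triangle P.csp Q.csp))
  pentagon P Q R T := Cell.ext (Category.comp_id _) (Category.comp_id _)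
    (congrArg CspMap.mid (Csp.pentagon P.csp Q.csp R.csp T.csp))

end Globular

end ProcessTheory

/-! ### Recognizing identities in the Grothendieck construction and in comma categories. -/

namespace DoubleGrothendieck

variable {A : DoubleCategory.{w, x, v, u}} {F : LaxDoubleFunctor A Spn.doubleCategory.{v', u'}}
  {X Y : Grothendieck (baseFunctor F)}

/-- A lift between proarrows that are only propositionally equal need not have the type of an
identity cell. Substituting the equality makes the types coincide, and two lifts with the same base
are equal. It serves for the unitor condition of `IsStrictIso`. -/
theorem IsLift.heq_idCell {P Q : Pro F X Y} {α : Cell F P Q} (hα : IsLift α) (h : P = Q)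
    (h' : α.base ≍ A.idCell Q.base) : α ≍ idCell Q := by
  subst h
  exact heq_of_eq (hα.ext (idCell_isLift _) (eq_of_heq h'))

end DoubleGrothendieck

namespace CommaLax

/-- If both components of a comma morphism are transports, its commuting square forces the two
structure morphisms to agree as well. The objects are then equal and the morphism is itself a
transport. -/
theorem exists_eq_eqToHom {A B X : Type w} [Category.{w} A] [Category.{w} B] [Category.{w} X]
    {F : A ⥤ X} {G : B ⥤ X} {s t : Comma F G} (f : s ⟶ t) (hl : s.left = t.left)
    (hr : s.right = t.right) (hl' : f.left = eqToHom hl) (hr' : f.right = eqToHom hr) :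
    ∃ h : s = t, f = eqToHom h := by
  have h : s = t := by
    -- Once the endpoints are identified, both vertical sides of this square become identities, and
    -- what remains is the equality of the structure morphisms.
    have w := f.w
    rw [hl', hr'] at w
    cases s; cases t
    cases hl; cases hr
    simp only [eqToHom_refl, CategoryTheory.Functor.map_id, Category.id_comp, Category.comp_id] at w
    cases w; rfl
  subst h
  exact ⟨rfl, CommaMorphism.ext hl' hr'⟩

end CommaLax

/-! ### The comparison with the double Grothendieck construction as a lax double functor. -/

namespace ProcessTheory

variable {S : Type u} [Category.{v} S] {U : S ⥤ Cat.{w, w}} [HasPushouts S]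

section Comparison

variable {X Y Z X' Y' Z' X'' Y'' : Grothendieck U}

/-- The unitor of the composite functor takes `𝟙 X.fiber` and transports it along `U.map_id`,
whereas `hid X` takes the identity at `(U.map (𝟙 X.base)).toFunctor.obj X.fiber`. The comma objects
have the same ends, so it suffices to compare these two morphisms; `U.map_id` identifies them. This
is the one place where the comparison of proarrows is not definitional. -/
theorem comparisonPro_hid (X : Grothendieck U) :
    DoubleGrothendieck.hid (comparisonObj X) = comparisonPro (hid X) := by
  have h := (homCast_heq (Cat.obj_eq (U.map_id X.base).symm X.fiber)
    (Cat.obj_eq (U.map_id X.base).symm X.fiber) (𝟙 X.fiber)).trans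
    (show 𝟙 X.fiber ≍ (hid X).hom by
      change _ ≍ 𝟙 ((U.map (𝟙 X.base)).toFunctor.obj X.fiber)
      rw [U.map_id]; rfl)
  exact DoubleGrothendieck.Pro.ext rfl (heq_of_eq (CommaLax.comma_ext
    (F := (U.map (𝟙 X.base)).toFunctor) (G := (U.map (𝟙 X.base)).toFunctor) rfl rfl h))

/-- The two bases are definitionally the same cospan, so the heterogeneous equality of fibers is a
genuine equality. It provides the target of the lift `comparisonUnitor`. -/
theorem comparisonPro_hid_fiber (X : Grothendieck U) :
    (DoubleGrothendieck.hid (comparisonObj X)).fiber = (comparisonPro (hid X)).fiber :=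
  eq_of_heq (congr_arg_heq DoubleGrothendieck.Pro.fiber (comparisonPro_hid X))

/-- The left leg of a comma span projects `(h', k')` to `h'`, so the boundary recovered in the
Grothendieck construction is the original arrow up to a cast. The case of `tgt` is the same with the
right leg. -/
theorem comparison_src {P : Pro U X Y} {Q : Pro U X' Y'} (α : Cell U P Q) :
    DoubleGrothendieck.src (comparisonCell α) = comparisonMap α.src :=
  DoubleGrothendieck.grothendieck_ext rfl (DoubleGrothendieck.src_fiber_heq _)

theorem comparison_tgt {P : Pro U X Y} {Q : Pro U X' Y'} (α : Cell U P Q) :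
    DoubleGrothendieck.tgt (comparisonCell α) = comparisonMap α.tgt :=
  DoubleGrothendieck.grothendieck_ext rfl (DoubleGrothendieck.tgt_fiber_heq _)

/-- The comparison map sends globular cells with identity boundary arrows to lifts. -/
theorem comparisonCell_isLift {P Q : Pro U X Y} (α : Cell U P Q) (hs : α.src = 𝟙 X)
    (ht : α.tgt = 𝟙 Y) : DoubleGrothendieck.IsLift (comparisonCell α) := by
  -- Taking the cell apart turns its boundary arrows into variables, which can then be replaced by
  -- identities. Their fibers are transports by `Grothendieck.id_fiber`, so the comma morphism `(h',
  -- k')` is one too.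
  obtain ⟨s, t, F, h₁, h₂, c⟩ := α
  subst hs ht
  refine CommaLax.exists_eq_eqToHom (F := (U.map Q.csp.inl).toFunctor)
    (G := (U.map Q.csp.inr).toFunctor) (comparisonCell ⟨𝟙 X, 𝟙 Y, F, h₁, h₂, c⟩).fiber
    (Cat.obj_eq (U.map_id X.base) X.fiber) (Cat.obj_eq (U.map_id Y.base) Y.fiber) ?_ ?_
  · exact Grothendieck.id_fiber X
  · exact Grothendieck.id_fiber Y

theorem comparisonCell_idCell (P : Pro U X Y) :
    comparisonCell (idCell P) = DoubleGrothendieck.idCell (comparisonPro P) :=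
  (comparisonCell_isLift _ rfl rfl).ext (DoubleGrothendieck.idCell_isLift _)
    rfl

/-- The bases are composed componentwise on both sides. A comma morphism is determined by its two
components, and each of these composes by the rule for fibers in a Grothendieck construction. -/
theorem comparisonCell_vcomp {P : Pro U X Y} {Q : Pro U X' Y'} {R : Pro U X'' Y''}
    (α : Cell U P Q) (β : Cell U Q R) :
    comparisonCell (vcomp α β) =
      DoubleGrothendieck.vcomp (comparisonCell α) (comparisonCell β) := by
  refine DoubleGrothendieck.Cell.ext rfl
    (HEq.trans ?_ (DoubleGrothendieck.vcomp_fiber_heq _ _).symm)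
  exact CommaLax.commaHom_heq (F := (U.map R.csp.inl).toFunctor)
    (G := (U.map R.csp.inr).toFunctor) (Cat.obj_eq (DoubleGrothendieck.vcomp_eq
    (F := (Csp.map U).comp commaLax) α.cspMap β.cspMap) P.comma) rfl
    (comp_fiber_heq _ _) (comp_fiber_heq _ _)

theorem comparison_tgt_eq_src {P : Pro U X Y} {Q : Pro U Y Z} {P' : Pro U X' Y'}
    {Q' : Pro U Y' Z'} {α : Cell U P P'} {β : Cell U Q Q'} (h : α.tgt = β.src) :
    DoubleGrothendieck.tgt (comparisonCell α) = DoubleGrothendieck.src (comparisonCell β) := by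
  rw [comparison_tgt, comparison_src, h]

/-- On morphisms the comma laxator keeps the left component of the first and the right component of
the second, exactly as `hcompCell` keeps the outer boundaries. Only the equality of the source
objects needs an argument, and it is the naturality of the laxator. -/
theorem comparisonCell_hcompCell {P : Pro U X Y} {Q : Pro U Y Z} {P' : Pro U X' Y'}
    {Q' : Pro U Y' Z'} (α : Cell U P P') (β : Cell U Q Q') (h : α.tgt = β.src) :
    comparisonCell (hcompCell α β h) = DoubleGrothendieck.hcompCell (comparisonCell α)
      (comparisonCell β) (comparison_tgt_eq_src h) := by
  refine DoubleGrothendieck.Cell.ext rfl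
    (HEq.trans ?_ (DoubleGrothendieck.hcompCell_fiber_heq _ _ _).symm)
  exact CommaLax.commaHom_heq (F := (U.map (hcomp P' Q').csp.inl).toFunctor)
    (G := (U.map (hcomp P' Q').csp.inr).toFunctor) (Cat.obj_eq (DoubleGrothendieck.hcompCell_eq
    (F := (Csp.map U).comp commaLax) α.cspMap β.cspMap (congrArg Grothendieck.Hom.base h))
    ⟨P.comma, Q.comma, rfl⟩) rfl HEq.rfl HEq.rfl

/-- The laxator of the comparison functor, an identity. -/
@[reducible]
noncomputable def comparisonLaxator (P : Pro U X Y) (Q : Pro U Y Z) :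
    DoubleGrothendieck.Cell ((Csp.map U).comp commaLax)
      (DoubleGrothendieck.hcomp (comparisonPro P) (comparisonPro Q)) (comparisonPro (hcomp P Q)) :=
  DoubleGrothendieck.idCell (comparisonPro (hcomp P Q))

/-- The unitor of the comparison functor, an identity up to an equality of proarrows. -/
@[reducible]
noncomputable def comparisonUnitor (X : Grothendieck U) :
    DoubleGrothendieck.Cell ((Csp.map U).comp commaLax)
      (DoubleGrothendieck.hid (comparisonObj X)) (comparisonPro (hid X)) :=
  DoubleGrothendieck.lift (Csp.idMap (Csp.hid X.base))
    ((DoubleGrothendieck.id_obj (DoubleGrothendieck.hid (comparisonObj X))).trans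
      (comparisonPro_hid_fiber X))

theorem comparisonLaxator_isLift (P : Pro U X Y) (Q : Pro U Y Z) :
    DoubleGrothendieck.IsLift (comparisonLaxator P Q) :=
  DoubleGrothendieck.idCell_isLift _

theorem comparisonUnitor_isLift (X : Grothendieck U) :
    DoubleGrothendieck.IsLift (comparisonUnitor X) :=
  DoubleGrothendieck.lift_isLift _ _

/-- Since the unitors are lifts, composing with them does not change the fiber up to heterogeneous
equality. On both sides it is the comma morphism with both components `f.fiber`. -/
theorem comparisonUnitor_naturality (f : X ⟶ Y) :
    DoubleGrothendieck.vcomp (DoubleGrothendieck.hidCell (comparisonMap f)) (comparisonUnitor Y) =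
      DoubleGrothendieck.vcomp (comparisonUnitor X) (comparisonCell (hidCell f)) := by
  refine DoubleGrothendieck.Cell.ext ?_ ?_
  · exact ((Csp.doubleCategory S).str.vcomp_id (Csp.hidMap f.base)).trans
      ((Csp.doubleCategory S).str.id_vcomp (Csp.hidMap f.base)).symm
  refine (DoubleGrothendieck.vcomp_fiber_right _ _ (comparisonUnitor_isLift Y)).trans
    (HEq.trans ?_ (DoubleGrothendieck.vcomp_fiber_left _ _ (comparisonUnitor_isLift X)).symm)
  have e := Cat.obj_eq (DoubleGrothendieck.hidCell_eq (F := (Csp.map U).comp commaLax) f.base)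
    X.fiber
  refine (map_heq_map _ e rfl (DoubleGrothendieck.hidCell_fiber_heq (comparisonMap f))).trans ?_
  -- The base of `comparisonUnitor Y` is an identity map of cospans, so the functor between apexes
  -- assigned to it is the identity.
  refine (Cat.map_heq (congrArg SpnMap.mid (((Csp.map U).comp commaLax).cell_id
    (Csp.hid Y.base))) _).trans ?_
  exact CommaLax.commaHom_heq (F := (U.map (𝟙 Y.base)).toFunctor)
    (G := (U.map (𝟙 Y.base)).toFunctor)
    (e.symm.trans (congrArg (DoubleGrothendieck.spanMap ((Csp.map U).comp commaLax)
      (Csp.hidMap f.base)).mid.toFunctor.obj (comparisonPro_hid_fiber X)))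
    (comparisonPro_hid_fiber Y) HEq.rfl HEq.rfl

theorem csp_id_vcomp {a b c d : S} {m : Csp a b} {n : Csp c d} (α : CspMap m n) :
    Csp.vcomp (Csp.idMap m) α = α :=
  (Csp.doubleCategory S).str.id_vcomp α

theorem csp_vcomp_id {a b c d : S} {m : Csp a b} {n : Csp c d} (α : CspMap m n) :
    Csp.vcomp α (Csp.idMap n) = α :=
  (Csp.doubleCategory S).str.vcomp_id α

/-- In the coherence axioms of `comparisonLax`, every laxator and unitor has an identity base. This
and the next lemma strip those identities from the two sides, leaving the bare coherence map of
cospans. -/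
theorem csp_hcompMap_id_vcomp {a b c a' c' : S} (m : Csp a b) (n : Csp b c) {p : Csp a' c'}
    (α : CspMap (m.hcomp n) p) :
    Csp.vcomp (Csp.vcomp (Csp.hcompMap (Csp.idMap m) (Csp.idMap n) rfl)
      (Csp.idMap (m.hcomp n))) α = α := by
  rw [Csp.hcompMap_id, csp_id_vcomp, csp_id_vcomp]

theorem csp_vcomp_hcompMap_id {a b c a' c' : S} (m : Csp a b) (n : Csp b c) {p : Csp a' c'}
    (α : CspMap p (m.hcomp n)) :
    Csp.vcomp (Csp.vcomp α (Csp.hcompMap (Csp.idMap m) (Csp.idMap n) rfl))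
      (Csp.idMap (m.hcomp n)) = α := by
  rw [Csp.hcompMap_id, csp_vcomp_id, csp_vcomp_id]

variable (U) in
/-- The comparison map as a lax double functor, whose laxators and unitors are identities up to
equality of proarrows. -/
noncomputable def comparisonLax :
    LaxDoubleFunctor ⟨doubleCategoryData U, doubleCategoryStructure U⟩
      (DoubleGrothendieck.doubleCategory ((Csp.map U).comp commaLax)) where
  toDoubleFunctorData := comparison U
  src_cell := comparison_src
  tgt_cell := comparison_tgt
  cell_id := comparisonCell_idCell
  cell_vcomp := comparisonCell_vcomp
  laxator := comparisonLaxator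
  unitor := comparisonUnitor
  src_laxator P Q := (comparisonLaxator_isLift P Q).src rfl
  tgt_laxator P Q := (comparisonLaxator_isLift P Q).tgt rfl
  src_unitor X := (comparisonUnitor_isLift X).src rfl
  tgt_unitor X := (comparisonUnitor_isLift X).tgt rfl
  -- The laxators are identity cells, so naturality is just the preservation of external composites
  -- of cells.
  laxator_naturality α β h :=
    ((DoubleGrothendieck.vcomp_id _).trans (comparisonCell_hcompCell α β h).symm).trans
      (DoubleGrothendieck.id_vcomp _).symm
  unitor_naturality := comparisonUnitor_naturality
  laxator_assoc P Q R :=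
    -- All cells in the associativity and unit axioms are lifts: the constraints and coherence cells
    -- of the target by construction, the images of the coherence cells by `comparisonCell_isLift`.
    -- Only their bases must be compared.
    DoubleGrothendieck.IsLift.ext
      ((((comparisonLaxator_isLift P Q).hcompCell (DoubleGrothendieck.idCell_isLift _) _).vcomp
        (comparisonLaxator_isLift _ R)).vcomp (comparisonCell_isLift (assoc P Q R) rfl rfl))
      (((DoubleGrothendieck.assoc_isLift _ _ _).vcomp
        ((DoubleGrothendieck.idCell_isLift _).hcompCell (comparisonLaxator_isLift Q R) _)).vcomp
          (comparisonLaxator_isLift P _))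
      ((csp_hcompMap_id_vcomp _ _ (Csp.assoc P.csp Q.csp R.csp)).trans
        (csp_vcomp_hcompMap_id _ _ (Csp.assoc P.csp Q.csp R.csp)).symm)
  laxator_leftUnitor P :=
    DoubleGrothendieck.IsLift.ext
      ((((comparisonUnitor_isLift _).hcompCell (DoubleGrothendieck.idCell_isLift _) _).vcomp
        (comparisonLaxator_isLift _ P)).vcomp (comparisonCell_isLift (leftUnitor P) rfl rfl))
      (DoubleGrothendieck.leftUnitor_isLift _)
      (csp_hcompMap_id_vcomp _ _ (Csp.leftUnitor P.csp))
  laxator_rightUnitor P :=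
    DoubleGrothendieck.IsLift.ext
      ((((DoubleGrothendieck.idCell_isLift _).hcompCell (comparisonUnitor_isLift _) _).vcomp
        (comparisonLaxator_isLift P _)).vcomp (comparisonCell_isLift (rightUnitor P) rfl rfl))
      (DoubleGrothendieck.rightUnitor_isLift _)
      (csp_hcompMap_id_vcomp _ _ (Csp.rightUnitor P.csp))

/-! ### The comparison is a strict isomorphism. -/

/-- The base functor of the composite is `U ⋙ 𝟭 _`, whose values unfold to those of `U`; repackaging
the two fields is therefore an inverse in both directions. The bijection on objects works the same
way. -/
theorem comparisonMap_bijective (X Y : Grothendieck U) :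
    Function.Bijective (comparisonMap : (X ⟶ Y) → _) :=
  ⟨fun _ _ h => congrArg (fun k : comparisonObj X ⟶ comparisonObj Y =>
    (⟨k.base, k.fiber⟩ : X ⟶ Y)) h, fun k => ⟨⟨k.base, k.fiber⟩, rfl⟩⟩

theorem comma_hom_heq {A B T : Type w} [Category.{w} A] [Category.{w} B] [Category.{w} T]
    {F : A ⥤ T} {G : B ⥤ T} {s t : Comma F G} (h : s = t) : s.hom ≍ t.hom := by
  rw [h]

/-- An object of the comma category with prescribed ends is just its structure morphism, so over a
fixed cospan the two notions of proarrow carry the same information. -/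
theorem comparisonPro_bijective (X Y : Grothendieck U) :
    Function.Bijective (comparisonPro : Pro U X Y → _) := by
  constructor
  · rintro ⟨m, f⟩ ⟨m', f'⟩ h
    have h₁ : m = m' := congrArg DoubleGrothendieck.Pro.base h
    subst h₁
    have h₂ := eq_of_heq (DoubleGrothendieck.Pro.ext_iff.1 h).2
    exact Pro.ext_heq rfl (comma_hom_heq (F := (U.map m.inl).toFunctor)
      (G := (U.map m.inr).toFunctor) h₂)
  -- With `X` and `Y` taken apart, the ends of the comma object are equated with the free variables
  -- `x` and `y`, which allows them to be substituted.
  · obtain ⟨a, x⟩ := X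
    obtain ⟨b, y⟩ := Y
    rintro ⟨m, s, h, h'⟩
    change Csp a b at m
    change Comma (U.map m.inl).toFunctor (U.map m.inr).toFunctor at s
    obtain ⟨l, r, f⟩ := s
    change l = x at h
    change r = y at h'
    subst h h'
    exact ⟨⟨m, f⟩, rfl⟩

theorem comparisonCell_bijective {P : Pro U X Y} {Q : Pro U X' Y'} :
    Function.Bijective (comparisonCell : Cell U P Q → _) := by
  constructor
  · intro α β h
    refine Cell.ext ((comparisonMap_bijective _ _).1 ?_) ((comparisonMap_bijective _ _).1 ?_) ?_
    -- The boundary arrows are read off from those of the image cell, which avoids comparing comma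
    -- morphisms with different source objects.
    · rw [← comparison_src, ← comparison_src, h]
    · rw [← comparison_tgt, ← comparison_tgt, h]
    · exact congrArg (fun γ : DoubleGrothendieck.Cell _ (comparisonPro P) (comparisonPro Q) =>
        CspMap.mid γ.base) h
  · rintro ⟨γ, c⟩
    change CspMap P.csp Q.csp at γ
    change (CommaLax.cell (Csp.mapCell U γ)).mid.toFunctor.obj P.comma ⟶
      (Q.comma : Comma (U.map Q.csp.inl).toFunctor (U.map Q.csp.inr).toFunctor) at c
    -- Each boundary arrow combines a leg of the cospan map with a component of the comma morphism,
    -- and the square `c.w` is the condition `comm`.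
    exact ⟨⟨⟨γ.left, c.left⟩, ⟨γ.right, c.right⟩, γ.mid, γ.w_left, γ.w_right, c.w⟩, rfl⟩

theorem comparisonObj_bijective :
    Function.Bijective (comparisonObj : Grothendieck U → _) :=
  ⟨fun _ _ h => congrArg (fun Z : Grothendieck
    (DoubleGrothendieck.baseFunctor ((Csp.map U).comp commaLax)) =>
      (⟨Z.base, Z.fiber⟩ : Grothendieck U)) h, fun Z => ⟨⟨Z.base, Z.fiber⟩, rfl⟩⟩

variable (U) in
theorem comparisonLax_isStrictIso : (comparisonLax U).IsStrictIso where
  obj_bijective := comparisonObj_bijective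
  map_bijective := comparisonMap_bijective
  pro_bijective := comparisonPro_bijective
  cell_bijective _ _ := comparisonCell_bijective
  -- The laxator of the composite functor is the comma laxator followed by the comma image of the
  -- pushout comparison; on objects this unfolds to the definition of `hcomp`.
  pro_hcomp _ _ := rfl
  pro_hid := comparisonPro_hid
  laxator_heq _ _ := HEq.rfl
  -- The unitor runs between propositionally equal proarrows and its base is an identity, so it is
  -- an identity cell only after transport along `comparisonPro_hid`.
  unitor_heq X := (comparisonUnitor_isLift X).heq_idCell (comparisonPro_hid X) HEq.rfl

end Comparison

end ProcessTheory

/-- The equation on `toDoubleFunctorData` ties the isomorphism to the prescribed assignments on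
objects, arrows, proarrows and cells. Strictness is part of `IsStrictIso`, which also asks that the
laxators and unitors be identities. -/
theorem mainTheorem5 {C : Type u} [Bicategory.{w', v} C] [Bicategory.Strict C] [HasPushouts C]
    (U : StrictPseudofunctor C Cat.{w, w}) :
    ∃ (S : (ProcessTheory.doubleCategoryData U.toFunctor).Structure)
      (Φ : LaxDoubleFunctor ⟨ProcessTheory.doubleCategoryData U.toFunctor, S⟩
        (DoubleGrothendieck.doubleCategory ((Csp.map U.toFunctor).comp commaLax))),
      Φ.toDoubleFunctorData = ProcessTheory.comparison U.toFunctor ∧ Φ.IsStrictIso :=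
  ⟨ProcessTheory.doubleCategoryStructure U.toFunctor, ProcessTheory.comparisonLax U.toFunctor,
    rfl, ProcessTheory.comparisonLax_isStrictIso U.toFunctor⟩
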